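/- **Setting.** An $n$-legged spider mechanism in $\mathbb R^2$ consists of pairwise distinct feet $A_1,\dots,A_n\in\mathbb R^2$, integers $p_1,\dots,p_n>1$ and lengths $\ell_{i,j}>0$ ($1\le i\le n$, $1\le j\le p_i$). Its spider space $\mathcal S$ is the set of all positions $\xi=(X,(A_i^j)_{1\le i\le n,\,1\le j\le p_i-1})$ of points of $\mathbb R^2$ with $|A_i^{j-1}A_i^{j}|=\ell_{i,j}$ for $1\le j\le p_i$, where $A_i^0=A_i$ and $A_i^{p_i}=X$. The broken line $\mathcal L_i=A_i^0A_i^1\cdots A_i^{p_i}$ is the $i$-th leg; it is aligned if it fits in a straight line. For a broken line, aligned in a straight line and with distinct end points, $Pos$ denotes the number of its edges that are codirected with the vector from its start point to its end point. Put $M(\mathcal L_i)=Pos(\mathcal L_i)-1$ and $M(\mathcal L_i,Z)=Pos(z\mathcal L_i)-1$, where $z\mathcal L_i$ is the broken line $ZA_i^0A_i^1\cdots A_i^{p_i}$. The polygon space of a list of lengths is the space of closed polygons in $\mathbb R^2$ with these consecutive edge lengths, modulo orientation preserving isometries of $\mathbb R^2$. For a point $X$, let $P_j(X)$ be the polygon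 space of the lengths $\ell_{j,1},\dots,\ell_{j,p_j},|XA_j|$ if $X\ne A_j$, and the product of the polygon space of $\ell_{j,1},\dots,\ell_{j,p_j}$ with a circle $S^1$ if $X=A_j$. The mechanism together with a point $Z\in\mathbb R^2$ is strongly generic if: no configuration has more than two aligned legs; two aligned legs of a configuration are never parallel (in particular, never on the same line); if two legs of a configuration are aligned, then $Z$ lies on neither of their lines; $Z\neq A_i$ for all $i$; and $X\ne Z$ in every configuration with an aligned leg. **Theorem.** Suppose that the mechanism and the point $Z$ are strongly generic. Then $\mathcal S$ is a smooth embedded submanifold, the function $\mathbb D(\xi)=\|x-z\|^2$ on $\mathcal S$ is a Morse–Bott function, and a configuration is critical for $\mathbb D$ if and only if it is of one of the kinds (1)–(3). In each case the indicated set $C$ of configurations is a submanifold consisting of critical points and is open and closed in the critical set of $\mathbb D$, and at all of its points the Morse–Bott index $\mu$ and the diffeomorphism type of $C$ are as follows. 1. $X=Z$. Here $C=\{\eta\in\mathcal S: X(\eta)=Z\}$ (possibly empty), $\mu=0$, and $C$ is diffeomorphic to the product of the $n$ polygon spaces $P_j(Z)$. 2. A leg $\mathcal L_i$ of $\xi$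 is aligned and $Z$ lies on its line. Here $C$ is the set of $\eta\in\mathcal S$ whose $i$-th leg is in the same position as that of $\xi$, $\mu=M(\mathcal L_i,Z)$, and $C$ is diffeomorphic to the product of the $n-1$ spaces $P_j(X)$, $j\neq i$. 3. Two legs $\mathcal L_i,\mathcal L_k$, $i\ne k$, of $\xi$ are aligned. Write $x-z=c_i(x-a_i)+c_k(x-a_k)$ and $\sigma_i(Z)=\operatorname{sign}(c_i)$, $\sigma_k(Z)=\operatorname{sign}(c_k)$; these signs are nonzero and describe in which of the four quadrants cut out by the lines $A_iX$ and $A_kX$ the point $Z$ lies. Here $C$ is the set of $\eta\in\mathcal S$ whose $i$-th and $k$-th legs are in the same positions as those of $\xi$, $\mu=M_i+M_k$ with $$M_s=\begin{cases}M(\mathcal L_s)&\text{if }\sigma_s(Z)>0,\\ p_s-1-M(\mathcal L_s)&\text{if }\sigma_s(Z)<0,\end{cases}\qquad s\in\{i,k\},$$ and $C$ is diffeomorphic to the product of the $n-2$ spaces $P_j(X)$, $j\ne i,k$. -/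

import Mathlib

open Set Filter Topology
open scoped ContDiff

noncomputable section

/-! ### Smooth maps, submanifolds and Morse-Bott functions in a normed space -/

section MorseBott

variable {E F : Type} [NormedAddCommGroup E] [NormedSpace ℝ E]
  [NormedAddCommGroup F] [NormedSpace ℝ F]

/-- A map on a subset `A` of a normed space is smooth if near each point of `A` it extends to a
`C^∞` map on an open set. -/
def IsSmoothOn (f : E → F) (A : Set E) : Prop :=
  ∀ x ∈ A, ∃ U : Set E, IsOpen U ∧ x ∈ U ∧ ∃ g : E → F, ContDiffOn ℝ ∞ g U ∧ EqOn f g (A ∩ U)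

/-- `S` is an embedded smooth submanifold: near each of its points an ambient
`C^∞` diffeomorphism between open sets flattens `S` onto a linear subspace. -/
def IsSubmanifold (S : Set E) : Prop :=
  ∀ x ∈ S, ∃ (Φ : OpenPartialHomeomorph E E) (W : Submodule ℝ E),
    x ∈ Φ.source ∧ ContDiffOn ℝ ∞ Φ Φ.source ∧ ContDiffOn ℝ ∞ Φ.symm Φ.target ∧
      Φ '' (Φ.source ∩ S) = Φ.target ∩ (W : Set E)

/-- `γ` is a smooth curve (germ at time `0`) in `S` through `x`. -/
structure IsCurveIn (S : Set E) (x : E) (γ : ℝ → E) : Prop where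
  smooth : ContDiffAt ℝ ∞ γ 0
  base : γ 0 = x
  mem : ∀ᶠ t in 𝓝 (0 : ℝ), γ t ∈ S

/-- The tangent space of `S` at `x`, spanned by the velocities at `x` of smooth curves in `S`
(for a submanifold these velocities already form a linear subspace). -/
def tangentSpaceAt (S : Set E) (x : E) : Submodule ℝ E :=
  Submodule.span ℝ {v | ∃ γ : ℝ → E, IsCurveIn S x γ ∧ deriv γ 0 = v}

/-- The critical set of the restriction of `f` to `S`: the differential of `f` along `S`
vanishes. -/
def criticalSet (f : E → ℝ) (S : Set E) : Set E :=
  {x | x ∈ S ∧ ∀ γ : ℝ → E, IsCurveIn S x γ → deriv (fun t => f (γ t)) 0 = 0}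

/-- `Q` is the Hessian, at the critical point `x`, of the restriction of `f` to `S`: the quadratic
form on the tangent space with `Q (γ'(0)) = (f ∘ γ)''(0)` for all smooth curves `γ` in `S`
through `x`. -/
def IsHessianAt (f : E → ℝ) (S : Set E) (x : E) (Q : QuadraticForm ℝ (tangentSpaceAt S x)) :
    Prop :=
  ∀ γ : ℝ → E, IsCurveIn S x γ → ∀ v : tangentSpaceAt S x, (v : E) = deriv γ 0 →
    Q v = iteratedDeriv 2 (fun t => f (γ t)) 0

/-- `x` is a critical point of `f` on `S` at which `f` is Morse-Bott with index `k`: for every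
complement `N`, in the tangent space of `S`, of the tangent space of the connected component of the
critical set through `x` (that is, for the tangent space `N` of any normal slice), the Hessian
restricted to `N` is nondegenerate and has negative index `k`. -/
def HasMorseBottIndex (f : E → ℝ) (S : Set E) (x : E) (k : ℕ) : Prop :=
  x ∈ criticalSet f S ∧ ∃ Q : QuadraticForm ℝ (tangentSpaceAt S x), IsHessianAt f S x Q ∧
    ∀ N : Submodule ℝ (tangentSpaceAt S x),
      IsCompl N ((tangentSpaceAt (connectedComponentIn (criticalSet f S) x) x).comap
        (tangentSpaceAt S x).subtype) →
      (Q.restrict N).Nondegenerate ∧ sigNeg (Q.restrict N) = k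

/-- `f` restricts to a Morse-Bott function on the smooth manifold `S`. -/
structure IsMorseBott (f : E → ℝ) (S : Set E) : Prop where
  manifold : IsSubmanifold S
  smooth : IsSmoothOn f S
  critical_manifold : ∀ x ∈ criticalSet f S,
    IsSubmanifold (connectedComponentIn (criticalSet f S) x)
  nondegenerate : ∀ x ∈ criticalSet f S, ∃ k : ℕ, HasMorseBottIndex f S x k

/-- `C` is a submanifold that is open and closed in the critical set of `f` on `S`, i.e. it consists of
entire connected components of the critical set. -/
structure IsCriticalManifold (f : E → ℝ) (S : Set E) (C : Set E) : Prop where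
  subset : C ⊆ criticalSet f S
  submanifold : IsSubmanifold C
  isOpen_rel : ∃ U : Set E, IsOpen U ∧ criticalSet f S ∩ U = C
  isClosed_rel : ∃ K : Set E, IsClosed K ∧ criticalSet f S ∩ K = C

end MorseBott

/-! ### Quotients of subsets of normed spaces, and diffeomorphisms between them -/

/-- A subset `K` of a normed space with an equivalence relation on it. Manifolds are presented in
this way: embedded ones by the trivial relation, orbit spaces of group actions by the
orbit relation. -/
structure SmoothQuotient where
  V : Type
  [grp : NormedAddCommGroup V]
  [spc : NormedSpace ℝ V]
  K : Set V
  rel : Setoid K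

namespace SmoothQuotient

attribute [instance] SmoothQuotient.grp SmoothQuotient.spc

/-- The underlying set, the quotient. -/
abbrev Carrier (Q : SmoothQuotient) : Type := Quotient Q.rel

/-- A map of quotients is smooth if, locally on the presenting sets, it lifts to a smooth map. -/
def IsSmoothMap {P Q : SmoothQuotient} (φ : P.Carrier → Q.Carrier) : Prop :=
  ∀ a ∈ P.K, ∃ U : Set P.V, IsOpen U ∧ a ∈ U ∧ ∃ F : P.V → Q.V, IsSmoothOn F (P.K ∩ U) ∧
    ∀ (b : P.V) (hb : b ∈ P.K), b ∈ U →
      ∃ hF : F b ∈ Q.K, φ (Quotient.mk P.rel ⟨b, hb⟩) = Quotient.mk Q.rel ⟨F b, hF⟩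

/-- `P` and `Q` are diffeomorphic. -/
def Diffeomorphic (P Q : SmoothQuotient) : Prop :=
  ∃ φ : P.Carrier ≃ Q.Carrier, IsSmoothMap (P := P) (Q := Q) φ ∧
    IsSmoothMap (P := Q) (Q := P) φ.symm

/-- A subset of a normed space. -/
def ofSet {E : Type} [NormedAddCommGroup E] [NormedSpace ℝ E] (A : Set E) : SmoothQuotient where
  V := E
  K := A
  rel := ⊥

/-- The Cartesian product of two spaces. -/
def prod (P Q : SmoothQuotient) : SmoothQuotient where
  V := P.V × Q.V
  K := P.K ×ˢ Q.K
  rel :=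
    { r := fun a b => P.rel ⟨a.1.1, a.2.1⟩ ⟨b.1.1, b.2.1⟩ ∧ Q.rel ⟨a.1.2, a.2.2⟩ ⟨b.1.2, b.2.2⟩
      iseqv :=
        { refl := fun _ => ⟨P.rel.refl _, Q.rel.refl _⟩
          symm := fun h => ⟨P.rel.symm h.1, Q.rel.symm h.2⟩
          trans := fun h h' => ⟨P.rel.trans h.1 h'.1, Q.rel.trans h.2 h'.2⟩ } }

/-- The Cartesian product of a finite family of spaces. -/
def pi {J : Type} [Fintype J] (Q : J → SmoothQuotient) : SmoothQuotient where
  V := ∀ j, (Q j).V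
  K := Set.univ.pi fun j => (Q j).K
  rel :=
    { r := fun a b => ∀ j, (Q j).rel ⟨a.1 j, a.2 j trivial⟩ ⟨b.1 j, b.2 j trivial⟩
      iseqv :=
        { refl := fun _ j => (Q j).rel.refl _
          symm := fun h j => (Q j).rel.symm (h j)
          trans := fun h h' j => (Q j).rel.trans (h j) (h' j) } }

end SmoothQuotient

/-! ### Polygon spaces -/

/-- The Euclidean plane. -/
abbrev Plane : Type := EuclideanSpace ℝ (Fin 2)

/-- Closed polygons in the plane, given by their vertices, with cyclically ordered edge lengths
`l`. -/
def closedPolygons {m : ℕ} (l : Fin m → ℝ) : Set (Fin m → Plane) :=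
  {P | ∀ j, dist (P j) (P (finRotate m j)) = l j}

/-- An isometry of the plane preserves the orientation. -/
def IsOrientationPreserving (g : Plane ≃ᵃⁱ[ℝ] Plane) : Prop :=
  0 < LinearMap.det (g.linearIsometryEquiv.toLinearEquiv : Plane →ₗ[ℝ] Plane)

theorem isOrientationPreserving_refl :
    IsOrientationPreserving (AffineIsometryEquiv.refl ℝ Plane) := by
  have h : ((AffineIsometryEquiv.refl ℝ Plane).linearIsometryEquiv.toLinearEquiv :
      Plane →ₗ[ℝ] Plane) = LinearMap.id := rfl
  rw [IsOrientationPreserving, h, LinearMap.det_id]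
  exact one_pos

theorem IsOrientationPreserving.trans {g h : Plane ≃ᵃⁱ[ℝ] Plane}
    (hg : IsOrientationPreserving g) (hh : IsOrientationPreserving h) :
    IsOrientationPreserving (g.trans h) := by
  have e : ((g.trans h).linearIsometryEquiv.toLinearEquiv : Plane →ₗ[ℝ] Plane) =
      (h.linearIsometryEquiv.toLinearEquiv : Plane →ₗ[ℝ] Plane) ∘ₗ
        (g.linearIsometryEquiv.toLinearEquiv : Plane →ₗ[ℝ] Plane) := rfl
  rw [IsOrientationPreserving, e, LinearMap.det_comp]
  exact mul_pos hh hg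

theorem IsOrientationPreserving.symm {g : Plane ≃ᵃⁱ[ℝ] Plane}
    (hg : IsOrientationPreserving g) : IsOrientationPreserving g.symm := by
  have e : (g.linearIsometryEquiv.toLinearEquiv : Plane →ₗ[ℝ] Plane) ∘ₗ
      (g.symm.linearIsometryEquiv.toLinearEquiv : Plane →ₗ[ℝ] Plane) = LinearMap.id := by
    ext1 v
    exact g.linearIsometryEquiv.apply_symm_apply v
  have h := congrArg LinearMap.det e
  rw [LinearMap.det_comp, LinearMap.det_id] at h
  have hg' : 0 < LinearMap.det (g.linearIsometryEquiv.toLinearEquiv : Plane →ₗ[ℝ] Plane) := hg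
  exact (mul_pos_iff_of_pos_left hg').1 (by rw [h]; exact one_pos)

/-- Congruence of polygons under the orientation preserving isometries of the plane. -/
def polygonSetoid {m : ℕ} (l : Fin m → ℝ) : Setoid (closedPolygons l) where
  r P P' := ∃ g : Plane ≃ᵃⁱ[ℝ] Plane, IsOrientationPreserving g ∧ ∀ j, P'.1 j = g (P.1 j)
  iseqv :=
    { refl := fun _ => ⟨AffineIsometryEquiv.refl ℝ Plane, isOrientationPreserving_refl, fun _ => rfl⟩
      symm := fun ⟨g, hg, h⟩ => ⟨g.symm, hg.symm, fun j => by rw [h j, g.symm_apply_apply]⟩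
      trans := fun ⟨g, hg, h⟩ ⟨g', hg', h'⟩ =>
        ⟨g.trans g', hg.trans hg', fun j => by rw [h' j, h j]; rfl⟩ }

/-- The polygon space: closed polygons with edge lengths `l` modulo orientation preserving
isometries. -/
def polygonSpace {m : ℕ} (l : Fin m → ℝ) : SmoothQuotient where
  V := Fin m → Plane
  K := closedPolygons l
  rel := polygonSetoid l

/-- The circle `S¹`. -/
def unitCircle : SmoothQuotient := SmoothQuotient.ofSet (Metric.sphere (0 : Plane) 1)

/-! ### Broken lines -/

/-- `Pos`: the number of edges of the broken line `P 0, …, P p` that are codirected with the vector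
from its start point to its end point. -/
def posEdges {p : ℕ} (P : Fin (p + 1) → Plane) : ℕ :=
  {j : Fin p | SameRay ℝ (P j.succ - P j.castSucc) (P (Fin.last p) - P 0)}.ncard

/-- The signed area of the parallelogram spanned by `u` and `v`. -/
def signedArea (u v : Plane) : ℝ := u 0 * v 1 - u 1 * v 0

/-- The sign of the coefficient `c` in `X - Z = c • (X - A) + c' • (X - A')` (Cramer's rule), where
`A, A', X` are not collinear. It is constant on the four quadrants into which the lines
`AX` and `A'X` divide the plane: it is `1` if `Z` and `A` are on the same side of the line `A'X`,
and `-1` if they are on opposite sides. -/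
def quadrantSign (A A' X Z : Plane) : SignType :=
  SignType.sign (signedArea (X - Z) (X - A') / signedArea (X - A) (X - A'))

/-! ### Spiders -/

/-- A spider mechanism with `n` legs in the plane. -/
structure SpiderMechanism where
  n : ℕ
  foot : Fin n → Plane
  foot_injective : Function.Injective foot
  p : Fin n → ℕ
  one_lt_p : ∀ i, 1 < p i
  len : ∀ i, Fin (p i) → ℝ
  len_pos : ∀ i j, 0 < len i j

namespace SpiderMechanism

variable (M : SpiderMechanism)

/-- Positions of the body `X` and of the joints `A_i^1, …, A_i^{p_i - 1}` of each leg. -/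
abbrev Positions : Type := Plane × (∀ i, Fin (M.p i - 1) → Plane)

variable {M}

/-- The points `A_i^0 = A_i, A_i^1, …, A_i^{p_i} = X` of the `i`-th leg. -/
def leg (ξ : M.Positions) (i : Fin M.n) (j : Fin (M.p i + 1)) : Plane :=
  if h₀ : (j : ℕ) = 0 then M.foot i
  else if h₁ : (j : ℕ) = M.p i then ξ.1
  else ξ.2 i ⟨j - 1, by omega⟩

variable (M) in
/-- The configuration space of the mechanism. -/
def spiderSpace : Set M.Positions :=
  {ξ | ∀ (i : Fin M.n) (j : Fin (M.p i)), dist (leg ξ i j.castSucc) (leg ξ i j.succ) = M.len i j}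

/-- The `i`-th leg fits in a straight line. -/
def LegAligned (ξ : M.Positions) (i : Fin M.n) : Prop := Collinear ℝ (range (leg ξ i))

/-- The line containing the `i`-th leg, if that leg is aligned. -/
def legLine (ξ : M.Positions) (i : Fin M.n) : AffineSubspace ℝ Plane :=
  affineSpan ℝ (range (leg ξ i))

variable (M) in
/-- The squared distance from the body to `Z`. -/
def sqDist (Z : Plane) (ξ : M.Positions) : ℝ := ‖ξ.1 - Z‖ ^ 2

variable (M) in
/-- Strong genericity of a spider mechanism together with a point `Z`. -/
structure StronglyGeneric (Z : Plane) : Prop where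
  aligned_le_two : ∀ ξ ∈ M.spiderSpace, {i | LegAligned ξ i}.ncard ≤ 2
  not_parallel : ∀ ξ ∈ M.spiderSpace, ∀ i k, i ≠ k → LegAligned ξ i → LegAligned ξ k →
    ¬ (legLine ξ i).Parallel (legLine ξ k)
  notMem_line : ∀ ξ ∈ M.spiderSpace, ∀ i k, i ≠ k → LegAligned ξ i → LegAligned ξ k →
    Z ∉ legLine ξ i
  ne_foot : ∀ i, Z ≠ M.foot i
  ne_body : ∀ ξ ∈ M.spiderSpace, ∀ i, LegAligned ξ i → Z ≠ ξ.1

/-- `M(𝓛) = Pos(𝓛) - 1` for the `i`-th leg. -/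
def legIndex (ξ : M.Positions) (i : Fin M.n) : ℕ := posEdges (leg ξ i) - 1

/-- `M(𝓛, Z) = Pos(z𝓛) - 1`, where `z𝓛` is the `i`-th leg with the edge `ZA_i` put before it. -/
def extendedLegIndex (Z : Plane) (ξ : M.Positions) (i : Fin M.n) : ℕ :=
  posEdges (Fin.cons Z (leg ξ i) : Fin (M.p i + 1 + 1) → Plane) - 1

/-- The contribution of leg `i` to the index when legs `i` and `k` are aligned: `M(𝓛_i)` or
`p_i - 1 - M(𝓛_i)`, according to the quadrant of `Z`. -/
def pairIndex (Z : Plane) (ξ : M.Positions) (i k : Fin M.n) : ℕ :=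
  if quadrantSign (M.foot i) (M.foot k) ξ.1 Z = 1 then legIndex ξ i
  else M.p i - 1 - legIndex ξ i

variable (M) in
/-- The configurations with the body at `Z`. -/
def bodyAt (Z : Plane) : Set M.Positions := {η | η ∈ M.spiderSpace ∧ η.1 = Z}

/-- The configurations whose `i`-th leg is in the same position as in `ξ`. -/
def sameLeg (ξ : M.Positions) (i : Fin M.n) : Set M.Positions :=
  {η | η ∈ M.spiderSpace ∧ leg η i = leg ξ i}

variable (M) in
/-- The polygon space of the closure of leg `i` by the bar from the body position `X` to the
foot `A_i`. -/
def closureSpace (i : Fin M.n) (X : Plane) : SmoothQuotient :=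
  polygonSpace (Fin.snoc (M.len i) (dist X (M.foot i)) : Fin (M.p i + 1) → ℝ)

open Classical in
variable (M) in
/-- The closure of leg `i` when the body may lie at the foot of the leg. In that case the leg is
itself a closed polygon, free to rotate about the foot, and the circle of its rotations has to be
added as a factor. -/
def closureFactor (i : Fin M.n) (X : Plane) : SmoothQuotient :=
  if X = M.foot i then SmoothQuotient.prod (polygonSpace (M.len i)) unitCircle
  else M.closureSpace i X

end SpiderMechanism

end

open SpiderMechanism

/-!
The spider space is a level set of the map of squared edge lengths (`lengthMap`). A leg that is
not aligned admits every velocity of its end point and every rate of change of its edge lengths,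
whereas an aligned leg prescribes the component of the velocity of the body along its line
(`exists_leg_velocities`). Genericity allows at most two aligned legs, and these are not parallel,
so the level set is regular. The same argument with the body and some legs held fixed makes the
sets `fixedLegs ξ I` submanifolds; the candidates for critical manifolds are of this form.

On tangent vectors the velocity of the body ranges over the vectors orthogonal to the aligned
legs, so a configuration is critical exactly if `X - Z` lies in the span of the directions of its
aligned legs (`mem_criticalSet_iff`). This leaves the three kinds of critical points. Each
candidate is relatively open and closed in the critical set: the number of aligned legs separates
the kinds from each other, and the angles between corresponding edges, together with the side of
the line through the two feet on which the body lies, separate different positions of aligned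
legs.

For the Hessian, `X - Z` is balanced by stresses along the aligned legs. As the edge lengths are
constant, the squared distance equals, on the whole spider space and not only to second order, the
quadratic form `‖δX‖ ^ 2 - ∑ λ i j * ‖δe i j‖ ^ 2` of the displacement, up to a constant
(`sqDist_eq_add_stressForm`). In terms of the rates of rotation of the edges this is, modulo the
tangent space of the critical manifold, a sum of diagonal forms `∑ w j * t j ^ 2` restricted to
hyperplanes `∑ w j * t j = 0`. The hyperplane is the orthogonal complement of `(1, …, 1)`, so one
sign is lost, namely that of `∑ w j`; this explains the term `-1` in `Pos - 1`
(`hyperplaneForm_nondegenerate_and_sigNeg`). Since nondegeneracy and the index hold for a form on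
the quotient of the tangent spaces, they hold on every complement
(`hasMorseBottIndex_of_quotient`).

When the body is fixed, each remaining leg moves independently of the others. Closing it up by the
bar from the body to the foot gives a polygon, and conversely a polygon is moved back to the given
end points by the explicit rigid motion `motion`, which is smooth in the vertices. If the body
lies at the foot, the leg itself is a closed polygon and its direction gives the circle factor.
Hence the space of positions of one leg is diffeomorphic to its `closureFactor`, with lifts
defined on the whole ambient spaces (`nonempty_globalDiffeo_closureFactor`), and the critical
manifolds are products of these.
-/

/-! ### Regular level sets -/

section Curves

variable {E G : Type} [NormedAddCommGroup E] [NormedSpace ℝ E]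
  [NormedAddCommGroup G] [NormedSpace ℝ G]

theorem IsCurveIn.hasDerivAt {S : Set E} {x : E} {γ : ℝ → E} (h : IsCurveIn S x γ) :
    HasDerivAt γ (deriv γ 0) 0 :=
  (h.smooth.differentiableAt (by simp)).hasDerivAt

theorem fderiv_deriv_eq_zero_of_isCurveIn {F : E → G} (hF : ContDiff ℝ ∞ F) {x : E} {γ : ℝ → E}
    (h : IsCurveIn {y | F y = F x} x γ) : fderiv ℝ F x (deriv γ 0) = 0 := by
  have h1 : HasFDerivAt F (fderiv ℝ F x) (γ 0) := by
    rw [h.base]; exact (hF.differentiable (by simp) x).hasFDerivAt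
  have h2 := h1.comp_hasDerivAt (0 : ℝ) h.hasDerivAt
  have h3 : F ∘ γ =ᶠ[𝓝 0] fun _ => F x := h.mem
  rw [← h2.deriv, h3.deriv_eq, deriv_const]

end Curves

section LevelSets

variable {E G : Type} [NormedAddCommGroup E] [NormedSpace ℝ E] [FiniteDimensional ℝ E]
  [NormedAddCommGroup G] [NormedSpace ℝ G] [FiniteDimensional ℝ G]

/-- Near a regular point `x` of `F`, the level set through `x` is flattened onto the kernel of the
differential by `y ↦ (y - x) - R (F' (y - x)) + R (F y - F x)`, where `R` is a right inverse of
`F' = DF(x)`. -/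
theorem exists_flattening {F : E → G} (hF : ContDiff ℝ ∞ F) (x : E)
    (hs : Function.Surjective (fderiv ℝ F x)) :
    ∃ Φ : OpenPartialHomeomorph E E, x ∈ Φ.source ∧ ContDiffOn ℝ ∞ Φ Φ.source ∧
      ContDiffOn ℝ ∞ Φ.symm Φ.target ∧ Φ x = 0 ∧
      HasFDerivAt Φ (ContinuousLinearMap.id ℝ E) x ∧
      ∀ y, F y = F x ↔ fderiv ℝ F x (Φ y) = 0 := by
  obtain ⟨R₀, hR₀⟩ := LinearMap.exists_rightInverse_of_surjective
    (fderiv ℝ F x : E →ₗ[ℝ] G) (LinearMap.range_eq_top.2 hs)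
  let R : G →L[ℝ] E := LinearMap.toContinuousLinearMap R₀
  have hR : ∀ g, fderiv ℝ F x (R g) = g := fun g => LinearMap.congr_fun hR₀ g
  let D := fderiv ℝ F x
  let Ψ : E → E := fun y => (y - x) - R (D (y - x)) + R (F y - F x)
  have hΨ : ContDiff ℝ ∞ Ψ :=
    ((contDiff_id.sub contDiff_const).sub
      (R.contDiff.comp (D.contDiff.comp (contDiff_id.sub contDiff_const)))).add
      (R.contDiff.comp (hF.sub contDiff_const))
  have hFx : HasFDerivAt F D x := (hF.differentiable (by simp) x).hasFDerivAt
  have hΨx : HasFDerivAt Ψ (ContinuousLinearMap.id ℝ E) x := by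
    have h1 : HasFDerivAt (fun y : E => y - x) (ContinuousLinearMap.id ℝ E) x :=
      (hasFDerivAt_id x).sub_const x
    have h2 : HasFDerivAt (fun y => R (D (y - x))) (R.comp (D.comp (ContinuousLinearMap.id ℝ E))) x :=
      R.hasFDerivAt.comp x (D.hasFDerivAt.comp x h1)
    have h3 : HasFDerivAt (fun y => R (F y - F x)) (R.comp D) x :=
      R.hasFDerivAt.comp x (hFx.sub_const (F x))
    have h4 := (h1.sub h2).add h3
    have h5 : ContinuousLinearMap.id ℝ E - R.comp (D.comp (ContinuousLinearMap.id ℝ E)) + R.comp D =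
        ContinuousLinearMap.id ℝ E := by
      ext v
      simp
    rw [h5] at h4
    exact h4
  have hΨx' : HasFDerivAt Ψ ((ContinuousLinearEquiv.refl ℝ E : E ≃L[ℝ] E) : E →L[ℝ] E) x := hΨx
  let Φ₀ := ContDiffAt.toOpenPartialHomeomorph Ψ (hΨ.contDiffAt (x := x)) hΨx' (by simp)
  have hΦ₀ : ∀ y, Φ₀ y = Ψ y := fun y => rfl
  let O : Set E := {y | fderiv ℝ Ψ y ∈ range ((↑) : (E ≃L[ℝ] E) → (E →L[ℝ] E))}
  have hO : IsOpen O := (ContinuousLinearEquiv.isOpen (𝕜 := ℝ) (E := E) (F := E)).preimage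
    (hΨ.continuous_fderiv (by simp))
  let Φ := Φ₀.restrOpen O hO
  have hsrc : Φ.source = Φ₀.source ∩ O := rfl
  have hΦ : ∀ y, Φ y = Ψ y := fun y => rfl
  have hxO : x ∈ O := ⟨ContinuousLinearEquiv.refl ℝ E, hΨx.fderiv.symm⟩
  refine ⟨Φ, ?_, ?_, ?_, ?_, hΨx, fun y => ?_⟩
  · rw [hsrc]
    exact ⟨ContDiffAt.mem_toOpenPartialHomeomorph_source _ _ _, hxO⟩
  · exact hΨ.contDiffOn
  · intro z hz
    have hz' : Φ.symm z ∈ O := by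
      have := Φ.map_target hz
      rw [hsrc] at this
      exact this.2
    obtain ⟨e, he⟩ := hz'
    refine (OpenPartialHomeomorph.contDiffAt_symm Φ hz (f₀' := e) ?_ ?_).contDiffWithinAt
    · rw [he]
      exact (hΨ.differentiable (by simp) _).hasFDerivAt
    · exact hΨ.contDiffAt
  · simp [hΦ, Ψ]
  · have : D (Ψ y) = F y - F x := by
      have e1 : D (Ψ y) = D (y - x) - D (R (D (y - x))) + D (R (F y - F x)) := by
        simp only [Ψ, map_add, map_sub]
      rw [e1, hR, hR, sub_self, zero_add]
    rw [hΦ]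
    change _ ↔ D (Ψ y) = 0
    rw [this, sub_eq_zero]

/-- The level set of `F` through a regular point is, near that point, a submanifold. -/
theorem isSubmanifold_of_regular {S : Set E}
    (h : ∀ x ∈ S, ∃ F : E → G, ContDiff ℝ ∞ F ∧ Function.Surjective (fderiv ℝ F x) ∧
      S = {y | F y = F x}) : IsSubmanifold S := by
  intro x hx
  obtain ⟨F, hF, hs, hS⟩ := h x hx
  obtain ⟨Φ, hxΦ, h1, h2, -, -, h3⟩ := exists_flattening hF x hs
  refine ⟨Φ, LinearMap.ker (fderiv ℝ F x : E →ₗ[ℝ] G), hxΦ, h1, h2, ?_⟩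
  ext z
  constructor
  · rintro ⟨y, ⟨hy, hyS⟩, rfl⟩
    rw [hS] at hyS
    exact ⟨Φ.map_source hy, (h3 y).1 hyS⟩
  · rintro ⟨hz, hzW⟩
    refine ⟨Φ.symm z, ⟨Φ.map_target hz, ?_⟩, Φ.right_inv hz⟩
    rw [hS]
    refine (h3 _).2 ?_
    rw [Φ.right_inv hz]
    exact hzW

/-- Every vector in the kernel of the differential at a regular point is the velocity of a curve in
the level set. -/
theorem exists_curve_of_mem_ker {F : E → G} (hF : ContDiff ℝ ∞ F) {x : E}
    (hs : Function.Surjective (fderiv ℝ F x)) {v : E} (hv : fderiv ℝ F x v = 0) :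
    ∃ γ : ℝ → E, IsCurveIn {y | F y = F x} x γ ∧ deriv γ 0 = v := by
  obtain ⟨Φ, hxΦ, h1, h2, h0, hd, h3⟩ := exists_flattening hF x hs
  have h0t : (0 : E) ∈ Φ.target := h0 ▸ Φ.map_source hxΦ
  have hs0 : Φ.symm 0 = x := by rw [← h0, Φ.left_inv hxΦ]
  have hlin : ContDiff ℝ ∞ (fun t : ℝ => t • v) := contDiff_id.smul contDiff_const
  have hsymm : HasFDerivAt Φ.symm (ContinuousLinearMap.id ℝ E) 0 := by
    have hd' : HasFDerivAt Φ ((ContinuousLinearEquiv.refl ℝ E : E ≃L[ℝ] E) : E →L[ℝ] E)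
        (Φ.symm 0) := by rw [hs0]; exact hd
    exact Φ.hasFDerivAt_symm h0t hd'
  have hmem : ∀ᶠ t : ℝ in 𝓝 0, t • v ∈ Φ.target := by
    have : ContinuousAt (fun t : ℝ => t • v) 0 := hlin.continuous.continuousAt
    refine this (Φ.open_target.mem_nhds ?_)
    simpa using h0t
  refine ⟨fun t => Φ.symm (t • v), ⟨?_, ?_, ?_⟩, ?_⟩
  · have : ContDiffAt ℝ ∞ Φ.symm ((0 : ℝ) • v) := by
      rw [zero_smul]; exact h2.contDiffAt (Φ.open_target.mem_nhds h0t)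
    exact this.comp (0 : ℝ) hlin.contDiffAt
  · simp [hs0]
  · filter_upwards [hmem] with t ht
    refine (h3 _).2 ?_
    rw [Φ.right_inv ht, map_smul, hv, smul_zero]
  · have h4 : HasDerivAt (fun t : ℝ => t • v) v 0 := by
      simpa using (hasDerivAt_id (0 : ℝ)).smul_const v
    have h5 : HasFDerivAt Φ.symm (ContinuousLinearMap.id ℝ E) ((0 : ℝ) • v) := by
      rw [zero_smul]; exact hsymm
    exact (h5.comp_hasDerivAt (0 : ℝ) h4).deriv

/-- The tangent space of a level set at a regular point is the kernel of the differential. -/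
theorem tangentSpaceAt_eq_ker {F : E → G} (hF : ContDiff ℝ ∞ F) {x : E}
    (hs : Function.Surjective (fderiv ℝ F x)) :
    tangentSpaceAt {y | F y = F x} x = LinearMap.ker (fderiv ℝ F x : E →ₗ[ℝ] G) := by
  apply le_antisymm
  · refine Submodule.span_le.2 ?_
    rintro v ⟨γ, hγ, rfl⟩
    exact fderiv_deriv_eq_zero_of_isCurveIn hF hγ
  · intro v hv
    exact Submodule.subset_span (exists_curve_of_mem_ker hF hs hv)

end LevelSets

/-! ### Second derivatives along curves and Morse-Bott points -/

section MorseBottCriteria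

variable {E : Type} [NormedAddCommGroup E] [NormedSpace ℝ E]

theorem deriv_bilin_comp (b : E →L[ℝ] E →L[ℝ] ℝ) {γ : ℝ → E} {t : ℝ} {v x : E}
    (h : HasDerivAt γ v t) :
    HasDerivAt (fun s => b (γ s - x) (γ s - x)) (b v (γ t - x) + b (γ t - x) v) t := by
  have h1 : HasDerivAt (fun s => γ s - x) v t := h.sub_const x
  have h2 : HasDerivAt (fun s => b (γ s - x)) (b v) t := b.hasFDerivAt.comp_hasDerivAt t h1
  exact h2.clm_apply h1

/-- If on `S` the function `f` differs from the quadratic form of `b` at `y - x` by a constant, then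
`x` is critical and the second derivatives of `f` along curves in `S` are given by `2 b`. -/
theorem derivs_of_quadratic_expansion {f : E → ℝ} {S : Set E} {x : E} (b : E →L[ℝ] E →L[ℝ] ℝ)
    (hb : ∀ y ∈ S, f y = f x + b (y - x) (y - x)) {γ : ℝ → E} (hγ : IsCurveIn S x γ) :
    deriv (fun t => f (γ t)) 0 = 0 ∧
      iteratedDeriv 2 (fun t => f (γ t)) 0 = 2 * b (deriv γ 0) (deriv γ 0) := by
  have hev : (fun t => f (γ t)) =ᶠ[𝓝 0] fun t => f x + b (γ t - x) (γ t - x) := by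
    filter_upwards [hγ.mem] with t ht using hb _ ht
  have hd : ∀ᶠ t in 𝓝 (0 : ℝ), HasDerivAt γ (deriv γ t) t := by
    have h1 : ContDiffAt ℝ 1 γ 0 := hγ.smooth.of_le (by norm_cast)
    obtain ⟨u, hu, hu'⟩ := (h1.eventually (by simp)).exists_mem
    filter_upwards [hu] with t ht
    exact ((hu' t ht).differentiableAt (by simp)).hasDerivAt
  have hd' : ∀ᶠ t in 𝓝 (0 : ℝ), HasDerivAt (fun t => f x + b (γ t - x) (γ t - x))
      (b (deriv γ t) (γ t - x) + b (γ t - x) (deriv γ t)) t := by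
    filter_upwards [hd] with t ht
    exact (deriv_bilin_comp b ht).const_add (f x)
  constructor
  · rw [hev.deriv_eq, hd'.self_of_nhds.deriv, hγ.base, sub_self]
    simp
  · have e1 : deriv (fun t => f (γ t)) =ᶠ[𝓝 0]
        fun t => b (deriv γ t) (γ t - x) + b (γ t - x) (deriv γ t) := by
      filter_upwards [hev.deriv, hd'] with t ht ht'
      rw [ht, ht'.deriv]
    have h2 : DifferentiableAt ℝ (deriv γ) 0 := by
      have h3 : ContDiffAt ℝ 1 (deriv γ) 0 := by
        have : ContDiffAt ℝ (1 + 1) γ 0 := hγ.smooth.of_le (by norm_cast)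
        have h6 := this.fderiv_right (m := 1) le_rfl
        exact h6.clm_apply contDiffAt_const
      exact h3.differentiableAt (by simp)
    have h3 := h2.hasDerivAt
    have h4 : HasDerivAt (fun s => γ s - x) (deriv γ 0) 0 := hγ.hasDerivAt.sub_const x
    have h5 : HasDerivAt (fun t => b (deriv γ t) (γ t - x) + b (γ t - x) (deriv γ t)) _ 0 :=
      ((b.hasFDerivAt.comp_hasDerivAt (0 : ℝ) h3).clm_apply h4).add
        ((b.hasFDerivAt.comp_hasDerivAt (0 : ℝ) h4).clm_apply h3)
    rw [iteratedDeriv_succ, iteratedDeriv_one, e1.deriv_eq, h5.deriv]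
    simp only [hγ.base, sub_self, map_zero, Function.comp, zero_apply]
    ring

/-- A curve through `x` in the critical set stays in a relatively open part of it for a short time,
and near its base point a curve is contained in one connected component. -/
theorem isCurveIn_connectedComponentIn_iff {A C : Set E} {x : E} (hx : x ∈ C) (hCA : C ⊆ A)
    (hopen : ∃ U : Set E, IsOpen U ∧ A ∩ U = C) (γ : ℝ → E) :
    IsCurveIn (connectedComponentIn A x) x γ ↔ IsCurveIn C x γ := by
  obtain ⟨U, hU, hUC⟩ := hopen
  have hxU : x ∈ U := by rw [← hUC] at hx; exact hx.2
  constructor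
  · rintro ⟨h1, h2, h3⟩
    refine ⟨h1, h2, ?_⟩
    have hc : ContinuousAt γ 0 := h1.continuousAt
    have : ∀ᶠ t in 𝓝 (0 : ℝ), γ t ∈ U := hc (hU.mem_nhds (by rw [h2]; exact hxU))
    filter_upwards [this, h3] with t ht ht'
    rw [← hUC]
    exact ⟨connectedComponentIn_subset _ _ ht', ht⟩
  · rintro ⟨h1, h2, h3⟩
    refine ⟨h1, h2, ?_⟩
    have h4 : ContDiffAt ℝ 1 γ 0 := h1.of_le (by norm_cast)
    have h5 : ∀ᶠ t in 𝓝 (0 : ℝ), γ t ∈ C ∧ ContinuousAt γ t := by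
      filter_upwards [h3, h4.eventually (by simp)] with t ht ht'
      exact ⟨ht, ht'.continuousAt⟩
    obtain ⟨ε, hε, hball⟩ := Metric.eventually_nhds_iff_ball.1 h5
    have hpre : IsPreconnected (γ '' Metric.ball 0 ε) :=
      (convex_ball (0 : ℝ) ε).isPreconnected.image γ
        fun t ht => (hball t ht).2.continuousWithinAt
    have hsub : γ '' Metric.ball 0 ε ⊆ connectedComponentIn A x := by
      refine hpre.subset_connectedComponentIn ⟨0, Metric.mem_ball_self hε, h2⟩ ?_
      rintro _ ⟨t, ht, rfl⟩
      exact hCA (hball t ht).1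
    filter_upwards [Metric.ball_mem_nhds (0 : ℝ) hε] with t ht
    exact hsub ⟨t, ht, rfl⟩

theorem tangentSpaceAt_connectedComponentIn {A C : Set E} {x : E} (hx : x ∈ C) (hCA : C ⊆ A)
    (hopen : ∃ U : Set E, IsOpen U ∧ A ∩ U = C) :
    tangentSpaceAt (connectedComponentIn A x) x = tangentSpaceAt C x := by
  unfold tangentSpaceAt
  simp only [isCurveIn_connectedComponentIn_iff hx hCA hopen]

/-- Connected components of a set that is locally a submanifold are submanifolds, because a
submanifold is locally connected. -/
theorem isSubmanifold_connectedComponentIn {A : Set E} (x : E)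
    (h : ∀ y ∈ A, ∃ C ⊆ A, y ∈ C ∧ IsSubmanifold C ∧ ∃ U : Set E, IsOpen U ∧ A ∩ U = C) :
    IsSubmanifold (connectedComponentIn A x) := by
  intro y hy
  obtain ⟨C, hCA, hyC, hC, U, hU, hUC⟩ := h y (connectedComponentIn_subset _ _ hy)
  have hyU : y ∈ U := by rw [← hUC] at hyC; exact hyC.2
  obtain ⟨Φ, W, hyΦ, h1, h2, h3⟩ := hC y hyC
  rw [connectedComponentIn_eq hy]
  -- a ball in the target, small enough for its preimage to lie in `U`
  have hnhds : Φ.target ∩ Φ.symm ⁻¹' U ∈ 𝓝 (Φ y) :=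
    (Φ.isOpen_inter_preimage_symm hU).mem_nhds
      ⟨Φ.map_source hyΦ, by simpa [Φ.left_inv hyΦ] using hyU⟩
  obtain ⟨ε, hε, hball⟩ := Metric.mem_nhds_iff.1 hnhds
  let B := Metric.ball (Φ y) ε
  have hΦy : Φ y ∈ (W : Set E) := by
    have : Φ y ∈ Φ '' (Φ.source ∩ C) := ⟨y, ⟨hyΦ, hyC⟩, rfl⟩
    rw [h3] at this
    exact this.2
  have hconn : IsPreconnected (Φ.symm '' (B ∩ (W : Set E))) :=
    (((convex_ball (Φ y) ε).inter W.convex).isPreconnected).image _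
      (Φ.continuousOn_symm.mono fun z hz => (hball hz.1).1)
  have hsub : Φ.symm '' (B ∩ (W : Set E)) ⊆ C := by
    rintro _ ⟨z, ⟨hzB, hzW⟩, rfl⟩
    have : z ∈ Φ '' (Φ.source ∩ C) := by rw [h3]; exact ⟨(hball hzB).1, hzW⟩
    obtain ⟨w, ⟨hw, hwC⟩, rfl⟩ := this
    rwa [Φ.left_inv hw]
  have hcomp : Φ.symm '' (B ∩ (W : Set E)) ⊆ connectedComponentIn A y :=
    hconn.subset_connectedComponentIn
      ⟨Φ y, ⟨Metric.mem_ball_self hε, hΦy⟩, Φ.left_inv hyΦ⟩ (hsub.trans hCA)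
  let Φ' := (Φ.symm.restrOpen B Metric.isOpen_ball).symm
  have ht : Φ'.target = Φ.target ∩ B := rfl
  have hsrc : Φ'.source ⊆ Φ.source := by
    intro w hw
    have := Φ'.map_source hw
    have h5 : Φ'.symm (Φ' w) = w := Φ'.left_inv hw
    rw [ht] at this
    rw [← h5]
    exact Φ.map_target this.1
  refine ⟨Φ', W, ?_, h1.mono hsrc, h2.mono (by rw [ht]; exact inter_subset_left), ?_⟩
  · have : Φ'.symm (Φ y) ∈ Φ'.source :=
      Φ'.map_target (by rw [ht]; exact ⟨Φ.map_source hyΦ, Metric.mem_ball_self hε⟩)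
    have h5 : Φ'.symm (Φ y) = y := Φ.left_inv hyΦ
    rwa [h5] at this
  · ext z
    constructor
    · rintro ⟨w, ⟨hw, hwc⟩, rfl⟩
      refine ⟨Φ'.map_source hw, ?_⟩
      have hwΦ := hsrc hw
      have hb := Φ'.map_source hw
      rw [ht] at hb
      have hwU : w ∈ U := by
        have := (hball hb.2).2
        have e : Φ.symm (Φ' w) = w := Φ.left_inv hwΦ
        simpa [e] using this
      have hwC : w ∈ C := by rw [← hUC]; exact ⟨connectedComponentIn_subset _ _ hwc, hwU⟩
      have : Φ w ∈ Φ '' (Φ.source ∩ C) := ⟨w, ⟨hwΦ, hwC⟩, rfl⟩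
      rw [h3] at this
      exact this.2
    · rintro ⟨hz, hzW⟩
      refine ⟨Φ'.symm z, ⟨Φ'.map_target hz, ?_⟩, Φ'.right_inv hz⟩
      rw [ht] at hz
      exact hcomp ⟨z, ⟨hz.2, hzW⟩, rfl⟩

open QuadraticMap in
/-- A criterion for Morse-Bott points. If on `S` the function `f` is, up to a constant, the
quadratic form of `b` at `y - x`, and `2 b` descends to a nondegenerate form `q` on the quotient
`V` of the tangent space of `S` by that of the critical manifold `C`, then the index is the
negative index of `q`. -/
theorem hasMorseBottIndex_of_quotient [FiniteDimensional ℝ E] {f : E → ℝ} {S C : Set E} {x : E}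
    {k : ℕ} (hC : IsCriticalManifold f S C) (hx : x ∈ C)
    (b : E →L[ℝ] E →L[ℝ] ℝ) (hb : ∀ y ∈ S, f y = f x + b (y - x) (y - x))
    {V : Type} [AddCommGroup V] [Module ℝ V] (φ : tangentSpaceAt S x →ₗ[ℝ] V)
    (hφ : Function.Surjective φ)
    (hker : ∀ v : tangentSpaceAt S x, φ v = 0 ↔ (v : E) ∈ tangentSpaceAt C x)
    (q : QuadraticForm ℝ V) (hq : ∀ v : tangentSpaceAt S x, 2 * b v v = q (φ v))
    (hnd : q.Nondegenerate) (hk : sigNeg q = k) : HasMorseBottIndex f S x k := by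
  refine ⟨hC.subset hx, q.comp φ, ?_, ?_⟩
  · intro γ hγ v hv
    rw [(derivs_of_quadratic_expansion b hb hγ).2, ← hv, hq]
    rfl
  · intro N hN
    rw [tangentSpaceAt_connectedComponentIn hx hC.subset hC.isOpen_rel] at hN
    have hK : (tangentSpaceAt C x).comap (tangentSpaceAt S x).subtype = LinearMap.ker φ := by
      ext v
      simp [hker]
    rw [hK] at hN
    -- `φ` restricts to an isomorphism on every complement `N` of its kernel
    have hbij : Function.Bijective (φ.domRestrict N) := by
      constructor
      · rw [← LinearMap.ker_eq_bot, LinearMap.ker_eq_bot']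
        intro n hn
        have : (n : tangentSpaceAt S x) ∈ N ⊓ LinearMap.ker φ := ⟨n.2, hn⟩
        rw [hN.inf_eq_bot] at this
        exact Subtype.ext this
      · intro w
        obtain ⟨v, rfl⟩ := hφ w
        have : v ∈ N ⊔ LinearMap.ker φ := by rw [hN.sup_eq_top]; trivial
        obtain ⟨n, hn, m, hm, rfl⟩ := Submodule.mem_sup.1 this
        refine ⟨⟨n, hn⟩, ?_⟩
        rw [map_add, LinearMap.mem_ker.1 hm, add_zero]
        rfl
    let e : ((q.comp φ).restrict N).IsometryEquiv q :=
      { LinearEquiv.ofBijective _ hbij with map_app' := fun n => rfl }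
    have hbot := nondegenerate_iff_radical_eq_bot.1 hnd
    have he : Equivalent ((q.comp φ).restrict N) q := ⟨e⟩
    constructor
    · rw [nondegenerate_iff_radical_eq_bot]
      have h1 := e.map_radical
      rw [hbot] at h1
      exact Submodule.map_eq_bot_iff.1 h1
    · rw [he.sigNeg_eq, hk]

end MorseBottCriteria

/-! ### Signatures of quadratic forms -/

section Signatures

open QuadraticMap

variable {M M' : Type} [AddCommGroup M] [Module ℝ M] [FiniteDimensional ℝ M]
  [AddCommGroup M'] [Module ℝ M'] [FiniteDimensional ℝ M']

theorem finrank_le_sigPos_of_map {N : Type} [AddCommGroup N] [Module ℝ N]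
    (Q : QuadraticForm ℝ M) (f : N →ₗ[ℝ] M) (hf : ∀ n, n ≠ 0 → 0 < Q (f n)) :
    Module.finrank ℝ N ≤ sigPos Q := by
  have hinj : Function.Injective f := by
    rw [← LinearMap.ker_eq_bot, LinearMap.ker_eq_bot']
    intro n hn
    by_contra h
    have := hf n h
    rw [hn, map_zero] at this
    exact lt_irrefl _ this
  rw [← LinearMap.finrank_range_of_inj hinj]
  refine le_sigPos_of_posDef Q ?_
  rintro ⟨_, n, rfl⟩ hn
  refine hf n ?_
  rintro rfl
  exact hn (Subtype.ext (map_zero f))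

theorem sigPos_add_sigPos_le_sigPos_prod (Q : QuadraticForm ℝ M) (Q' : QuadraticForm ℝ M') :
    sigPos Q + sigPos Q' ≤ sigPos (Q.prod Q') := by
  obtain ⟨V, hV, hVp⟩ := exists_finrank_eq_sigPos_and_posDef Q
  obtain ⟨V', hV', hVp'⟩ := exists_finrank_eq_sigPos_and_posDef Q'
  rw [← hV, ← hV', ← Module.finrank_prod]
  refine finrank_le_sigPos_of_map _ (V.subtype.prodMap V'.subtype) ?_
  rintro ⟨v, v'⟩ hn
  have h1 : 0 ≤ Q v := by
    by_cases h : v = 0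
    · simp [h]
    · exact (hVp v h).le
  have h2 : 0 ≤ Q' v' := by
    by_cases h : v' = 0
    · simp [h]
    · exact (hVp' v' h).le
  change 0 < Q v + Q' v'
  by_cases h : v = 0
  · have h' : v' ≠ 0 := by rintro rfl; exact hn (by rw [h]; rfl)
    have : 0 < Q' v' := hVp' v' h'
    linarith
  · have : 0 < Q v := hVp v h
    linarith

/-- The orthogonal sum of nondegenerate forms is nondegenerate, and negative indices add up. -/
theorem nondegenerate_prod_and_sigNeg_prod {Q : QuadraticForm ℝ M} {Q' : QuadraticForm ℝ M'}
    (hQ : Q.Nondegenerate) (hQ' : Q'.Nondegenerate) :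
    (Q.prod Q').Nondegenerate ∧ sigNeg (Q.prod Q') = sigNeg Q + sigNeg Q' := by
  have h1 := sigPos_add_sigPos_le_sigPos_prod Q Q'
  have h2 : sigNeg Q + sigNeg Q' ≤ sigNeg (Q.prod Q') := by
    have := sigPos_add_sigPos_le_sigPos_prod (-Q) (-Q')
    have e : (-Q).prod (-Q') = -(Q.prod Q') := by
      ext v
      simp
      ring
    rwa [e, sigPos_neg, sigPos_neg, sigPos_neg] at this
  -- both indices are superadditive, and the dimensions leave no room for strict inequality
  have h3 := QuadraticForm.sigPos_add_sigNeg_add_radical (Q := Q.prod Q')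
  have h4 := QuadraticForm.sigPos_add_sigNeg_add_radical (Q := Q)
  have h5 := QuadraticForm.sigPos_add_sigNeg_add_radical (Q := Q')
  rw [nondegenerate_iff_radical_eq_bot] at hQ hQ' ⊢
  rw [hQ, finrank_bot] at h4
  rw [hQ', finrank_bot] at h5
  rw [Module.finrank_prod] at h3
  refine ⟨Submodule.finrank_eq_zero.1 (by omega), by omega⟩

open Classical in
/-- Adjoining to a subspace `H` a vector `e` orthogonal to it on which the form is positive raises
the positive index. -/
theorem sigPos_restrict_add_le (Q : QuadraticForm ℝ M) (H : Submodule ℝ M) (e : M)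
    (he : ∀ h ∈ H, ∀ s : ℝ, Q (h + s • e) = Q h + s * s * Q e) :
    sigPos (Q.restrict H) + (if 0 < Q e then 1 else 0) ≤ sigPos Q := by
  obtain ⟨V, hV, hVp⟩ := exists_finrank_eq_sigPos_and_posDef (Q.restrict H)
  rw [← hV]
  split_ifs with hpos
  · have : Module.finrank ℝ V + 1 = Module.finrank ℝ (V × ℝ) := by simp
    rw [this]
    refine finrank_le_sigPos_of_map Q
      ((H.subtype ∘ₗ V.subtype).coprod (LinearMap.toSpanSingleton ℝ M e)) ?_
    rintro ⟨v, s⟩ hn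
    have h0 : Q ((v : H) + s • e) = Q (v : H) + s * s * Q e := he _ (v : H).2 s
    change 0 < Q ((v : H) + s • e)
    rw [h0]
    by_cases hv : v = 0
    · have hs : s ≠ 0 := by rintro rfl; exact hn (by rw [hv]; rfl)
      have := mul_pos (mul_self_pos.2 hs) hpos
      simpa [hv] using this
    · have h1 : 0 < Q (v : H) := hVp v hv
      have := mul_nonneg (mul_self_nonneg s) hpos.le
      linarith
  · refine finrank_le_sigPos_of_map Q (H.subtype ∘ₗ V.subtype) fun v hv => ?_
    exact hVp v hv

variable {ι : Type} [Fintype ι]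

/-- The orthogonal complement of the vector `(1, …, 1)` with respect to `∑ w i * t i ^ 2`. -/
def weightHyperplane (w : ι → ℝ) : Submodule ℝ (ι → ℝ) :=
  LinearMap.ker (∑ i, w i • LinearMap.proj (R := ℝ) (φ := fun _ : ι => ℝ) i)

theorem mem_weightHyperplane {w t : ι → ℝ} : t ∈ weightHyperplane w ↔ ∑ i, w i * t i = 0 := by
  simp [weightHyperplane]

/-- The quadratic form `∑ w i * t i ^ 2` on the hyperplane `∑ w i * t i = 0`. -/
noncomputable def hyperplaneForm (w : ι → ℝ) : QuadraticForm ℝ (weightHyperplane w) :=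
  (weightedSumSquares ℝ w).restrict (weightHyperplane w)

theorem hyperplaneForm_apply (w : ι → ℝ) (t : weightHyperplane w) :
    hyperplaneForm w t = ∑ i, w i * (t.1 i * t.1 i) := by
  simp [hyperplaneForm, weightedSumSquares_apply]

open Classical in
/-- The vector `(1, …, 1)` is orthogonal to the hyperplane and the form takes the value `∑ w i`
on it; splitting it off removes one sign of the diagonal form. -/
theorem hyperplaneForm_nondegenerate_and_sigNeg {w : ι → ℝ} (hw : ∀ i, w i ≠ 0)
    (hr : ∑ i, w i ≠ 0) : (hyperplaneForm w).Nondegenerate ∧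
      sigNeg (hyperplaneForm w) + (if ∑ i, w i < 0 then 1 else 0) = {i | w i < 0}.ncard := by
  let Q := weightedSumSquares ℝ w
  let e : ι → ℝ := fun _ => 1
  have hQ : ∀ t : ι → ℝ, Q t = ∑ i, w i * (t i * t i) := fun t => by
    simp [Q, weightedSumSquares_apply]
  have hQe : Q e = ∑ i, w i := by simp [hQ, e]
  have he : ∀ h ∈ weightHyperplane w, ∀ s : ℝ, Q (h + s • e) = Q h + s * s * Q e := by
    intro h hh s
    rw [mem_weightHyperplane] at hh
    rw [hQe, hQ, hQ, Finset.mul_sum]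
    have : ∀ i, w i * ((h + s • e) i * (h + s • e) i) =
        w i * (h i * h i) + s * s * w i + 2 * s * (w i * h i) := by
      intro i; simp [e]; ring
    simp only [this, Finset.sum_add_distrib, ← Finset.mul_sum, hh]
    ring
  -- splitting off `e` gives lower bounds for both indices of the diagonal form, which are sharp for
  -- dimensional reasons once the restricted form is known to be nondegenerate
  have hp := sigPos_restrict_add_le Q _ e he
  have hn := sigPos_restrict_add_le (-Q) (weightHyperplane w) e (by
    intro h hh s
    simp only [neg_apply, he h hh s]
    ring)
  have hneg : (-Q).restrict (weightHyperplane w) = -(Q.restrict (weightHyperplane w)) := by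
    ext; rfl
  rw [hneg, sigPos_neg, sigPos_neg] at hn
  have hP : sigPos Q = {i | 0 < w i}.ncard := QuadraticForm.sigPos_weightedSumSquares
  have hN : sigNeg Q = {i | w i < 0}.ncard := QuadraticForm.sigNeg_weightedSumSquares
  have hcard : {i | 0 < w i}.ncard + {i | w i < 0}.ncard = Fintype.card ι := by
    have h1 : {i | w i < 0} = {i | 0 < w i}ᶜ := by
      ext i
      simp only [mem_ofPred_eq, mem_compl_iff, not_lt]
      exact ⟨fun h => h.le, fun h => lt_of_le_of_ne h (hw i)⟩
    rw [h1, Set.ncard_add_ncard_compl, Nat.card_eq_fintype_card]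
  have hdim : Module.finrank ℝ (weightHyperplane w) + 1 = Fintype.card ι := by
    have h1 : (∑ i, w i • LinearMap.proj (R := ℝ) (φ := fun _ : ι => ℝ) i) ≠ 0 := by
      intro h0
      have := LinearMap.congr_fun h0 e
      simp [e] at this
      exact hr this
    have h2 : Module.finrank ℝ (weightHyperplane w) + 1 = Module.finrank ℝ (ι → ℝ) :=
      Module.Dual.finrank_ker_add_one_of_ne_zero h1
    rwa [Module.finrank_fintype_fun_eq_card] at h2
  have hrad : (hyperplaneForm w).radical = ⊥ := by
    rw [Submodule.eq_bot_iff]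
    intro t ht
    rw [mem_radical_iff'] at ht
    have h0 := (mem_weightHyperplane.1 t.2)
    -- `t` is orthogonal to the hyperplane and to `(1, …, 1)`, hence to every vector
    have horth : ∀ u : weightHyperplane w, ∑ i, w i * (t.1 i * u.1 i) = 0 := by
      intro u
      have h1 := ht.2 u
      have h2 := ht.1
      rw [hyperplaneForm_apply] at h1 h2
      rw [hyperplaneForm_apply] at h1
      have : ∀ i, w i * ((t + u).1 i * (t + u).1 i) =
        w i * (t.1 i * t.1 i) + w i * (u.1 i * u.1 i) + 2 * (w i * (t.1 i * u.1 i)) := by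
        intro i; simp; ring
      simp only [this, Finset.sum_add_distrib, ← Finset.mul_sum] at h1
      linarith
    ext j
    let r := ∑ i, w i
    -- `r` times the projection of the `j`-th basis vector to the hyperplane
    let u : ι → ℝ := Pi.single j r - fun _ => w j
    have hu : u ∈ weightHyperplane w := by
      rw [mem_weightHyperplane]
      simp [u, mul_sub, Finset.sum_sub_distrib, Pi.single_apply, ← Finset.sum_mul, r]
      ring
    have h3 := horth ⟨u, hu⟩
    simp only [u, Pi.sub_apply, mul_sub, Finset.sum_sub_distrib, Pi.single_apply, mul_ite,
      mul_zero, Finset.sum_ite_eq', Finset.mem_univ, if_true] at h3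
    have h4 : ∑ i, w i * (t.1 i * w j) = 0 := by
      have : ∀ i, w i * (t.1 i * w j) = w j * (w i * t.1 i) := fun i => by ring
      simp only [this, ← Finset.mul_sum, h0, mul_zero]
    rw [h4, sub_zero] at h3
    have := (mul_eq_zero.1 h3).resolve_left (hw j)
    exact (mul_eq_zero.1 this).resolve_right hr
  have hsum := QuadraticForm.sigPos_add_sigNeg_add_radical (Q := hyperplaneForm w)
  rw [hrad, finrank_bot] at hsum
  refine ⟨nondegenerate_iff_radical_eq_bot.2 hrad, ?_⟩
  change sigPos (hyperplaneForm w) + _ ≤ _ at hp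
  change sigNeg (hyperplaneForm w) + _ ≤ _ at hn
  simp only [neg_apply, Left.neg_pos_iff] at hn
  rw [hQe] at hp hn
  rcases lt_or_gt_of_ne hr with h | h
  · simp only [h, h.not_gt, if_true, if_false] at hp hn ⊢
    omega
  · simp only [h, h.not_gt, if_true, if_false] at hp hn ⊢
    omega

end Signatures

/-! ### Vectors in the plane -/

section PlaneVectors

theorem plane_ext {u v : Plane} (h0 : u 0 = v 0) (h1 : u 1 = v 1) : u = v := by
  ext i
  fin_cases i
  · exact h0
  · exact h1

theorem plane_inner (u v : Plane) : inner ℝ u v = u 0 * v 0 + u 1 * v 1 := by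
  simp [PiLp.inner_apply, Fin.sum_univ_two, mul_comm]

theorem plane_norm_sq (u : Plane) : ‖u‖ ^ 2 = u 0 ^ 2 + u 1 ^ 2 := by
  rw [EuclideanSpace.real_norm_sq_eq, Fin.sum_univ_two]

theorem plane_norm_sq_pos {u : Plane} (h : u ≠ 0) : 0 < u 0 ^ 2 + u 1 ^ 2 := by
  rw [← plane_norm_sq]
  exact pow_pos (norm_pos_iff.2 h) 2

/-- The rotation of the plane by a right angle. -/
noncomputable def rot : Plane →ₗ[ℝ] Plane where
  toFun v := !₂[-v 1, v 0]
  map_add' u v := plane_ext (by simp; ring) (by simp)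
  map_smul' c v := plane_ext (by simp) (by simp)

@[simp] theorem rot_apply_zero (v : Plane) : rot v 0 = -v 1 := rfl

@[simp] theorem rot_apply_one (v : Plane) : rot v 1 = v 0 := rfl

theorem inner_rot_self (v : Plane) : inner ℝ v (rot v) = 0 := by
  rw [plane_inner]
  simp
  ring

theorem norm_rot (v : Plane) : ‖rot v‖ = ‖v‖ := by
  have : ‖rot v‖ ^ 2 = ‖v‖ ^ 2 := by
    rw [plane_norm_sq, plane_norm_sq, rot_apply_zero, rot_apply_one]
    ring
  exact (sq_eq_sq₀ (norm_nonneg _) (norm_nonneg _)).1 this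

theorem rot_ne_zero {v : Plane} (h : v ≠ 0) : rot v ≠ 0 := by
  rw [← norm_pos_iff, norm_rot]
  exact norm_pos_iff.2 h

/-- The coefficient of `rot e` in the orthogonal decomposition of a vector along `e` and
`rot e`. -/
noncomputable def rotCoeff (e : Plane) : Plane →ₗ[ℝ] ℝ := (‖e‖ ^ 2)⁻¹ • innerₗ Plane (rot e)

theorem rotCoeff_apply (e v : Plane) :
    rotCoeff e v = (e 0 ^ 2 + e 1 ^ 2)⁻¹ * (e 0 * v 1 - e 1 * v 0) := by
  rw [rotCoeff, plane_norm_sq, LinearMap.smul_apply, innerₗ_apply_apply, plane_inner]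
  simp only [rot_apply_zero, rot_apply_one, smul_eq_mul]
  ring

theorem rotCoeff_smul_rot {e : Plane} (he : e ≠ 0) (t : ℝ) : rotCoeff e (t • rot e) = t := by
  have := (plane_norm_sq_pos he).ne'
  rw [rotCoeff_apply]
  simp only [PiLp.smul_apply, rot_apply_zero, rot_apply_one, smul_eq_mul]
  field_simp
  ring

theorem eq_rotCoeff_smul_rot {e v : Plane} (he : e ≠ 0) (h : inner ℝ e v = 0) :
    v = rotCoeff e v • rot e := by
  have := (plane_norm_sq_pos he).ne'
  rw [plane_inner] at h
  have h0 : v 0 = -e 1 * rotCoeff e v := by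
    rw [rotCoeff_apply]
    field_simp
    linear_combination e 0 * h
  have h1 : v 1 = e 0 * rotCoeff e v := by
    rw [rotCoeff_apply]
    field_simp
    linear_combination e 1 * h
  refine plane_ext ?_ ?_
  · simp only [PiLp.smul_apply, rot_apply_zero, smul_eq_mul]; linarith
  · simp only [PiLp.smul_apply, rot_apply_one, smul_eq_mul]; linarith

theorem signedArea_smul_smul (a b : ℝ) (u v : Plane) :
    signedArea (a • u) (b • v) = a * b * signedArea u v := by
  simp [signedArea]
  ring

theorem signedArea_self (u : Plane) : signedArea u u = 0 := by
  simp [signedArea]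
  ring

theorem exists_smul_of_signedArea_eq_zero {u v : Plane} (hu : u ≠ 0) (h : signedArea u v = 0) :
    ∃ a : ℝ, v = a • u := by
  have := (plane_norm_sq_pos hu).ne'
  rw [signedArea] at h
  refine ⟨(u 0 ^ 2 + u 1 ^ 2)⁻¹ * (u 0 * v 0 + u 1 * v 1), plane_ext ?_ ?_⟩
  · simp only [PiLp.smul_apply, smul_eq_mul]
    field_simp
    linear_combination -u 1 * h
  · simp only [PiLp.smul_apply, smul_eq_mul]
    field_simp
    linear_combination u 0 * h

theorem exists_smul_rot_add_smul_rot {u v : Plane} (h : signedArea u v ≠ 0) (w : Plane) :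
    ∃ s t : ℝ, s • rot u + t • rot v = w := by
  obtain ⟨D, hD⟩ : ∃ D, D = signedArea u v := ⟨_, rfl⟩
  rw [← hD] at h
  refine ⟨(v 0 * w 0 + v 1 * w 1) / D, -(u 0 * w 0 + u 1 * w 1) / D, plane_ext ?_ ?_⟩
  all_goals
    simp only [PiLp.add_apply, PiLp.smul_apply, rot_apply_zero, rot_apply_one, smul_eq_mul]
    field_simp
    rw [hD, signedArea]
    ring

theorem exists_inner_eq_inner_eq {u v : Plane} (h : signedArea u v ≠ 0) (κ κ' : ℝ) :
    ∃ w : Plane, inner ℝ u w = κ ∧ inner ℝ v w = κ' := by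
  obtain ⟨D, hD⟩ : ∃ D, D = signedArea u v := ⟨_, rfl⟩
  rw [← hD] at h
  refine ⟨!₂[(κ * v 1 - κ' * u 1) / D, (κ' * u 0 - κ * v 0) / D], ?_, ?_⟩
  all_goals
    rw [plane_inner]
    simp only [Matrix.cons_val_zero, Matrix.cons_val_one]
    field_simp
    rw [hD, signedArea]
    ring

theorem eq_zero_of_inner_eq_zero {u v w : Plane} (h : signedArea u v ≠ 0)
    (hu : inner ℝ u w = 0) (hv : inner ℝ v w = 0) : w = 0 := by
  rw [plane_inner] at hu hv
  rw [signedArea] at h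
  refine plane_ext ?_ ?_
  · have : (u 0 * v 1 - u 1 * v 0) * w 0 = 0 := by linear_combination v 1 * hu - u 1 * hv
    simpa using (mul_eq_zero.1 this).resolve_left h
  · have : (u 0 * v 1 - u 1 * v 0) * w 1 = 0 := by linear_combination u 0 * hv - v 0 * hu
    simpa using (mul_eq_zero.1 this).resolve_left h

theorem exists_norm_eq_smul {u v : Plane} (hv : v ≠ 0) :
    ∃ c : ℝ, ‖c • v‖ = ‖u‖ := by
  refine ⟨‖u‖ / ‖v‖, ?_⟩
  rw [norm_smul, norm_div, norm_norm, norm_norm, div_mul_cancel₀ _ (norm_ne_zero_iff.2 hv)]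

end PlaneVectors

/-! ### Edges of the legs -/

theorem sum_succ_sub_castSucc {V : Type} [AddCommGroup V] {p : ℕ} (g : Fin (p + 1) → V) :
    ∑ j : Fin p, (g j.succ - g j.castSucc) = g (Fin.last p) - g 0 := by
  have h1 := Fin.sum_univ_succ g
  have h2 := Fin.sum_univ_castSucc g
  rw [Finset.sum_sub_distrib, sub_eq_sub_iff_add_eq_add, add_comm, ← h1, h2, add_comm]

namespace SpiderMechanism

variable {M : SpiderMechanism}

/-- The velocity of the joint `j` of leg `i` as a linear function of the velocity of the
configuration; the foot `j = 0` does not move. -/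
noncomputable def jointMap (i : Fin M.n) (j : Fin (M.p i + 1)) : M.Positions →L[ℝ] Plane :=
  if h₀ : (j : ℕ) = 0 then 0
  else if h₁ : (j : ℕ) = M.p i then ContinuousLinearMap.fst ℝ _ _
  else (ContinuousLinearMap.proj (R := ℝ) (φ := fun _ : Fin (M.p i - 1) => Plane)
      ⟨j - 1, by omega⟩).comp
    ((ContinuousLinearMap.proj (R := ℝ) (φ := fun i : Fin M.n => Fin (M.p i - 1) → Plane) i).comp
      (ContinuousLinearMap.snd ℝ _ _))

/-- The linear part of `edge`. -/
noncomputable def edgeMap (i : Fin M.n) (j : Fin (M.p i)) : M.Positions →L[ℝ] Plane :=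
  jointMap i j.succ - jointMap i j.castSucc

/-- The edge vectors of a leg. -/
noncomputable def edge (ξ : M.Positions) (i : Fin M.n) (j : Fin (M.p i)) : Plane :=
  leg ξ i j.succ - leg ξ i j.castSucc

theorem p_pos (i : Fin M.n) : 0 < M.p i := lt_trans zero_lt_one (M.one_lt_p i)

@[simp] theorem leg_zero (ξ : M.Positions) (i : Fin M.n) : leg ξ i 0 = M.foot i := by
  simp [leg]

@[simp] theorem leg_last (ξ : M.Positions) (i : Fin M.n) : leg ξ i (Fin.last _) = ξ.1 := by
  have := (p_pos i).ne'
  simp [leg, this]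

theorem leg_sub_leg (η ξ : M.Positions) (i : Fin M.n) (j : Fin (M.p i + 1)) :
    leg η i j - leg ξ i j = jointMap i j (η - ξ) := by
  unfold leg jointMap
  split_ifs <;> simp

theorem edge_sub_edge (η ξ : M.Positions) (i : Fin M.n) (j : Fin (M.p i)) :
    edge η i j - edge ξ i j = edgeMap i j (η - ξ) := by
  rw [edge, edge, edgeMap, sub_apply, ← leg_sub_leg, ← leg_sub_leg]
  abel

theorem sum_edge (ξ : M.Positions) (i : Fin M.n) : ∑ j, edge ξ i j = ξ.1 - M.foot i := by
  have := sum_succ_sub_castSucc (leg ξ i)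
  rwa [leg_last, leg_zero] at this

theorem sum_edgeMap (δ : M.Positions) (i : Fin M.n) : ∑ j, edgeMap i j δ = δ.1 := by
  have h := sum_edge δ i
  have h0 := sum_edge (0 : M.Positions) i
  have : ∀ j, edgeMap i j δ = edge δ i j - edge 0 i j := fun j => by
    rw [edge_sub_edge, sub_zero]
  simp only [this, Finset.sum_sub_distrib, h, h0]
  simp

theorem mem_spiderSpace_iff {ξ : M.Positions} :
    ξ ∈ M.spiderSpace ↔ ∀ i j, ‖edge ξ i j‖ = M.len i j := by
  simp only [spiderSpace, mem_ofPred_eq, edge, dist_eq_norm,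
    norm_sub_rev (leg ξ _ (Fin.succ _))]

theorem edge_ne_zero {ξ : M.Positions} (hξ : ξ ∈ M.spiderSpace) (i : Fin M.n) (j : Fin (M.p i)) :
    edge ξ i j ≠ 0 := by
  rw [← norm_pos_iff, mem_spiderSpace_iff.1 hξ i j]
  exact M.len_pos i j

/-- Prescribed edge velocities of one leg are realized by velocities of its joints. -/
theorem exists_joints (i : Fin M.n) (w : Plane) (ε : Fin (M.p i) → Plane) (h : ∑ j, ε j = w) :
    ∃ d : Fin (M.p i - 1) → Plane, ∀ δ : M.Positions, δ.1 = w → δ.2 i = d →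
      ∀ j, edgeMap i j δ = ε j := by
  have hlast : Fin.partialSum ε (Fin.last _) = w := by
    have := sum_succ_sub_castSucc (Fin.partialSum ε)
    simp only [Fin.partialSum_succ, add_sub_cancel_left, Fin.partialSum_zero, sub_zero] at this
    rw [← this, h]
  refine ⟨fun k => Fin.partialSum ε ⟨k + 1, by omega⟩, fun δ h1 h2 => ?_⟩
  have hj : ∀ j, jointMap i j δ = Fin.partialSum ε j := by
    intro j
    unfold jointMap
    split_ifs with h₀ h₁
    · have : j = 0 := Fin.ext h₀
      simp [this]
    · have : j = Fin.last _ := Fin.ext h₁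
      rw [this, hlast, ← h1]
      rfl
    · have h3 : j = ⟨(j : ℕ) - 1 + 1, by omega⟩ := Fin.ext (by simp; omega)
      change δ.2 i _ = _
      rw [h2]
      conv_rhs => rw [h3]
  intro j
  rw [edgeMap, sub_apply, hj, hj, Fin.partialSum_succ, add_sub_cancel_left]

theorem exists_position (w : Plane) (ε : ∀ i, Fin (M.p i) → Plane) (h : ∀ i, ∑ j, ε i j = w) :
    ∃ δ : M.Positions, δ.1 = w ∧ ∀ i j, edgeMap i j δ = ε i j := by
  choose d hd using fun i => exists_joints i w (ε i) (h i)
  exact ⟨(w, d), rfl, fun i => hd i _ rfl rfl⟩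

theorem exists_configuration (X : Plane) (e : ∀ i, Fin (M.p i) → Plane)
    (h : ∀ i, ∑ j, e i j = X - M.foot i) :
    ∃ η : M.Positions, η.1 = X ∧ ∀ i j, edge η i j = e i j := by
  obtain ⟨δ, h1, h2⟩ := exists_position X (fun i j => e i j - edge (0 : M.Positions) i j)
    (fun i => by rw [Finset.sum_sub_distrib, h, sum_edge]; simp)
  refine ⟨δ, h1, fun i j => ?_⟩
  have := edge_sub_edge δ 0 i j
  rw [sub_zero, h2] at this
  exact sub_left_injective this

theorem leg_eq_iff {η ξ : M.Positions} {i : Fin M.n} :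
    leg η i = leg ξ i ↔ η.1 = ξ.1 ∧ η.2 i = ξ.2 i := by
  constructor
  · intro h
    refine ⟨by rw [← leg_last η i, h, leg_last], funext fun k => ?_⟩
    have := congrFun h ⟨k + 1, by omega⟩
    have hk : (k : ℕ) + 1 ≠ M.p i := by omega
    simpa [leg, hk] using this
  · rintro ⟨h1, h2⟩
    ext1 j
    unfold leg
    rw [h1, h2]

theorem leg_eq_of_edge_eq {η ξ : M.Positions} {i : Fin M.n} (h : ∀ j, edge η i j = edge ξ i j) :
    leg η i = leg ξ i := by
  ext1 j
  induction j using Fin.induction with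
  | zero => simp
  | succ j ih =>
    have := h j
    rw [edge, edge, ih] at this
    exact sub_left_injective this

theorem edge_eq_of_leg_eq {η ξ : M.Positions} {i : Fin M.n} (h : leg η i = leg ξ i)
    (j : Fin (M.p i)) : edge η i j = edge ξ i j := by
  rw [edge, edge, h]

/-! ### Aligned legs -/

/-- The first edge of a leg. -/
noncomputable def firstEdge (ξ : M.Positions) (i : Fin M.n) : Plane := edge ξ i ⟨0, p_pos i⟩

theorem firstEdge_ne_zero {ξ : M.Positions} (hξ : ξ ∈ M.spiderSpace) (i : Fin M.n) :
    firstEdge ξ i ≠ 0 := edge_ne_zero hξ i _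

theorem leg_sub_foot_of_edge_smul {ξ : M.Positions} {i : Fin M.n} {u : Plane}
    (h : ∀ j, ∃ a : ℝ, edge ξ i j = a • u) (j : Fin (M.p i + 1)) :
    ∃ r : ℝ, leg ξ i j = r • u + M.foot i := by
  induction j using Fin.induction with
  | zero => exact ⟨0, by simp⟩
  | succ j ih =>
    obtain ⟨r, hr⟩ := ih
    obtain ⟨a, ha⟩ := h j
    refine ⟨a + r, ?_⟩
    rw [edge, sub_eq_iff_eq_add, hr] at ha
    rw [ha, add_smul, add_assoc]

theorem legAligned_iff_exists {ξ : M.Positions} {i : Fin M.n} :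
    LegAligned ξ i ↔ ∃ u : Plane, ∀ j, ∃ a : ℝ, edge ξ i j = a • u := by
  have h0 : M.foot i ∈ range (leg ξ i) := ⟨0, leg_zero ξ i⟩
  rw [LegAligned, collinear_iff_of_mem h0]
  constructor
  · rintro ⟨v, hv⟩
    refine ⟨v, fun j => ?_⟩
    obtain ⟨r, hr⟩ := hv _ (mem_range_self j.succ)
    obtain ⟨s, hs⟩ := hv _ (mem_range_self j.castSucc)
    refine ⟨r - s, ?_⟩
    rw [edge, hr, hs, sub_smul, vadd_eq_add, vadd_eq_add]
    abel
  · rintro ⟨u, hu⟩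
    refine ⟨u, ?_⟩
    rintro _ ⟨j, rfl⟩
    exact leg_sub_foot_of_edge_smul hu j

theorem legAligned_iff_signedArea {ξ : M.Positions} (hξ : ξ ∈ M.spiderSpace) {i : Fin M.n} :
    LegAligned ξ i ↔ ∀ j k, signedArea (edge ξ i j) (edge ξ i k) = 0 := by
  rw [legAligned_iff_exists]
  constructor
  · rintro ⟨u, hu⟩ j k
    obtain ⟨a, ha⟩ := hu j
    obtain ⟨b, hb⟩ := hu k
    rw [ha, hb, signedArea_smul_smul, signedArea_self, mul_zero]
  · intro h
    exact ⟨firstEdge ξ i, fun j =>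
      exists_smul_of_signedArea_eq_zero (firstEdge_ne_zero hξ i) (h _ _)⟩

theorem LegAligned.exists_smul_firstEdge {ξ : M.Positions} (hξ : ξ ∈ M.spiderSpace) {i : Fin M.n}
    (h : LegAligned ξ i) : ∃ a : Fin (M.p i) → ℝ, ∀ j, edge ξ i j = a j • firstEdge ξ i := by
  choose a ha using fun j => exists_smul_of_signedArea_eq_zero (firstEdge_ne_zero hξ i)
    ((legAligned_iff_signedArea hξ).1 h ⟨0, p_pos i⟩ j)
  exact ⟨a, ha⟩

theorem legLine_eq {ξ : M.Positions} (hξ : ξ ∈ M.spiderSpace) {i : Fin M.n}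
    (h : LegAligned ξ i) :
    legLine ξ i = line[ℝ, M.foot i, leg ξ i (Fin.succ ⟨0, p_pos i⟩)] := by
  have h1 : leg ξ i (Fin.castSucc ⟨0, p_pos i⟩) = M.foot i := leg_zero ξ i
  refine (Collinear.affineSpan_eq_of_ne h ⟨0, leg_zero ξ i⟩ (mem_range_self _) ?_).symm
  intro h2
  apply firstEdge_ne_zero hξ i
  rw [firstEdge, edge, ← h2, h1, sub_self]

theorem mem_legLine_iff {ξ : M.Positions} (hξ : ξ ∈ M.spiderSpace) {i : Fin M.n}
    (h : LegAligned ξ i) {Z : Plane} :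
    Z ∈ legLine ξ i ↔ ∃ r : ℝ, Z - M.foot i = r • firstEdge ξ i := by
  have h1 : leg ξ i (Fin.castSucc ⟨0, p_pos i⟩) = M.foot i := leg_zero ξ i
  rw [legLine_eq hξ h, mem_affineSpan_pair_iff_exists_lineMap_eq]
  refine exists_congr fun r => ?_
  rw [firstEdge, edge, h1, AffineMap.lineMap_apply, vsub_eq_sub, vadd_eq_add, sub_eq_iff_eq_add,
    eq_comm]

theorem parallel_of_signedArea_eq_zero {ξ : M.Positions} (hξ : ξ ∈ M.spiderSpace) {i k : Fin M.n}
    (hi : LegAligned ξ i) (hk : LegAligned ξ k)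
    (h : signedArea (firstEdge ξ i) (firstEdge ξ k) = 0) : (legLine ξ i).Parallel (legLine ξ k) := by
  obtain ⟨a, ha⟩ := exists_smul_of_signedArea_eq_zero (firstEdge_ne_zero hξ i) h
  have ha0 : a ≠ 0 := by
    rintro rfl
    exact firstEdge_ne_zero hξ k (by rw [ha, zero_smul])
  rw [legLine_eq hξ hi, legLine_eq hξ hk,
    AffineSubspace.affineSpan_pair_parallel_iff_vectorSpan_eq, vectorSpan_pair_rev,
    vectorSpan_pair_rev]
  have h1 : ∀ i, leg ξ i (Fin.succ ⟨0, p_pos i⟩) - M.foot i = firstEdge ξ i := fun i => by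
    rw [firstEdge, edge, ← leg_zero ξ i]; rfl
  rw [vsub_eq_sub, vsub_eq_sub, h1, h1, ha,
    Submodule.span_singleton_smul_eq (IsUnit.mk0 a ha0)]

/-- Aligned legs stay aligned when they are in the same position. -/
theorem legAligned_congr {η ξ : M.Positions} {i : Fin M.n} (h : leg η i = leg ξ i) :
    LegAligned η i ↔ LegAligned ξ i := by
  rw [LegAligned, LegAligned, h]

theorem legLine_congr {η ξ : M.Positions} {i : Fin M.n} (h : leg η i = leg ξ i) :
    legLine η i = legLine ξ i := by
  rw [legLine, legLine, h]

end SpiderMechanism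

/-! ### Infinitesimal motions of one leg -/

section EdgeVelocities

variable {p : ℕ} {e : Fin p → Plane}

theorem inner_div_smul_self {e : Plane} (he : e ≠ 0) (r : ℝ) :
    inner ℝ e ((r / ‖e‖ ^ 2) • e) = r := by
  have : ‖e‖ ≠ 0 := norm_ne_zero_iff.2 he
  rw [inner_smul_right, real_inner_self_eq_norm_sq]
  field_simp

/-- The end point of a leg with two nonparallel edges can be moved with any velocity, while the edge
lengths change at any prescribed rates: two edges can be rotated independently. -/
theorem exists_edge_velocities (he : ∀ j, e j ≠ 0) {j₁ j₂ : Fin p}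
    (h : signedArea (e j₁) (e j₂) ≠ 0) (w : Plane) (r : Fin p → ℝ) :
    ∃ ε : Fin p → Plane, ∑ j, ε j = w ∧ ∀ j, inner ℝ (e j) (ε j) = r j := by
  let ε₀ : Fin p → Plane := fun j => (r j / ‖e j‖ ^ 2) • e j
  obtain ⟨s, t, hst⟩ := exists_smul_rot_add_smul_rot h (w - ∑ j, ε₀ j)
  refine ⟨ε₀ + Pi.single j₁ (s • rot (e j₁)) + Pi.single j₂ (t • rot (e j₂)), ?_, fun j => ?_⟩
  · simp only [Pi.add_apply, Finset.sum_add_distrib, Finset.sum_pi_single', Finset.mem_univ,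
      if_true]
    rw [add_assoc, hst, add_sub_cancel]
  · have hz : ∀ (j' : Fin p) (s : ℝ),
        inner ℝ (e j) ((Pi.single j' (s • rot (e j')) : Fin p → Plane) j) = 0 := by
      intro j' s
      rcases eq_or_ne j j' with rfl | hj
      · rw [Pi.single_eq_same, inner_smul_right, inner_rot_self, mul_zero]
      · rw [Pi.single_eq_of_ne hj, inner_zero_right]
    rw [Pi.add_apply, Pi.add_apply, inner_add_right, inner_add_right, hz, hz, add_zero, add_zero]
    exact inner_div_smul_self (he j) (r j)

/-- If all edges are parallel to `u`, the rates of change of the edge lengths determine the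
component along `u` of the velocity of the end point, and the other component is arbitrary. -/
theorem exists_edge_velocities_of_smul (he : ∀ j, e j ≠ 0) {u : Plane} {a : Fin p → ℝ}
    (ha : ∀ j, e j = a j • u) (j₀ : Fin p) (w : Plane) (r : Fin p → ℝ)
    (hw : inner ℝ u w = ∑ j, r j / a j) :
    ∃ ε : Fin p → Plane, ∑ j, ε j = w ∧ ∀ j, inner ℝ (e j) (ε j) = r j := by
  let ε₀ : Fin p → Plane := fun j => (r j / ‖e j‖ ^ 2) • e j
  have ha0 : ∀ j, a j ≠ 0 := fun j h0 => he j (by rw [ha, h0, zero_smul])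
  have hu : inner ℝ u (w - ∑ j, ε₀ j) = 0 := by
    rw [inner_sub_right, hw, inner_sum, sub_eq_zero]
    refine Finset.sum_congr rfl fun j _ => ?_
    have h1 := inner_div_smul_self (he j) (r j)
    change inner ℝ (e j) (ε₀ j) = r j at h1
    rw [ha j, real_inner_smul_left] at h1
    rw [div_eq_iff (ha0 j), mul_comm, h1]
  refine ⟨ε₀ + Pi.single j₀ (w - ∑ j, ε₀ j), ?_, fun j => ?_⟩
  · simp only [Pi.add_apply, Finset.sum_add_distrib, Finset.sum_pi_single', Finset.mem_univ,
      if_true]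
    rw [add_sub_cancel]
  · have hz : inner ℝ (e j) ((Pi.single j₀ (w - ∑ j, ε₀ j) : Fin p → Plane) j) = 0 := by
      rcases eq_or_ne j j₀ with rfl | hj
      · rw [Pi.single_eq_same, ha, real_inner_smul_left, hu, mul_zero]
      · rw [Pi.single_eq_of_ne hj, inner_zero_right]
    rw [Pi.add_apply, inner_add_right, hz, add_zero]
    exact inner_div_smul_self (he j) (r j)

end EdgeVelocities

namespace SpiderMechanism

variable {M : SpiderMechanism} {Z : Plane}

/-- Edge lengths of one leg change at arbitrary rates `r` for every velocity `w` of the body,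
except that an aligned leg prescribes the component of `w` along the leg. -/
theorem exists_leg_velocities {ξ : M.Positions} (hξ : ξ ∈ M.spiderSpace) (i : Fin M.n)
    (r : Fin (M.p i) → ℝ) :
    ∃ κ : ℝ, (r = 0 → κ = 0) ∧ ∀ w : Plane, (LegAligned ξ i → inner ℝ (firstEdge ξ i) w = κ) →
      ∃ ε : Fin (M.p i) → Plane, ∑ j, ε j = w ∧ ∀ j, inner ℝ (edge ξ i j) (ε j) = r j := by
  by_cases h : LegAligned ξ i
  · obtain ⟨a, ha⟩ := h.exists_smul_firstEdge hξ
    refine ⟨∑ j, r j / a j, ?_, fun w hw => ?_⟩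
    · rintro rfl
      simp
    · exact exists_edge_velocities_of_smul (edge_ne_zero hξ i) ha ⟨0, p_pos i⟩ w r (hw h)
  · refine ⟨0, fun _ => rfl, fun w _ => ?_⟩
    rw [legAligned_iff_signedArea hξ] at h
    push Not at h
    obtain ⟨j, k, hjk⟩ := h
    exact exists_edge_velocities (edge_ne_zero hξ i) hjk w r

/-! ### Consequences of genericity -/

theorem StronglyGeneric.eq_or_eq (hgen : M.StronglyGeneric Z) {ξ : M.Positions}
    (hξ : ξ ∈ M.spiderSpace) {i k l : Fin M.n} (hik : i ≠ k) (hi : LegAligned ξ i)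
    (hk : LegAligned ξ k) (hl : LegAligned ξ l) : l = i ∨ l = k := by
  by_contra! h
  have h1 : ({i, k, l} : Set (Fin M.n)).ncard = 3 :=
    Set.ncard_eq_three.2 ⟨i, k, l, hik, h.1.symm, h.2.symm, rfl⟩
  have h2 : ({i, k, l} : Set (Fin M.n)) ⊆ {i | LegAligned ξ i} := by
    rintro x (rfl | rfl | rfl) <;> assumption
  have h3 := Set.ncard_le_ncard h2 (Set.toFinite _)
  have := hgen.aligned_le_two ξ hξ
  omega

theorem StronglyGeneric.signedArea_firstEdge_ne_zero (hgen : M.StronglyGeneric Z)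
    {ξ : M.Positions} (hξ : ξ ∈ M.spiderSpace) {i k : Fin M.n} (hik : i ≠ k)
    (hi : LegAligned ξ i) (hk : LegAligned ξ k) :
    signedArea (firstEdge ξ i) (firstEdge ξ k) ≠ 0 :=
  fun h => hgen.not_parallel ξ hξ i k hik hi hk (parallel_of_signedArea_eq_zero hξ hi hk h)

/-- If an aligned leg closed up at its foot, it could be rotated about the foot until it became
parallel to a second aligned leg. -/
theorem StronglyGeneric.body_ne_foot (hgen : M.StronglyGeneric Z) {ξ : M.Positions}
    (hξ : ξ ∈ M.spiderSpace) {i k : Fin M.n} (hik : i ≠ k) (hi : LegAligned ξ i)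
    (hk : LegAligned ξ k) : ξ.1 ≠ M.foot i := by
  intro h0
  obtain ⟨a, ha⟩ := hi.exists_smul_firstEdge hξ
  have hsum := sum_edge ξ i
  simp only [ha, ← Finset.sum_smul, h0, sub_self] at hsum
  have ha0 : ∑ j, a j = 0 := (smul_eq_zero.1 hsum).resolve_right (firstEdge_ne_zero hξ i)
  have hk0 := firstEdge_ne_zero hξ k
  obtain ⟨c, hc⟩ := exists_norm_eq_smul (u := firstEdge ξ i) hk0
  -- leg `i` turned about its foot to the direction of leg `k`, all other legs unchanged
  let e : ∀ l, Fin (M.p l) → Plane :=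
    Function.update (fun l j => edge ξ l j) i fun j => a j • c • firstEdge ξ k
  have hei : ∀ j, e i j = a j • c • firstEdge ξ k := fun j => by
    simp only [e, Function.update_self]
  have hel : ∀ l, l ≠ i → e l = edge ξ l := fun l hl => by
    simp only [e, Function.update_of_ne hl]
  obtain ⟨η, hη, hηe⟩ := exists_configuration (M := M) ξ.1 e fun l => by
    rcases eq_or_ne l i with rfl | hl
    · simp only [hei, ← Finset.sum_smul, ha0, zero_smul, h0, sub_self]
    · rw [hel l hl, sum_edge]
  have hηS : η ∈ M.spiderSpace := by
    rw [mem_spiderSpace_iff] at hξ ⊢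
    intro l j
    rw [hηe, ← hξ l j]
    rcases eq_or_ne l i with rfl | hl
    · rw [hei, norm_smul, hc, ha j, norm_smul]
    · rw [hel l hl]
  have hηi : LegAligned η i := legAligned_iff_exists.2
    ⟨c • firstEdge ξ k, fun j => ⟨a j, by rw [hηe, hei]⟩⟩
  have hleg : leg η k = leg ξ k := leg_eq_of_edge_eq fun j => by rw [hηe, hel k hik.symm]
  refine hgen.signedArea_firstEdge_ne_zero hηS hik hηi ((legAligned_congr hleg).2 hk) ?_
  have h1 : firstEdge η k = (1 : ℝ) • firstEdge ξ k := by
    rw [one_smul]; exact edge_eq_of_leg_eq hleg _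
  have h2 : firstEdge η i = (a ⟨0, p_pos i⟩ * c) • firstEdge ξ k := by
    rw [firstEdge, hηe, hei, mul_smul]
  rw [h1, h2, signedArea_smul_smul, signedArea_self, mul_zero]

/-- At most two legs are aligned and they are not parallel, so the components of the velocity of the
body along the aligned legs can be prescribed independently. -/
theorem StronglyGeneric.exists_inner_firstEdge_eq (hgen : M.StronglyGeneric Z) {ξ : M.Positions}
    (hξ : ξ ∈ M.spiderSpace) (κ : Fin M.n → ℝ) :
    ∃ w : Plane, ∀ i, LegAligned ξ i → inner ℝ (firstEdge ξ i) w = κ i := by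
  by_cases h1 : ∃ i, LegAligned ξ i
  · obtain ⟨i, hi⟩ := h1
    by_cases h2 : ∃ k, k ≠ i ∧ LegAligned ξ k
    · obtain ⟨k, hki, hk⟩ := h2
      obtain ⟨w, hwi, hwk⟩ := exists_inner_eq_inner_eq
        (hgen.signedArea_firstEdge_ne_zero hξ hki.symm hi hk) (κ i) (κ k)
      refine ⟨w, fun l hl => ?_⟩
      rcases hgen.eq_or_eq hξ hki.symm hi hk hl with rfl | rfl
      · exact hwi
      · exact hwk
    · push Not at h2
      refine ⟨(κ i / ‖firstEdge ξ i‖ ^ 2) • firstEdge ξ i, fun l hl => ?_⟩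
      have : l = i := by
        by_contra h
        exact h2 l h hl
      rw [this]
      exact inner_div_smul_self (firstEdge_ne_zero hξ i) _
  · exact ⟨0, fun i hi => (h1 ⟨i, hi⟩).elim⟩

/-! ### The spider space as a regular level set -/

/-- The squared lengths of the edges. -/
noncomputable def lengthMap (ξ : M.Positions) : ∀ i, Fin (M.p i) → ℝ :=
  fun i j => ‖edge ξ i j‖ ^ 2

theorem edge_eq_add (ξ : M.Positions) (i : Fin M.n) (j : Fin (M.p i)) :
    edge ξ i j = edge 0 i j + edgeMap i j ξ := by
  have := edge_sub_edge ξ 0 i j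
  rw [sub_zero] at this
  rw [← this, add_sub_cancel]

theorem edge_eq_add' (i : Fin M.n) (j : Fin (M.p i)) :
    (fun ξ : M.Positions => edge ξ i j) = fun ξ => edge 0 i j + edgeMap i j ξ :=
  funext fun ξ => edge_eq_add ξ i j

theorem contDiff_edge (i : Fin M.n) (j : Fin (M.p i)) :
    ContDiff ℝ ∞ fun ξ : M.Positions => edge ξ i j := by
  rw [edge_eq_add']
  exact contDiff_const.add (edgeMap i j).contDiff

theorem hasFDerivAt_normSq_edge (ξ : M.Positions) (i : Fin M.n) (j : Fin (M.p i)) :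
    ∃ L : M.Positions →L[ℝ] ℝ, HasFDerivAt (fun ξ : M.Positions => ‖edge ξ i j‖ ^ 2) L ξ ∧
      ∀ δ, L δ = 2 * inner ℝ (edge ξ i j) (edgeMap i j δ) := by
  have h1 : HasFDerivAt (fun ξ : M.Positions => edge ξ i j) (edgeMap i j) ξ := by
    rw [edge_eq_add']
    exact (edgeMap i j).hasFDerivAt.const_add _
  refine ⟨_, h1.norm_sq, fun δ => ?_⟩
  simp

theorem contDiff_lengthMap : ContDiff ℝ ∞ (lengthMap (M := M)) :=
  contDiff_pi.2 fun i => contDiff_pi.2 fun j => (contDiff_edge i j).norm_sq ℝ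

theorem fderiv_lengthMap_apply (ξ δ : M.Positions) (i : Fin M.n) (j : Fin (M.p i)) :
    fderiv ℝ lengthMap ξ δ i j = 2 * inner ℝ (edge ξ i j) (edgeMap i j δ) := by
  have h : HasFDerivAt lengthMap (fderiv ℝ lengthMap ξ) ξ :=
    (contDiff_lengthMap.differentiable (by simp) ξ).hasFDerivAt
  obtain ⟨L, hL, hLδ⟩ := hasFDerivAt_normSq_edge ξ i j
  have h1 := hasFDerivAt_pi'.1 (hasFDerivAt_pi'.1 h i) j
  rw [← hLδ, ← h1.unique hL]
  rfl

theorem spiderSpace_eq {ξ : M.Positions} (hξ : ξ ∈ M.spiderSpace) :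
    M.spiderSpace = {η | lengthMap η = lengthMap ξ} := by
  ext η
  rw [mem_spiderSpace_iff] at hξ ⊢
  rw [mem_ofPred_eq]
  constructor
  · intro h
    funext i j
    rw [lengthMap, lengthMap, h, hξ]
  · intro h i j
    have := congrFun (congrFun h i) j
    rw [lengthMap, lengthMap, sq_eq_sq₀ (norm_nonneg _) (norm_nonneg _)] at this
    rw [this, hξ]

theorem StronglyGeneric.surjective_fderiv_lengthMap (hgen : M.StronglyGeneric Z)
    {ξ : M.Positions} (hξ : ξ ∈ M.spiderSpace) :
    Function.Surjective (fderiv ℝ lengthMap ξ) := by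
  intro r
  choose κ _ hκ using fun i => exists_leg_velocities hξ i (fun j => r i j / 2)
  obtain ⟨w, hw⟩ := hgen.exists_inner_firstEdge_eq hξ κ
  choose ε hεw hε using fun i => hκ i w (hw i)
  obtain ⟨δ, -, hδ⟩ := exists_position w ε hεw
  refine ⟨δ, ?_⟩
  funext i j
  rw [fderiv_lengthMap_apply, hδ, hε]
  ring

theorem StronglyGeneric.isSubmanifold_spiderSpace (hgen : M.StronglyGeneric Z) :
    IsSubmanifold M.spiderSpace :=
  isSubmanifold_of_regular fun _ hξ =>
    ⟨lengthMap, contDiff_lengthMap, hgen.surjective_fderiv_lengthMap hξ, spiderSpace_eq hξ⟩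

theorem StronglyGeneric.mem_tangentSpaceAt (hgen : M.StronglyGeneric Z) {ξ : M.Positions}
    (hξ : ξ ∈ M.spiderSpace) {v : M.Positions} :
    v ∈ tangentSpaceAt M.spiderSpace ξ ↔ ∀ i j, inner ℝ (edge ξ i j) (edgeMap i j v) = 0 := by
  rw [spiderSpace_eq hξ,
    tangentSpaceAt_eq_ker contDiff_lengthMap (hgen.surjective_fderiv_lengthMap hξ)]
  constructor
  · intro h i j
    have := congrFun (congrFun (LinearMap.mem_ker.1 h) i) j
    change fderiv ℝ lengthMap ξ v i j = 0 at this
    rw [fderiv_lengthMap_apply] at this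
    linarith
  · intro h
    refine LinearMap.mem_ker.2 (funext fun i => funext fun j => ?_)
    change fderiv ℝ lengthMap ξ v i j = 0
    rw [fderiv_lengthMap_apply, h, mul_zero]

/-! ### Configurations with a fixed body and some fixed legs -/

/-- The configurations with the same body position as `ξ` and the same positions of the legs
in `I`. -/
def fixedLegs (ξ : M.Positions) (I : Finset (Fin M.n)) : Set M.Positions :=
  {η | η ∈ M.spiderSpace ∧ η.1 = ξ.1 ∧ ∀ i ∈ I, η.2 i = ξ.2 i}

/-- The body, the joints of the legs in `I`, and the squared edge lengths of the other legs. -/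
noncomputable def fixedLegsMap (I : Finset (Fin M.n)) (ξ : M.Positions) :
    Plane × (∀ i : I, Fin (M.p i - 1) → Plane) × (∀ i : ↥Iᶜ, Fin (M.p i) → ℝ) :=
  (ξ.1, fun i => ξ.2 i, fun i => lengthMap ξ i)

theorem contDiff_fixedLegsMap (I : Finset (Fin M.n)) : ContDiff ℝ ∞ (fixedLegsMap (M := M) I) := by
  refine contDiff_fst.prodMk (ContDiff.prodMk ?_ ?_)
  · exact contDiff_pi.2 fun i => contDiff_pi.1 contDiff_snd (i : Fin M.n)
  · exact contDiff_pi.2 fun i => contDiff_pi.1 contDiff_lengthMap (i : Fin M.n)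

theorem hasFDerivAt_fixedLegsMap (I : Finset (Fin M.n)) (ξ : M.Positions) :
    ∃ L : M.Positions →L[ℝ] Plane × (∀ i : I, Fin (M.p i - 1) → Plane) ×
      (∀ i : ↥Iᶜ, Fin (M.p i) → ℝ), HasFDerivAt (fixedLegsMap I) L ξ ∧ ∀ δ, L δ =
        (δ.1, fun i : I => δ.2 i, fun i : ↥Iᶜ => fderiv ℝ lengthMap ξ δ i) := by
  have h : HasFDerivAt lengthMap (fderiv ℝ lengthMap ξ) ξ :=
    (contDiff_lengthMap.differentiable (by simp) ξ).hasFDerivAt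
  have h2 : HasFDerivAt (fun ξ : M.Positions => fun i : I => ξ.2 i) _ ξ :=
    hasFDerivAt_pi.2 fun i => ((ContinuousLinearMap.proj (R := ℝ)
      (φ := fun i : Fin M.n => Fin (M.p i - 1) → Plane) (i : Fin M.n)).comp
      (ContinuousLinearMap.snd ℝ Plane _)).hasFDerivAt
  have h3 : HasFDerivAt (fun ξ : M.Positions => fun i : ↥Iᶜ => lengthMap ξ i) _ ξ :=
    hasFDerivAt_pi.2 fun i => (ContinuousLinearMap.proj (R := ℝ)
      (φ := fun i : Fin M.n => Fin (M.p i) → ℝ) (i : Fin M.n)).hasFDerivAt.comp ξ h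
  exact ⟨_, (hasFDerivAt_fst (p := ξ)).prodMk (h2.prodMk h3), fun δ => rfl⟩

theorem fderiv_fixedLegsMap_apply (I : Finset (Fin M.n)) (ξ δ : M.Positions) :
    fderiv ℝ (fixedLegsMap I) ξ δ =
      (δ.1, fun i : I => δ.2 i, fun i : ↥Iᶜ => fderiv ℝ lengthMap ξ δ i) := by
  obtain ⟨L, hL, hδ⟩ := hasFDerivAt_fixedLegsMap I ξ
  rw [hL.fderiv, hδ]

theorem fixedLegs_eq {ξ : M.Positions} (hξ : ξ ∈ M.spiderSpace) (I : Finset (Fin M.n)) :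
    fixedLegs ξ I = {η | fixedLegsMap I η = fixedLegsMap I ξ} := by
  ext η
  simp only [fixedLegs, fixedLegsMap, mem_ofPred_eq, Prod.mk.injEq, funext_iff (f := fun i : I => _),
    funext_iff (f := fun i : ↥Iᶜ => _), Subtype.forall]
  rw [spiderSpace_eq hξ, mem_ofPred_eq]
  constructor
  · rintro ⟨h1, h2, h3⟩
    exact ⟨h2, h3, fun i _ => by rw [h1]⟩
  · rintro ⟨h1, h2, h3⟩
    refine ⟨funext fun i => ?_, h1, h2⟩
    by_cases hi : i ∈ I
    · have := leg_eq_iff.2 ⟨h1, h2 i hi⟩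
      funext j
      rw [lengthMap, lengthMap, edge_eq_of_leg_eq this]
    · exact h3 i (Finset.mem_compl.2 hi)

theorem surjective_fderiv_fixedLegsMap {ξ : M.Positions} (hξ : ξ ∈ M.spiderSpace)
    {I : Finset (Fin M.n)} (hI : ∀ i ∉ I, ¬ LegAligned ξ i) :
    Function.Surjective (fderiv ℝ (fixedLegsMap I) ξ) := by
  classical
  rintro ⟨w, d, r⟩
  choose κ _ hκ using fun i : ↥Iᶜ => exists_leg_velocities hξ i (fun j => r i j / 2)
  choose ε hεw hε using fun i : ↥Iᶜ => hκ i w (fun h => (hI i (Finset.mem_compl.1 i.2) h).elim)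
  choose d' hd' using fun i : ↥Iᶜ => exists_joints (M := M) i w (ε i) (hεw i)
  let δ : M.Positions := (w, fun i => if h : i ∈ I then d ⟨i, h⟩ else d' ⟨i, Finset.mem_compl.2 h⟩)
  refine ⟨δ, ?_⟩
  rw [fderiv_fixedLegsMap_apply]
  refine Prod.ext rfl (Prod.ext (funext fun i => ?_) (funext fun i => funext fun j => ?_))
  · change (if h : (i : Fin M.n) ∈ I then d ⟨i, h⟩ else d' ⟨i, Finset.mem_compl.2 h⟩) = d i
    rw [dif_pos i.2]
  · change fderiv ℝ lengthMap ξ δ i j = r i j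
    rw [fderiv_lengthMap_apply, hd' i δ rfl (dif_neg (Finset.mem_compl.1 i.2)), hε]
    ring

theorem fixedLegs_congr {η ξ : M.Positions} {I : Finset (Fin M.n)} (h : η ∈ fixedLegs ξ I) :
    fixedLegs η I = fixedLegs ξ I := by
  ext ζ
  simp only [fixedLegs, mem_ofPred_eq]
  rw [h.2.1]
  refine and_congr_right fun _ => and_congr_right fun _ => forall₂_congr fun i hi => ?_
  rw [h.2.2 i hi]

/-- Fixing the body and the legs in `I` gives a submanifold if the remaining legs are never aligned,
since a leg that is not aligned admits all rates of change of its edge lengths with its end points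
held fixed. -/
theorem isSubmanifold_fixedLegs {ξ : M.Positions} {I : Finset (Fin M.n)}
    (hI : ∀ η ∈ fixedLegs ξ I, ∀ i ∉ I, ¬ LegAligned η i) : IsSubmanifold (fixedLegs ξ I) :=
  isSubmanifold_of_regular fun η hη =>
    ⟨fixedLegsMap I, contDiff_fixedLegsMap I, surjective_fderiv_fixedLegsMap hη.1 (hI η hη),
      by rw [← fixedLegs_congr hη, fixedLegs_eq hη.1]⟩

theorem snd_eq_zero_iff {v : M.Positions} (hv : v.1 = 0) {i : Fin M.n} :
    v.2 i = 0 ↔ ∀ j, edgeMap i j v = 0 := by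
  have h0 : leg v i = leg 0 i ↔ v.2 i = 0 := by
    rw [leg_eq_iff]
    exact ⟨fun h => h.2, fun h => ⟨hv, h⟩⟩
  rw [← h0]
  constructor
  · intro h j
    rw [← sub_zero v, ← edge_sub_edge, edge_eq_of_leg_eq h, sub_self]
  · intro h
    refine leg_eq_of_edge_eq fun j => ?_
    rw [edge_eq_add v, h, add_zero]

theorem StronglyGeneric.mem_tangentSpaceAt_fixedLegs (hgen : M.StronglyGeneric Z)
    {ξ : M.Positions} (hξ : ξ ∈ M.spiderSpace)
    {I : Finset (Fin M.n)} (hI : ∀ i ∉ I, ¬ LegAligned ξ i) {v : M.Positions}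
    (hv : v ∈ tangentSpaceAt M.spiderSpace ξ) :
    v ∈ tangentSpaceAt (fixedLegs ξ I) ξ ↔ v.1 = 0 ∧ ∀ i ∈ I, ∀ j, edgeMap i j v = 0 := by
  rw [fixedLegs_eq hξ,
    tangentSpaceAt_eq_ker (contDiff_fixedLegsMap I) (surjective_fderiv_fixedLegsMap hξ hI)]
  rw [hgen.mem_tangentSpaceAt hξ] at hv
  have hker : v ∈ LinearMap.ker (fderiv ℝ (fixedLegsMap I) ξ).toLinearMap ↔
      v.1 = 0 ∧ ∀ i ∈ I, v.2 i = 0 := by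
    rw [LinearMap.mem_ker]
    change fderiv ℝ (fixedLegsMap I) ξ v = 0 ↔ _
    rw [fderiv_fixedLegsMap_apply, Prod.mk_eq_zero, Prod.mk_eq_zero]
    constructor
    · rintro ⟨h1, h2, -⟩
      exact ⟨h1, fun i hi => congrFun h2 ⟨i, hi⟩⟩
    · rintro ⟨h1, h2⟩
      refine ⟨h1, funext fun i => h2 i i.2, funext fun i => funext fun j => ?_⟩
      change fderiv ℝ lengthMap ξ v i j = 0
      rw [fderiv_lengthMap_apply, hv, mul_zero]
  rw [hker]
  refine and_congr_right fun h => forall₂_congr fun i _ => ?_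
  exact snd_eq_zero_iff h

end SpiderMechanism

/-! ### Critical points of the squared distance -/

section PlaneVectors

theorem eq_of_smul_of_inner_pos {x y v : Plane} {a b : ℝ} (hx : x = a • v) (hy : y = b • v)
    (hn : ‖x‖ = ‖y‖) (h : 0 < inner ℝ x y) : x = y := by
  rw [hx, hy, inner_smul_left, inner_smul_right, real_inner_self_eq_norm_sq] at h
  simp only [conj_trivial] at h
  have hv : v ≠ 0 := by rintro rfl; simp at h
  have hv' : 0 < ‖v‖ := norm_pos_iff.2 hv
  have hab : 0 < a * b := by
    by_contra hc
    push Not at hc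
    have := mul_nonpos_of_nonpos_of_nonneg hc (sq_nonneg ‖v‖)
    linarith
  rw [hx, hy, norm_smul, norm_smul, mul_left_inj' hv'.ne', Real.norm_eq_abs, Real.norm_eq_abs,
    abs_eq_abs] at hn
  rcases hn with hn | hn
  · rw [hx, hy, hn]
  · have := mul_self_nonneg b
    rw [hn] at hab
    linarith

/-- Two circles with distinct centres meet in at most one point on each side of the line through the
centres. -/
theorem eq_of_norm_sub_eq {x y A B : Plane} (hA : ‖x - A‖ = ‖y - A‖) (hB : ‖x - B‖ = ‖y - B‖)
    (h : 0 < signedArea (x - A) (x - B) * signedArea (y - A) (y - B)) : x = y := by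
  have hA' : ‖x - A‖ ^ 2 = ‖y - A‖ ^ 2 := by rw [hA]
  have hB' : ‖x - B‖ ^ 2 = ‖y - B‖ ^ 2 := by rw [hB]
  rw [plane_norm_sq, plane_norm_sq] at hA' hB'
  simp only [signedArea, PiLp.sub_apply] at h hA' hB'
  obtain ⟨d0, hd0⟩ : ∃ d0, B 0 = A 0 + d0 := ⟨B 0 - A 0, by ring⟩
  obtain ⟨d1, hd1⟩ : ∃ d1, B 1 = A 1 + d1 := ⟨B 1 - A 1, by ring⟩
  obtain ⟨p0, hp0⟩ : ∃ p0, x 0 = A 0 + p0 := ⟨x 0 - A 0, by ring⟩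
  obtain ⟨p1, hp1⟩ : ∃ p1, x 1 = A 1 + p1 := ⟨x 1 - A 1, by ring⟩
  obtain ⟨q0, hq0⟩ : ∃ q0, y 0 = A 0 + q0 := ⟨y 0 - A 0, by ring⟩
  obtain ⟨q1, hq1⟩ : ∃ q1, y 1 = A 1 + q1 := ⟨y 1 - A 1, by ring⟩
  rw [hd0, hd1, hp0, hp1, hq0, hq1] at h hB'
  rw [hp0, hp1, hq0, hq1] at hA'
  -- the components of `x - A` and `y - A` along the line of centres agree, and those across it
  -- agree up to sign
  have hpar : p0 * d0 + p1 * d1 = q0 * d0 + q1 * d1 := by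
    linear_combination (hA' - hB') / 2
  have harea : (p0 * d1 - p1 * d0) ^ 2 = (q0 * d1 - q1 * d0) ^ 2 := by
    have e1 : (p0 * d1 - p1 * d0) ^ 2 =
      (p0 ^ 2 + p1 ^ 2) * (d0 ^ 2 + d1 ^ 2) - (p0 * d0 + p1 * d1) ^ 2 := by ring
    have e2 : (q0 * d1 - q1 * d0) ^ 2 =
      (q0 ^ 2 + q1 ^ 2) * (d0 ^ 2 + d1 ^ 2) - (q0 * d0 + q1 * d1) ^ 2 := by ring
    have e3 : p0 ^ 2 + p1 ^ 2 = q0 ^ 2 + q1 ^ 2 := by linarith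
    rw [e1, e2, hpar, e3]
  have h' : 0 < (p0 * d1 - p1 * d0) * (q0 * d1 - q1 * d0) := by
    convert h using 1
    ring
  have harea' : p0 * d1 - p1 * d0 = q0 * d1 - q1 * d0 := by
    rcases sq_eq_sq_iff_eq_or_eq_neg.1 harea with h1 | h1
    · exact h1
    · rw [h1] at h'
      have := mul_self_nonneg (q0 * d1 - q1 * d0)
      linarith
  have hd : d0 ^ 2 + d1 ^ 2 ≠ 0 := by
    intro hd
    have h2 := sq_nonneg d0
    have h3 := sq_nonneg d1
    have h0 : d0 = 0 := (pow_eq_zero_iff two_ne_zero).1 (by linarith)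
    have h1 : d1 = 0 := (pow_eq_zero_iff two_ne_zero).1 (by linarith)
    rw [h0, h1] at h'
    simp at h'
  have r0 : (d0 ^ 2 + d1 ^ 2) * (p0 - q0) = 0 := by linear_combination d0 * hpar + d1 * harea'
  have r1 : (d0 ^ 2 + d1 ^ 2) * (p1 - q1) = 0 := by linear_combination d1 * hpar - d0 * harea'
  have s0 := (mul_eq_zero.1 r0).resolve_left hd
  have s1 := (mul_eq_zero.1 r1).resolve_left hd
  exact plane_ext (by rw [hp0, hq0]; linarith) (by rw [hp1, hq1]; linarith)

end PlaneVectors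

namespace SpiderMechanism

variable {M : SpiderMechanism} {Z : Plane}

theorem contDiff_sqDist (Z : Plane) : ContDiff ℝ ∞ (M.sqDist Z) :=
  (contDiff_fst.sub contDiff_const).norm_sq ℝ

theorem deriv_sqDist_comp {ξ : M.Positions} {S : Set M.Positions} {γ : ℝ → M.Positions}
    (hγ : IsCurveIn S ξ γ) :
    deriv (fun t => M.sqDist Z (γ t)) 0 = 2 * inner ℝ (ξ.1 - Z) (deriv γ 0).1 := by
  have h1 : HasDerivAt (fun t => (γ t).1) (deriv γ 0).1 0 :=
    (ContinuousLinearMap.fst ℝ Plane (∀ i, Fin (M.p i - 1) → Plane)).hasFDerivAt.comp_hasDerivAt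
      (0 : ℝ) hγ.hasDerivAt
  have h2 := (h1.sub_const Z).norm_sq
  rw [hγ.base] at h2
  exact h2.deriv

/-- Tangent vectors with a prescribed velocity `w` of the body exist as soon as `w` is orthogonal to
the aligned legs; the edge velocities of the legs in `I` may be prescribed. -/
theorem StronglyGeneric.exists_tangent (hgen : M.StronglyGeneric Z) {ξ : M.Positions}
    (hξ : ξ ∈ M.spiderSpace) (I : Finset (Fin M.n)) (w : Plane) (ε₀ : ∀ l, Fin (M.p l) → Plane)
    (hsum : ∀ l ∈ I, ∑ j, ε₀ l j = w) (horth : ∀ l ∈ I, ∀ j, inner ℝ (edge ξ l j) (ε₀ l j) = 0)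
    (hI : ∀ l ∉ I, LegAligned ξ l → inner ℝ (firstEdge ξ l) w = 0) :
    ∃ v ∈ tangentSpaceAt M.spiderSpace ξ, v.1 = w ∧ ∀ l ∈ I, ∀ j, edgeMap l j v = ε₀ l j := by
  have key : ∀ l, ∃ ε : Fin (M.p l) → Plane, ∑ j, ε j = w ∧
      (∀ j, inner ℝ (edge ξ l j) (ε j) = 0) ∧ (l ∈ I → ε = ε₀ l) := by
    intro l
    by_cases hl : l ∈ I
    · exact ⟨ε₀ l, hsum l hl, horth l hl, fun _ => rfl⟩
    · obtain ⟨κ, hκ0, hκ⟩ := exists_leg_velocities hξ l 0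
      obtain ⟨ε, h1, h2⟩ := hκ w (fun h => by rw [hκ0 rfl, hI l hl h])
      exact ⟨ε, h1, h2, fun h => (hl h).elim⟩
  choose ε h1 h2 h3 using key
  obtain ⟨v, hv, hvε⟩ := exists_position w ε h1
  refine ⟨v, (hgen.mem_tangentSpaceAt hξ).2 fun i j => by rw [hvε, h2], hv, fun l hl j => ?_⟩
  rw [hvε, h3 l hl]

theorem StronglyGeneric.inner_firstEdge_eq_zero (hgen : M.StronglyGeneric Z) {ξ : M.Positions}
    (hξ : ξ ∈ M.spiderSpace) {v : M.Positions} (hv : v ∈ tangentSpaceAt M.spiderSpace ξ)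
    {i : Fin M.n} (hi : LegAligned ξ i) : inner ℝ (firstEdge ξ i) v.1 = 0 := by
  obtain ⟨a, ha⟩ := hi.exists_smul_firstEdge hξ
  rw [← sum_edgeMap v i, inner_sum]
  refine Finset.sum_eq_zero fun j _ => ?_
  have h1 := (hgen.mem_tangentSpaceAt hξ).1 hv i j
  have h2 : a j ≠ 0 := fun h => edge_ne_zero hξ i j (by rw [ha, h, zero_smul])
  rw [ha, real_inner_smul_left] at h1
  exact (mul_eq_zero.1 h1).resolve_left h2

/-- A configuration is critical if and only if `X - Z` is orthogonal to all velocities of the body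
that are orthogonal to the aligned legs. -/
theorem StronglyGeneric.mem_criticalSet_iff (hgen : M.StronglyGeneric Z) {ξ : M.Positions}
    (hξ : ξ ∈ M.spiderSpace) : ξ ∈ criticalSet (M.sqDist Z) M.spiderSpace ↔
      ∀ w : Plane, (∀ i, LegAligned ξ i → inner ℝ (firstEdge ξ i) w = 0) →
        inner ℝ (ξ.1 - Z) w = 0 := by
  constructor
  · rintro ⟨-, h⟩ w hw
    obtain ⟨v, hv, hvw, -⟩ := hgen.exists_tangent hξ ∅ w 0 (by simp) (by simp)
      fun l _ hl => hw l hl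
    rw [spiderSpace_eq hξ,
      tangentSpaceAt_eq_ker contDiff_lengthMap (hgen.surjective_fderiv_lengthMap hξ)] at hv
    obtain ⟨γ, hγ, hγv⟩ := exists_curve_of_mem_ker contDiff_lengthMap
      (hgen.surjective_fderiv_lengthMap hξ) hv
    rw [← spiderSpace_eq hξ] at hγ
    have := h γ hγ
    rw [deriv_sqDist_comp hγ, hγv, hvw] at this
    linarith
  · refine fun h => ⟨hξ, fun γ hγ => ?_⟩
    have hv : deriv γ 0 ∈ tangentSpaceAt M.spiderSpace ξ := Submodule.subset_span ⟨γ, hγ, rfl⟩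
    rw [deriv_sqDist_comp hγ, h _ fun i hi => hgen.inner_firstEdge_eq_zero hξ hv hi, mul_zero]

theorem LegAligned.exists_body_sub_foot_eq_smul {ξ : M.Positions} (hξ : ξ ∈ M.spiderSpace)
    {i : Fin M.n} (hi : LegAligned ξ i) : ∃ r : ℝ, ξ.1 - M.foot i = r • firstEdge ξ i := by
  obtain ⟨a, ha⟩ := hi.exists_smul_firstEdge hξ
  refine ⟨∑ j, a j, ?_⟩
  rw [← sum_edge ξ i, Finset.sum_smul]
  exact Finset.sum_congr rfl fun j _ => ha j

theorem mem_legLine_iff_body {ξ : M.Positions} (hξ : ξ ∈ M.spiderSpace) {i : Fin M.n}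
    (hi : LegAligned ξ i) : Z ∈ legLine ξ i ↔ ∃ r : ℝ, ξ.1 - Z = r • firstEdge ξ i := by
  rw [mem_legLine_iff hξ hi]
  obtain ⟨r₀, hr₀⟩ := hi.exists_body_sub_foot_eq_smul hξ
  constructor
  · rintro ⟨r, hr⟩
    refine ⟨r₀ - r, ?_⟩
    rw [sub_smul, ← hr, ← hr₀]
    abel
  · rintro ⟨r, hr⟩
    refine ⟨r₀ - r, ?_⟩
    rw [sub_smul, ← hr, ← hr₀]
    abel

/-- The classification of the critical points by the number of aligned legs: for no aligned leg all
velocities of the body are admissible, for one aligned leg those normal to it, and for two aligned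
legs none. -/
theorem StronglyGeneric.criticalSet_eq (hgen : M.StronglyGeneric Z) :
    criticalSet (M.sqDist Z) M.spiderSpace =
      {ξ | ξ ∈ M.spiderSpace ∧ (ξ.1 = Z ∨ (∃ i, LegAligned ξ i ∧ Z ∈ legLine ξ i) ∨
        ∃ i k, i ≠ k ∧ LegAligned ξ i ∧ LegAligned ξ k)} := by
  ext ξ
  rw [mem_ofPred_eq]
  by_cases hξ : ξ ∈ M.spiderSpace
  swap
  · exact ⟨fun h => (hξ h.1).elim, fun h => (hξ h.1).elim⟩
  rw [hgen.mem_criticalSet_iff hξ]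
  constructor
  · intro h
    refine ⟨hξ, ?_⟩
    by_cases h1 : ∃ i, LegAligned ξ i
    · obtain ⟨i, hi⟩ := h1
      right
      by_cases h2 : ∃ k, k ≠ i ∧ LegAligned ξ k
      · obtain ⟨k, hki, hk⟩ := h2
        exact Or.inr ⟨i, k, hki.symm, hi, hk⟩
      · push Not at h2
        refine Or.inl ⟨i, hi, (mem_legLine_iff_body hξ hi).2 ?_⟩
        have h3 := h (rot (firstEdge ξ i)) fun l hl => by
          have : l = i := by
            by_contra hli
            exact h2 l hli hl
          rw [this, inner_rot_self]
        refine exists_smul_of_signedArea_eq_zero (firstEdge_ne_zero hξ i) ?_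
        rw [plane_inner] at h3
        rw [signedArea]
        simp only [rot_apply_zero, rot_apply_one] at h3
        linarith
    · left
      have h3 := h (ξ.1 - Z) fun i hi => (h1 ⟨i, hi⟩).elim
      rwa [inner_self_eq_zero, sub_eq_zero] at h3
  · rintro ⟨-, h | ⟨i, hi, hZ⟩ | ⟨i, k, hik, hi, hk⟩⟩ w hw
    · rw [h, sub_self, inner_zero_left]
    · obtain ⟨r, hr⟩ := (mem_legLine_iff_body hξ hi).1 hZ
      rw [hr, real_inner_smul_left, hw i hi, mul_zero]
    · rw [eq_zero_of_inner_eq_zero (hgen.signedArea_firstEdge_ne_zero hξ hik hi hk) (hw i hi)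
        (hw k hk), inner_zero_right]

/-! ### The critical manifolds -/

theorem continuous_edge (i : Fin M.n) (j : Fin (M.p i)) :
    Continuous fun ξ : M.Positions => edge ξ i j := (contDiff_edge i j).continuous

theorem continuous_signedArea {T : Type} [TopologicalSpace T] {f g : T → Plane}
    (hf : Continuous f) (hg : Continuous g) : Continuous fun t => signedArea (f t) (g t) := by
  unfold signedArea
  fun_prop

/-- The configurations of `M.spiderSpace` with an aligned leg `i` are those in this set. -/
def alignedSet (i : Fin M.n) : Set M.Positions :=
  {ξ | ∀ j k, signedArea (edge ξ i j) (edge ξ i k) = 0}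

theorem isClosed_alignedSet (i : Fin M.n) : IsClosed (alignedSet (M := M) i) := by
  simp only [alignedSet, ofPred_forall]
  exact isClosed_iInter fun j => isClosed_iInter fun k =>
    isClosed_eq (continuous_signedArea (continuous_edge i j) (continuous_edge i k))
      continuous_const

theorem mem_alignedSet_iff {ξ : M.Positions} (hξ : ξ ∈ M.spiderSpace) {i : Fin M.n} :
    ξ ∈ alignedSet i ↔ LegAligned ξ i := (legAligned_iff_signedArea hξ).symm

/-- The positions in which no leg outside `I` is aligned. -/
def alignedOnlyIn (I : Finset (Fin M.n)) : Set M.Positions := {η | ∀ l ∉ I, η ∉ alignedSet l}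

theorem isOpen_alignedOnlyIn (I : Finset (Fin M.n)) : IsOpen (alignedOnlyIn (M := M) I) := by
  simp only [alignedOnlyIn, ofPred_forall]
  exact isOpen_iInter_of_finite fun l => isOpen_iInter_of_finite fun _ =>
    (isClosed_alignedSet l).isOpen_compl

/-- The positions in which every edge of leg `i` forms an acute angle with the corresponding edge
in `ξ`. -/
def nearLeg (ξ : M.Positions) (i : Fin M.n) : Set M.Positions :=
  {η | ∀ j, 0 < inner ℝ (edge η i j) (edge ξ i j)}

theorem isOpen_nearLeg (ξ : M.Positions) (i : Fin M.n) : IsOpen (nearLeg ξ i) := by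
  simp only [nearLeg, ofPred_forall]
  exact isOpen_iInter_of_finite fun j =>
    isOpen_lt continuous_const ((continuous_edge i j).inner continuous_const)

theorem mem_nearLeg_of_leg_eq {η ξ : M.Positions} (hξ : ξ ∈ M.spiderSpace) {i : Fin M.n}
    (h : leg η i = leg ξ i) : η ∈ nearLeg ξ i := by
  intro j
  rw [edge_eq_of_leg_eq h, real_inner_self_eq_norm_sq]
  exact pow_pos (norm_pos_iff.2 (edge_ne_zero hξ i j)) 2

theorem isClosed_fixed (ξ : M.Positions) (I : Finset (Fin M.n)) :
    IsClosed {η : M.Positions | η.1 = ξ.1 ∧ ∀ i ∈ I, η.2 i = ξ.2 i} := by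
  simp only [ofPred_and, ofPred_forall]
  refine (isClosed_eq continuous_fst continuous_const).inter
    (isClosed_iInter fun i => isClosed_iInter fun _ => isClosed_eq ?_ continuous_const)
  exact (continuous_apply i).comp continuous_snd

theorem leg_eq_of_mem_fixedLegs {η ξ : M.Positions} {I : Finset (Fin M.n)}
    (h : η ∈ fixedLegs ξ I) {i : Fin M.n} (hi : i ∈ I) : leg η i = leg ξ i :=
  leg_eq_iff.2 ⟨h.2.1, h.2.2 i hi⟩

/-- A set of configurations with some legs fixed is a critical manifold if it consists of critical
points at which no other legs are aligned, and if it is relatively open in the critical set. -/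
theorem isCriticalManifold_fixedLegs {ξ : M.Positions} {I : Finset (Fin M.n)}
    (hcrit : fixedLegs ξ I ⊆ criticalSet (M.sqDist Z) M.spiderSpace)
    (hI : ∀ η ∈ fixedLegs ξ I, ∀ i ∉ I, ¬ LegAligned η i)
    (hopen : ∃ U : Set M.Positions, IsOpen U ∧ fixedLegs ξ I ⊆ U ∧
      criticalSet (M.sqDist Z) M.spiderSpace ∩ U ⊆ fixedLegs ξ I) :
    IsCriticalManifold (M.sqDist Z) M.spiderSpace (fixedLegs ξ I) where
  subset := hcrit
  submanifold := isSubmanifold_fixedLegs hI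
  isOpen_rel := by
    obtain ⟨U, hU, h1, h2⟩ := hopen
    exact ⟨U, hU, h2.antisymm fun η hη => ⟨hcrit hη, h1 hη⟩⟩
  isClosed_rel := ⟨_, isClosed_fixed ξ I, Subset.antisymm (fun _ hη => ⟨hη.1.1, hη.2⟩)
    fun _ hη => ⟨hcrit hη, hη.2⟩⟩

theorem bodyAt_eq_fixedLegs {ξ : M.Positions} (hξ : ξ ∈ M.bodyAt Z) :
    M.bodyAt Z = fixedLegs ξ ∅ := by
  ext η
  simp only [bodyAt, fixedLegs, mem_ofPred_eq, hξ.2]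
  simp

theorem sameLeg_eq_fixedLegs (ξ : M.Positions) (i : Fin M.n) :
    sameLeg ξ i = fixedLegs ξ {i} := by
  ext η
  simp only [sameLeg, fixedLegs, mem_ofPred_eq, leg_eq_iff]
  simp

theorem sameLeg_inter_eq_fixedLegs (ξ : M.Positions) (i k : Fin M.n) :
    sameLeg ξ i ∩ sameLeg ξ k = fixedLegs ξ {i, k} := by
  ext η
  simp only [sameLeg, fixedLegs, mem_ofPred_eq, leg_eq_iff, mem_inter_iff]
  simp
  tauto

theorem StronglyGeneric.not_legAligned_of_mem_bodyAt (hgen : M.StronglyGeneric Z)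
    {η : M.Positions} (hη : η ∈ M.bodyAt Z) (i : Fin M.n) : ¬ LegAligned η i :=
  fun h => hgen.ne_body η hη.1 i h hη.2.symm

/-- With the body at `Z` no leg is aligned, and this separates these configurations from the other
critical points. -/
theorem StronglyGeneric.isCriticalManifold_bodyAt (hgen : M.StronglyGeneric Z) :
    IsCriticalManifold (M.sqDist Z) M.spiderSpace (M.bodyAt Z) := by
  have hcrit : M.bodyAt Z ⊆ criticalSet (M.sqDist Z) M.spiderSpace := fun η hη => by
    rw [hgen.criticalSet_eq]
    exact ⟨hη.1, Or.inl hη.2⟩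
  refine ⟨hcrit, ?_, ⟨alignedOnlyIn ∅, isOpen_alignedOnlyIn ∅, ?_⟩,
    ⟨{η | η.1 = Z}, isClosed_eq continuous_fst continuous_const, ?_⟩⟩
  · intro η hη
    have h := bodyAt_eq_fixedLegs hη
    have h' := isSubmanifold_fixedLegs (ξ := η) (I := ∅) fun ζ hζ i _ =>
      hgen.not_legAligned_of_mem_bodyAt (by rwa [h]) i
    rw [← h] at h'
    exact h' η hη
  · ext η
    constructor
    · rintro ⟨h1, h2⟩
      have hS := h1.1
      have h3 : ∀ i, ¬ LegAligned η i := fun i hi =>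
        h2 i (by simp) ((mem_alignedSet_iff hS).2 hi)
      rw [hgen.criticalSet_eq] at h1
      obtain ⟨-, h | ⟨i, hi, -⟩ | ⟨i, -, -, hi, -⟩⟩ := h1
      · exact ⟨hS, h⟩
      · exact (h3 i hi).elim
      · exact (h3 i hi).elim
    · intro hη
      refine ⟨hcrit hη, fun i _ hi => ?_⟩
      exact hgen.not_legAligned_of_mem_bodyAt hη i ((mem_alignedSet_iff hη.1).1 hi)
  · ext η
    exact ⟨fun h => ⟨h.1.1, h.2⟩, fun h => ⟨hcrit h, h.2⟩⟩

theorem StronglyGeneric.not_legAligned_of_mem_legLine (hgen : M.StronglyGeneric Z)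
    {ξ : M.Positions} (hξ : ξ ∈ M.spiderSpace) {i : Fin M.n} (hi : LegAligned ξ i)
    (hZ : Z ∈ legLine ξ i) {l : Fin M.n} (hl : l ≠ i) : ¬ LegAligned ξ l :=
  fun h => hgen.notMem_line ξ hξ i l hl.symm hi h hZ

theorem edge_eq_smul_of_mem_legLine {ξ : M.Positions}
    (hξ : ξ ∈ M.spiderSpace) {i : Fin M.n} (hi : LegAligned ξ i) (hmem : Z ∈ legLine ξ i)
    (hZ : Z ≠ M.foot i) (j : Fin (M.p i)) : ∃ a : ℝ, edge ξ i j = a • (Z - M.foot i) := by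
  obtain ⟨r, hr⟩ := (mem_legLine_iff hξ hi).1 hmem
  obtain ⟨a, ha⟩ := hi.exists_smul_firstEdge hξ
  have hr0 : r ≠ 0 := by
    rintro rfl
    exact hZ (by rwa [zero_smul, sub_eq_zero] at hr)
  refine ⟨a j * r⁻¹, ?_⟩
  rw [hr, smul_smul, mul_assoc, inv_mul_cancel₀ hr0, mul_one, ha]

/-- If the `i`-th leg is aligned and `Z` lies on its line, that line joins `Z` to the foot, so the
leg has only finitely many such positions. These are separated by the angles between corresponding
edges. -/
theorem StronglyGeneric.isCriticalManifold_sameLeg (hgen : M.StronglyGeneric Z)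
    {ξ : M.Positions} (hξ : ξ ∈ M.spiderSpace) {i : Fin M.n} (hi : LegAligned ξ i)
    (hZ : Z ∈ legLine ξ i) :
    IsCriticalManifold (M.sqDist Z) M.spiderSpace (sameLeg ξ i) := by
  rw [sameLeg_eq_fixedLegs]
  have hleg : ∀ η ∈ fixedLegs ξ {i}, leg η i = leg ξ i := fun η hη =>
    leg_eq_of_mem_fixedLegs hη (Finset.mem_singleton_self i)
  have hal : ∀ η ∈ fixedLegs ξ {i}, LegAligned η i ∧ Z ∈ legLine η i := fun η hη =>
    ⟨(legAligned_congr (hleg η hη)).2 hi, by rwa [legLine_congr (hleg η hη)]⟩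
  have hnot : ∀ η ∈ fixedLegs ξ {i}, ∀ l ∉ ({i} : Finset (Fin M.n)), ¬ LegAligned η l :=
    fun η hη l hl => hgen.not_legAligned_of_mem_legLine hη.1 (hal η hη).1 (hal η hη).2
      (by simpa using hl)
  refine isCriticalManifold_fixedLegs (fun η hη => ?_) hnot
    ⟨{η | η.1 ≠ Z} ∩ alignedOnlyIn {i} ∩ nearLeg ξ i, ?_, fun η hη => ?_, ?_⟩
  · rw [hgen.criticalSet_eq]
    exact ⟨hη.1, Or.inr (Or.inl ⟨i, hal η hη⟩)⟩
  · exact ((isOpen_ne_fun continuous_fst continuous_const).inter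
      (isOpen_alignedOnlyIn _)).inter (isOpen_nearLeg ξ i)
  · refine ⟨⟨fun h => hgen.ne_body η hη.1 i (hal η hη).1 h.symm, fun l hl h => ?_⟩,
      mem_nearLeg_of_leg_eq hξ (hleg η hη)⟩
    exact hnot η hη l hl ((mem_alignedSet_iff hη.1).1 h)
  · rintro η ⟨hc, ⟨hηZ, hηa⟩, hηn⟩
    rw [hgen.criticalSet_eq] at hc
    obtain ⟨hS, hc⟩ := hc
    have hη : ∀ l, LegAligned η l → l = i := fun l hl => by
      by_contra hli
      exact hηa l (by simpa using hli) ((mem_alignedSet_iff hS).2 hl)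
    rcases hc with h | ⟨l, hl, hlZ⟩ | ⟨l, m, hlm, hl, hm⟩
    · exact (hηZ h).elim
    · obtain rfl := hη l hl
      rw [← sameLeg_eq_fixedLegs]
      refine ⟨hS, leg_eq_of_edge_eq fun j => ?_⟩
      obtain ⟨a, ha⟩ := edge_eq_smul_of_mem_legLine hS hl hlZ (hgen.ne_foot l) j
      obtain ⟨b, hb⟩ := edge_eq_smul_of_mem_legLine hξ hi hZ (hgen.ne_foot l) j
      refine eq_of_smul_of_inner_pos ha hb ?_ (hηn j)
      rw [mem_spiderSpace_iff.1 hS, mem_spiderSpace_iff.1 hξ]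
    · exact (hlm ((hη l hl).trans (hη m hm).symm)).elim

/-- Aligned positions of a leg with all corresponding edges forming acute angles have the same
pattern of directions, so they are similarly placed on their lines. -/
theorem exists_common_coefficients {η ξ : M.Positions} (hη : η ∈ M.spiderSpace)
    (hξ : ξ ∈ M.spiderSpace) {i : Fin M.n} (hηi : LegAligned η i) (hξi : LegAligned ξ i)
    (hn : η ∈ nearLeg ξ i) : ∃ a : Fin (M.p i) → ℝ, (∀ j, edge η i j = a j • firstEdge η i) ∧
      ∀ j, edge ξ i j = a j • firstEdge ξ i := by
  obtain ⟨a, ha⟩ := hηi.exists_smul_firstEdge hη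
  obtain ⟨b, hb⟩ := hξi.exists_smul_firstEdge hξ
  have hnorm : ‖firstEdge η i‖ = ‖firstEdge ξ i‖ := by
    rw [firstEdge, firstEdge, mem_spiderSpace_iff.1 hη, mem_spiderSpace_iff.1 hξ]
  have h0 : 0 < inner ℝ (firstEdge η i) (firstEdge ξ i) := hn _
  refine ⟨a, ha, fun j => ?_⟩
  have hab : 0 < a j * b j := by
    have := hn j
    rw [ha, hb, real_inner_smul_left, inner_smul_right, ← mul_assoc] at this
    exact pos_of_mul_pos_left this h0.le
  have habs : |a j| = |b j| := by
    have h1 : ‖edge η i j‖ = ‖edge ξ i j‖ := by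
      rw [mem_spiderSpace_iff.1 hη, mem_spiderSpace_iff.1 hξ]
    rw [ha, hb, norm_smul, norm_smul, hnorm] at h1
    exact mul_right_cancel₀ (norm_ne_zero_iff.2 (firstEdge_ne_zero hξ i)) h1
  have : a j = b j := by
    rcases abs_eq_abs.1 habs with h | h
    · exact h
    · rw [h] at hab
      nlinarith [mul_self_nonneg (b j)]
  rw [this, hb]

theorem body_sub_foot_eq_sum {η : M.Positions} {i : Fin M.n} {a : Fin (M.p i) → ℝ}
    {u : Plane} (ha : ∀ j, edge η i j = a j • u) : η.1 - M.foot i = (∑ j, a j) • u := by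
  rw [← sum_edge η i, Finset.sum_smul]
  exact Finset.sum_congr rfl fun j _ => ha j

theorem StronglyGeneric.signedArea_body_ne_zero (hgen : M.StronglyGeneric Z) {ξ : M.Positions}
    (hξ : ξ ∈ M.spiderSpace) {i k : Fin M.n} (hik : i ≠ k) (hi : LegAligned ξ i)
    (hk : LegAligned ξ k) : signedArea (ξ.1 - M.foot i) (ξ.1 - M.foot k) ≠ 0 := by
  obtain ⟨r, hr⟩ := hi.exists_body_sub_foot_eq_smul hξ
  obtain ⟨s, hs⟩ := hk.exists_body_sub_foot_eq_smul hξ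
  have hr0 : r ≠ 0 := by
    rintro rfl
    exact hgen.body_ne_foot hξ hik hi hk (by rwa [zero_smul, sub_eq_zero] at hr)
  have hs0 : s ≠ 0 := by
    rintro rfl
    exact hgen.body_ne_foot hξ hik.symm hk hi (by rwa [zero_smul, sub_eq_zero] at hs)
  rw [hr, hs, signedArea_smul_smul]
  exact mul_ne_zero (mul_ne_zero hr0 hs0) (hgen.signedArea_firstEdge_ne_zero hξ hik hi hk)

/-- Two aligned legs with given patterns of directions have given distances between end points, so
the body lies at one of the two intersection points of two circles about the feet. -/
theorem StronglyGeneric.isCriticalManifold_sameLeg_inter (hgen : M.StronglyGeneric Z)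
    {ξ : M.Positions} (hξ : ξ ∈ M.spiderSpace) {i k : Fin M.n} (hik : i ≠ k)
    (hi : LegAligned ξ i) (hk : LegAligned ξ k) :
    IsCriticalManifold (M.sqDist Z) M.spiderSpace (sameLeg ξ i ∩ sameLeg ξ k) := by
  rw [sameLeg_inter_eq_fixedLegs]
  have hmem : ∀ l ∈ ({i, k} : Finset (Fin M.n)), LegAligned ξ l := by
    intro l hl
    rw [Finset.mem_insert, Finset.mem_singleton] at hl
    rcases hl with rfl | rfl <;> assumption
  have hleg : ∀ η ∈ fixedLegs ξ {i, k}, ∀ l ∈ ({i, k} : Finset (Fin M.n)), leg η l = leg ξ l :=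
    fun η hη l hl => leg_eq_of_mem_fixedLegs hη hl
  have hii : i ∈ ({i, k} : Finset (Fin M.n)) := by simp
  have hkk : k ∈ ({i, k} : Finset (Fin M.n)) := by simp
  have hal : ∀ η ∈ fixedLegs ξ {i, k}, ∀ l ∈ ({i, k} : Finset (Fin M.n)), LegAligned η l :=
    fun η hη l hl => (legAligned_congr (hleg η hη l hl)).2 (hmem l hl)
  have hnot : ∀ η ∈ fixedLegs ξ {i, k}, ∀ l ∉ ({i, k} : Finset (Fin M.n)), ¬ LegAligned η l := by
    intro η hη l hl h
    apply hl
    have := hgen.eq_or_eq hη.1 hik (hal η hη i hii) (hal η hη k hkk) h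
    simpa using this
  -- the condition on the signed areas distinguishes the body position of `ξ` from its mirror image
  -- in the line through the two feet
  let U : Set M.Positions := {η | η.1 ≠ Z} ∩ alignedOnlyIn {i, k} ∩
    {η | ∀ l ∈ ({i, k} : Finset (Fin M.n)),
      η ∉ alignedSet l ∩ {η | signedArea (η.1 - Z) (firstEdge η l) = 0}} ∩
    {η | ∀ l ∈ ({i, k} : Finset (Fin M.n)), η ∈ nearLeg ξ l} ∩
    {η | 0 < signedArea (η.1 - M.foot i) (η.1 - M.foot k) *
      signedArea (ξ.1 - M.foot i) (ξ.1 - M.foot k)}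
  have hU : IsOpen U := by
    refine ((((isOpen_ne_fun continuous_fst continuous_const).inter
      (isOpen_alignedOnlyIn _)).inter ?_).inter ?_).inter ?_
    · simp only [ofPred_forall]
      exact isOpen_iInter_of_finite fun l => isOpen_iInter_of_finite fun _ =>
        ((isClosed_alignedSet l).inter (isClosed_eq (continuous_signedArea
          (continuous_fst.sub continuous_const) (continuous_edge l _))
            continuous_const)).isOpen_compl
    · simp only [ofPred_forall]
      exact isOpen_iInter_of_finite fun l => isOpen_iInter_of_finite fun _ => isOpen_nearLeg ξ l
    · exact isOpen_lt continuous_const ((continuous_signedArea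
        (continuous_fst.sub continuous_const) (continuous_fst.sub continuous_const)).mul
          continuous_const)
  refine isCriticalManifold_fixedLegs (fun η hη => ?_) hnot ⟨U, hU, fun η hη => ?_, ?_⟩
  · rw [hgen.criticalSet_eq]
    exact ⟨hη.1, Or.inr (Or.inr ⟨i, k, hik, hal η hη i hii, hal η hη k hkk⟩)⟩
  · refine ⟨⟨⟨⟨fun h => hgen.ne_body η hη.1 i (hal η hη i hii) h.symm, fun l hl h => ?_⟩,
      ?_⟩, fun l hl => mem_nearLeg_of_leg_eq hξ (hleg η hη l hl)⟩, ?_⟩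
    · exact hnot η hη l hl ((mem_alignedSet_iff hη.1).1 h)
    · rintro l hl ⟨-, h2⟩
      have h3 : Z ∈ legLine η l := by
        rw [mem_legLine_iff_body hη.1 (hal η hη l hl)]
        refine exists_smul_of_signedArea_eq_zero (firstEdge_ne_zero hη.1 l) ?_
        have h4 : signedArea (η.1 - Z) (firstEdge η l) = 0 := h2
        rw [signedArea] at h4 ⊢
        linarith
      rw [Finset.mem_insert, Finset.mem_singleton] at hl
      rcases hl with rfl | rfl
      · exact hgen.notMem_line η hη.1 l k hik (hal η hη l hii) (hal η hη k hkk) h3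
      · exact hgen.notMem_line η hη.1 l i hik.symm (hal η hη l hkk) (hal η hη i hii) h3
    · rw [mem_ofPred_eq, hη.2.1]
      exact mul_self_pos.2 (hgen.signedArea_body_ne_zero hξ hik hi hk)
  · rintro η ⟨hc, ⟨⟨⟨hηZ, hηa⟩, hηl⟩, hηn⟩, hηs⟩
    rw [hgen.criticalSet_eq] at hc
    obtain ⟨hS, hc⟩ := hc
    have hη : ∀ l, LegAligned η l → l ∈ ({i, k} : Finset (Fin M.n)) := fun l hl => by
      by_contra hli
      exact hηa l hli ((mem_alignedSet_iff hS).2 hl)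
    have hboth : LegAligned η i ∧ LegAligned η k := by
      rcases hc with h | ⟨l, hl, hlZ⟩ | ⟨l, m, hlm, hl, hm⟩
      · exact (hηZ h).elim
      · refine (hηl l (hη l hl) ⟨(mem_alignedSet_iff hS).2 hl, ?_⟩).elim
        obtain ⟨r, hr⟩ := (mem_legLine_iff_body hS hl).1 hlZ
        change signedArea (η.1 - Z) (firstEdge η l) = 0
        rw [hr, ← one_smul ℝ (firstEdge η l), smul_smul, signedArea_smul_smul, signedArea_self,
          mul_zero]
      · have h1 := hη l hl
        have h2 := hη m hm
        rw [Finset.mem_insert, Finset.mem_singleton] at h1 h2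
        rcases h1 with rfl | rfl <;> rcases h2 with rfl | rfl
        · exact (hlm rfl).elim
        · exact ⟨hl, hm⟩
        · exact ⟨hm, hl⟩
        · exact (hlm rfl).elim
    obtain ⟨a, ha, ha'⟩ := exists_common_coefficients hS hξ hboth.1 hi (hηn i hii)
    obtain ⟨b, hb, hb'⟩ := exists_common_coefficients hS hξ hboth.2 hk (hηn k hkk)
    have hnorm : ∀ l, ‖firstEdge η l‖ = ‖firstEdge ξ l‖ := fun l => by
      rw [firstEdge, firstEdge, mem_spiderSpace_iff.1 hS, mem_spiderSpace_iff.1 hξ]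
    -- the distances from the body to the two feet are the same in both configurations
    have hX : η.1 = ξ.1 := by
      refine eq_of_norm_sub_eq (A := M.foot i) (B := M.foot k) ?_ ?_ hηs
      · rw [body_sub_foot_eq_sum ha, body_sub_foot_eq_sum ha', norm_smul, norm_smul, hnorm]
      · rw [body_sub_foot_eq_sum hb, body_sub_foot_eq_sum hb', norm_smul, norm_smul, hnorm]
    have hfix : ∀ l (c : Fin (M.p l) → ℝ), (∀ j, edge η l j = c j • firstEdge η l) →
        (∀ j, edge ξ l j = c j • firstEdge ξ l) → ξ.1 ≠ M.foot l → leg η l = leg ξ l := by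
      intro l c hc hc' hne
      have h1 := body_sub_foot_eq_sum hc
      have h2 := body_sub_foot_eq_sum hc'
      rw [hX, h2] at h1
      have h3 : ∑ j, c j ≠ 0 := by
        intro h0
        rw [h0, zero_smul, sub_eq_zero] at h2
        exact hne h2
      have h4 := smul_right_injective _ h3 h1
      exact leg_eq_of_edge_eq fun j => by rw [hc, hc', h4]
    rw [← sameLeg_inter_eq_fixedLegs]
    exact ⟨⟨hS, hfix i a ha ha' (hgen.body_ne_foot hξ hik hi hk)⟩,
      ⟨hS, hfix k b hb hb' (hgen.body_ne_foot hξ hik.symm hk hi)⟩⟩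

end SpiderMechanism

/-! ### The Hessian of the squared distance -/

section LinearAlgebra

open QuadraticMap

/-- The map `t ↦ (0, t) - m • (1, …, 1)` with `m = ∑ a j * t j`. If `b + ∑ a j = 1`, it identifies
`Fin p → ℝ` with the hyperplane orthogonal to `(1, …, 1)` for weights proportional to
`(b, a 0, …)`. -/
noncomputable def hyperplaneParam {p : ℕ} (a : Fin p → ℝ) (b c : ℝ) (hab : b + ∑ j, a j = 1) :
    (Fin p → ℝ) →ₗ[ℝ] weightHyperplane (fun j => c * (Fin.cons b a : Fin (p + 1) → ℝ) j) where
  toFun t := ⟨fun j => (Fin.cons 0 t : Fin (p + 1) → ℝ) j - ∑ j, a j * t j, by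
    rw [mem_weightHyperplane, Fin.sum_univ_succ]
    simp only [Fin.cons_zero, Fin.cons_succ, mul_sub, Finset.sum_sub_distrib, ← Finset.sum_mul,
      mul_assoc, ← Finset.mul_sum]
    linear_combination -c * (∑ j, a j * t j) * hab⟩
  map_add' s t := by
    ext j
    refine Fin.cases ?_ (fun j => ?_) j
    · simp [mul_add, Finset.sum_add_distrib]
      ring
    · simp [mul_add, Finset.sum_add_distrib]
      ring
  map_smul' r t := by
    ext j
    have : ∀ j, a j * (r * t j) = r * (a j * t j) := fun j => by ring
    refine Fin.cases ?_ (fun j => ?_) j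
    · simp [this, ← Finset.mul_sum]
    · simp [this, ← Finset.mul_sum]
      ring

theorem hyperplaneParam_apply {p : ℕ} (a : Fin p → ℝ) (b c : ℝ) (hab : b + ∑ j, a j = 1)
    (t : Fin p → ℝ) (j : Fin (p + 1)) : (hyperplaneParam a b c hab t).1 j =
      (Fin.cons 0 t : Fin (p + 1) → ℝ) j - ∑ j, a j * t j := rfl

theorem hyperplaneParam_injective {p : ℕ} (a : Fin p → ℝ) (b c : ℝ) (hab : b + ∑ j, a j = 1) :
    Function.Injective (hyperplaneParam a b c hab) := by
  intro s t h
  have h' : ∀ j, (hyperplaneParam a b c hab s).1 j = (hyperplaneParam a b c hab t).1 j :=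
    fun j => by rw [h]
  simp only [hyperplaneParam_apply] at h'
  have h0 := h' 0
  simp only [Fin.cons_zero] at h0
  funext j
  have hj := h' j.succ
  simp only [Fin.cons_succ] at hj
  linarith

theorem hyperplaneParam_surjective {p : ℕ} (a : Fin p → ℝ) (b c : ℝ) (hc : c ≠ 0)
    (hab : b + ∑ j, a j = 1) : Function.Surjective (hyperplaneParam a b c hab) := by
  rintro ⟨τ, hτ⟩
  rw [mem_weightHyperplane, Fin.sum_univ_succ] at hτ
  simp only [Fin.cons_zero, Fin.cons_succ, mul_assoc, ← Finset.mul_sum, ← mul_add] at hτ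
  have hτ' := (mul_eq_zero.1 hτ).resolve_left hc
  refine ⟨fun j => τ j.succ - τ 0, ?_⟩
  have hm : ∑ j, a j * (τ j.succ - τ 0) = -τ 0 := by
    simp only [mul_sub, Finset.sum_sub_distrib, ← Finset.sum_mul]
    linear_combination hτ' - τ 0 * hab
  ext j
  rw [hyperplaneParam_apply, hm]
  refine Fin.cases ?_ (fun j => ?_) j
  · simp
  · simp

theorem hyperplaneForm_hyperplaneParam {p : ℕ} (a : Fin p → ℝ) (b c : ℝ)
    (hab : b + ∑ j, a j = 1) (t : Fin p → ℝ) :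
    hyperplaneForm _ (hyperplaneParam a b c hab t) =
      c * (∑ j, a j * t j ^ 2 - (∑ j, a j * t j) ^ 2) := by
  rw [hyperplaneForm_apply, Fin.sum_univ_succ]
  simp only [hyperplaneParam_apply, Fin.cons_zero, Fin.cons_succ]
  obtain ⟨m, hm⟩ : ∃ m, m = ∑ j, a j * t j := ⟨_, rfl⟩
  rw [← hm]
  have : ∀ j, c * a j * ((t j - m) * (t j - m)) =
      c * (a j * t j ^ 2) - 2 * c * m * (a j * t j) + c * m ^ 2 * a j := fun j => by ring
  simp only [this, Finset.sum_add_distrib, Finset.sum_sub_distrib, ← Finset.mul_sum, ← hm]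
  linear_combination c * m ^ 2 * hab

/-- Twice the squared norm of the plane. -/
noncomputable def twiceNormSq : QuadraticForm ℝ Plane :=
  (2 : ℝ) • LinearMap.BilinMap.toQuadraticMap (innerₗ Plane)

theorem twiceNormSq_apply (v : Plane) : twiceNormSq v = 2 * ‖v‖ ^ 2 := by
  rw [twiceNormSq, smul_apply, LinearMap.BilinMap.toQuadraticMap_apply,
    innerₗ_apply_apply, real_inner_self_eq_norm_sq, smul_eq_mul]

theorem twiceNormSq_nondegenerate_and_sigNeg :
    twiceNormSq.Nondegenerate ∧ sigNeg twiceNormSq = 0 := by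
  have h1 : Module.finrank ℝ Plane ≤ sigPos twiceNormSq :=
    finrank_le_sigPos_of_map _ LinearMap.id fun v hv => by
      rw [twiceNormSq_apply]
      have := norm_pos_iff.2 hv
      simp only [LinearMap.id_coe, id_eq]
      positivity
  have h2 := QuadraticForm.sigPos_add_sigNeg_add_radical (Q := twiceNormSq)
  rw [nondegenerate_iff_radical_eq_bot]
  exact ⟨Submodule.finrank_eq_zero.1 (by omega), by omega⟩

theorem ncard_pos_add_ncard_neg {ι : Type} [Fintype ι] {a : ι → ℝ} (ha : ∀ i, a i ≠ 0) :
    {i | 0 < a i}.ncard + {i | a i < 0}.ncard = Fintype.card ι := by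
  have h1 : {i | a i < 0} = {i | 0 < a i}ᶜ := by
    ext i
    simp only [mem_ofPred_eq, mem_compl_iff, not_lt]
    exact ⟨fun h => h.le, fun h => lt_of_le_of_ne h (ha i)⟩
  rw [h1, Set.ncard_add_ncard_compl, Nat.card_eq_fintype_card]

end LinearAlgebra

/-- The number of edges codirected with the vector from the start to the end, for a broken line
whose edges are multiples of this vector. -/
theorem posEdges_eq_ncard {p : ℕ} {P : Fin (p + 1) → Plane} {s : Plane} {a : Fin p → ℝ}
    (hs : s ≠ 0) (hend : P (Fin.last p) - P 0 = s) (ha : ∀ j, a j ≠ 0)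
    (hP : ∀ j, P j.succ - P j.castSucc = a j • s) : posEdges P = {j | 0 < a j}.ncard := by
  rw [posEdges, hend]
  congr 1
  ext j
  rw [mem_ofPred_eq, mem_ofPred_eq, hP]
  exact sameRay_smul_left_iff_of_ne hs (ha j)

namespace SpiderMechanism

variable {M : SpiderMechanism} {Z : Plane}

/-- The inner product of the plane as a continuous bilinear form. -/
noncomputable def planeInner : Plane →L[ℝ] Plane →L[ℝ] ℝ := innerSL ℝ

theorem planeInner_apply (u v : Plane) : planeInner u v = inner ℝ u v := rfl

/-- Half the Hessian of the Lagrange function `‖X - Z‖² - ∑ λ i j * ‖edge i j‖²`, where `I` contains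
the legs with nonzero multipliers. -/
noncomputable def stressForm (I : Finset (Fin M.n)) (lam : ∀ i, Fin (M.p i) → ℝ) :
    M.Positions →L[ℝ] M.Positions →L[ℝ] ℝ :=
  planeInner.bilinearComp (ContinuousLinearMap.fst ℝ _ _) (ContinuousLinearMap.fst ℝ _ _) -
    ∑ i ∈ I, ∑ j, lam i j • planeInner.bilinearComp (edgeMap i j) (edgeMap i j)

theorem stressForm_apply (I : Finset (Fin M.n)) (lam : ∀ i, Fin (M.p i) → ℝ) (v : M.Positions) :
    stressForm I lam v v = ‖v.1‖ ^ 2 - ∑ i ∈ I, ∑ j, lam i j * ‖edgeMap i j v‖ ^ 2 := by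
  simp only [stressForm, sub_apply, sum_apply, smul_apply,
    ContinuousLinearMap.bilinearComp_apply, planeInner_apply, real_inner_self_eq_norm_sq,
    smul_eq_mul, ContinuousLinearMap.coe_fst']

/-- If the legs in `I` carry stresses `s i` that balance the force `X - Z` at the body, then the
squared distance is, on the whole spider space, a quadratic form of the displacement up to a
constant. -/
theorem sqDist_eq_add_stressForm {ξ : M.Positions} (hξ : ξ ∈ M.spiderSpace)
    (I : Finset (Fin M.n)) (lam : ∀ i, Fin (M.p i) → ℝ) (s : Fin M.n → Plane)
    (hs : ∀ i ∈ I, ∀ j, lam i j • edge ξ i j = s i) (hsum : ∑ i ∈ I, s i = ξ.1 - Z)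
    (η : M.Positions) (hη : η ∈ M.spiderSpace) :
    M.sqDist Z η = M.sqDist Z ξ + stressForm I lam (η - ξ) (η - ξ) := by
  have hlen : ∀ i j, ‖edgeMap i j (η - ξ)‖ ^ 2 =
      -2 * inner ℝ (edge ξ i j) (edgeMap i j (η - ξ)) := by
    intro i j
    have h1 : ‖edge η i j‖ ^ 2 = ‖edge ξ i j‖ ^ 2 := by
      rw [mem_spiderSpace_iff.1 hη, mem_spiderSpace_iff.1 hξ]
    have h2 : edge η i j = edge ξ i j + edgeMap i j (η - ξ) := by
      rw [← edge_sub_edge]; abel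
    rw [h2, norm_add_sq_real] at h1
    linarith
  have hX : η.1 - Z = (ξ.1 - Z) + (η - ξ).1 := by simp
  rw [sqDist, sqDist, stressForm_apply, hX, norm_add_sq_real]
  have h3 : ∑ i ∈ I, ∑ j, lam i j * ‖edgeMap i j (η - ξ)‖ ^ 2 =
      -2 * inner ℝ (ξ.1 - Z) (η - ξ).1 := by
    rw [← hsum, sum_inner, Finset.mul_sum]
    refine Finset.sum_congr rfl fun i hi => ?_
    rw [← sum_edgeMap (η - ξ) i, inner_sum, Finset.mul_sum]
    refine Finset.sum_congr rfl fun j _ => ?_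
    rw [hlen, ← hs i hi j, real_inner_smul_left]
    ring
  rw [h3]
  ring

/-- The rates of rotation of the edges of leg `i` under an infinitesimal motion. -/
noncomputable def edgeRates (ξ : M.Positions) (i : Fin M.n) :
    M.Positions →ₗ[ℝ] (Fin (M.p i) → ℝ) :=
  LinearMap.pi fun j => rotCoeff (edge ξ i j) ∘ₗ (edgeMap i j).toLinearMap

theorem StronglyGeneric.edgeMap_eq (hgen : M.StronglyGeneric Z) {ξ : M.Positions}
    (hξ : ξ ∈ M.spiderSpace) {v : M.Positions} (hv : v ∈ tangentSpaceAt M.spiderSpace ξ)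
    (i : Fin M.n) (j : Fin (M.p i)) : edgeMap i j v = edgeRates ξ i v j • rot (edge ξ i j) :=
  eq_rotCoeff_smul_rot (edge_ne_zero hξ i j) ((hgen.mem_tangentSpaceAt hξ).1 hv i j)

theorem edgeRates_of_edgeMap_eq {ξ : M.Positions} (hξ : ξ ∈ M.spiderSpace) {v : M.Positions}
    {i : Fin M.n} {t : Fin (M.p i) → ℝ} (h : ∀ j, edgeMap i j v = t j • rot (edge ξ i j)) :
    edgeRates ξ i v = t := by
  funext j
  change rotCoeff (edge ξ i j) (edgeMap i j v) = t j
  rw [h, rotCoeff_smul_rot (edge_ne_zero hξ i j)]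

theorem StronglyGeneric.edgeRates_eq_zero_iff (hgen : M.StronglyGeneric Z) {ξ : M.Positions}
    (hξ : ξ ∈ M.spiderSpace) {v : M.Positions} (hv : v ∈ tangentSpaceAt M.spiderSpace ξ)
    (i : Fin M.n) : edgeRates ξ i v = 0 ↔ ∀ j, edgeMap i j v = 0 := by
  constructor
  · intro h j
    rw [hgen.edgeMap_eq hξ hv, h, Pi.zero_apply, zero_smul]
  · intro h
    refine edgeRates_of_edgeMap_eq hξ fun j => ?_
    rw [h, Pi.zero_apply, zero_smul]

/-- The motion of the body in terms of the rotations of the edges of a leg whose edges are multiples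
of one vector. -/
theorem StronglyGeneric.fst_eq_of_edge_smul (hgen : M.StronglyGeneric Z) {ξ : M.Positions}
    (hξ : ξ ∈ M.spiderSpace) {v : M.Positions} (hv : v ∈ tangentSpaceAt M.spiderSpace ξ)
    {i : Fin M.n} {a : Fin (M.p i) → ℝ} {s : Plane} (ha : ∀ j, edge ξ i j = a j • s) :
    v.1 = (∑ j, a j * edgeRates ξ i v j) • rot s := by
  rw [← sum_edgeMap v i, Finset.sum_smul]
  refine Finset.sum_congr rfl fun j _ => ?_
  rw [hgen.edgeMap_eq hξ hv, ha, map_smul, smul_smul, mul_comm]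

/-- The contribution to the Hessian of a leg with edges `a j • s` under the stress `c • s`. -/
theorem StronglyGeneric.sum_stress_eq (hgen : M.StronglyGeneric Z) {ξ : M.Positions}
    (hξ : ξ ∈ M.spiderSpace) {v : M.Positions} (hv : v ∈ tangentSpaceAt M.spiderSpace ξ)
    {i : Fin M.n} {a : Fin (M.p i) → ℝ} {s : Plane} (ha : ∀ j, edge ξ i j = a j • s) (c : ℝ) :
    ∑ j, (c / a j) * ‖edgeMap i j v‖ ^ 2 =
      c * ‖s‖ ^ 2 * ∑ j, a j * edgeRates ξ i v j ^ 2 := by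
  rw [Finset.mul_sum]
  refine Finset.sum_congr rfl fun j _ => ?_
  have h0 : a j ≠ 0 := fun h => edge_ne_zero hξ i j (by rw [ha, h, zero_smul])
  rw [hgen.edgeMap_eq hξ hv, norm_smul, norm_rot, mul_pow, Real.norm_eq_abs, sq_abs, ha,
    norm_smul, mul_pow, Real.norm_eq_abs, sq_abs]
  field_simp

/-! ### Morse-Bott indices -/

/-- With the body at `Z` no stresses are needed, and the Hessian is twice the squared norm of the
velocity of the body. -/
theorem StronglyGeneric.hasMorseBottIndex_bodyAt (hgen : M.StronglyGeneric Z) {η : M.Positions}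
    (hη : η ∈ M.bodyAt Z) : HasMorseBottIndex (M.sqDist Z) M.spiderSpace η 0 := by
  have hS := hη.1
  have hnot := hgen.not_legAligned_of_mem_bodyAt hη
  have hC := hgen.isCriticalManifold_bodyAt
  refine hasMorseBottIndex_of_quotient hC hη (stressForm ∅ 0)
    (sqDist_eq_add_stressForm hS ∅ 0 0 (by simp) (by simp [hη.2]))
    ((ContinuousLinearMap.fst ℝ Plane (∀ i, Fin (M.p i - 1) → Plane)).toLinearMap ∘ₗ
      (tangentSpaceAt M.spiderSpace η).subtype) ?_ ?_ twiceNormSq ?_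
    twiceNormSq_nondegenerate_and_sigNeg.1 twiceNormSq_nondegenerate_and_sigNeg.2
  · intro w
    obtain ⟨v, hv, hvw, -⟩ := hgen.exists_tangent hS ∅ w 0 (by simp) (by simp)
      fun l _ hl => (hnot l hl).elim
    exact ⟨⟨v, hv⟩, hvw⟩
  · intro v
    rw [bodyAt_eq_fixedLegs hη,
      hgen.mem_tangentSpaceAt_fixedLegs hS (I := ∅) (fun i _ => hnot i) v.2]
    simp
  · intro v
    rw [stressForm_apply, twiceNormSq_apply]
    simp

/-- The leg preceded by the bar from `Z` to the foot is a broken line from `Z` to `X` with edges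
`A j • s`, where `s = X - Z`, and it carries the stress `s`. Relative to the common rotation about
`Z` that follows the body, the rates of rotation `t j` of its edges satisfy `∑ A j * t j = 0`, and
the Hessian is a negative multiple of `∑ A j * t j ^ 2`. -/
theorem StronglyGeneric.hasMorseBottIndex_of_mem_legLine (hgen : M.StronglyGeneric Z)
    {ξ : M.Positions} (hξ : ξ ∈ M.spiderSpace) {i : Fin M.n} (hi : LegAligned ξ i)
    (hZ : Z ∈ legLine ξ i) :
    HasMorseBottIndex (M.sqDist Z) M.spiderSpace ξ (extendedLegIndex Z ξ i) := by
  classical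
  have hs : ξ.1 - Z ≠ 0 := fun h => hgen.ne_body ξ hξ i hi (sub_eq_zero.1 h).symm
  obtain ⟨a', ha'⟩ := hi.exists_smul_firstEdge hξ
  obtain ⟨r, hr⟩ := (mem_legLine_iff_body hξ hi).1 hZ
  have hr0 : r ≠ 0 := by rintro rfl; exact hs (by rw [hr, zero_smul])
  set s := ξ.1 - Z with hsdef
  have hfirst : firstEdge ξ i = r⁻¹ • s := by
    rw [hr, smul_smul, inv_mul_cancel₀ hr0, one_smul]
  obtain ⟨a, ha⟩ : ∃ a : Fin (M.p i) → ℝ, ∀ j, edge ξ i j = a j • s :=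
    ⟨fun j => a' j * r⁻¹, fun j => by rw [ha', hfirst, smul_smul]⟩
  have ha0 : ∀ j, a j ≠ 0 := fun j h => edge_ne_zero hξ i j (by rw [ha, h, zero_smul])
  have hbody := body_sub_foot_eq_sum ha
  -- the bar from `Z` to the foot is `b • s`
  obtain ⟨b, hb⟩ : ∃ b, b = 1 - ∑ j, a j := ⟨_, rfl⟩
  have hbs : M.foot i - Z = b • s := by
    rw [hb, sub_smul, one_smul, ← hbody, hsdef]
    abel
  have hb0 : b ≠ 0 := by
    rintro rfl
    rw [zero_smul, sub_eq_zero] at hbs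
    exact hgen.ne_foot i hbs.symm
  have hab : b + ∑ j, a j = 1 := by rw [hb]; ring
  let c : ℝ := -2 * ‖s‖ ^ 2
  have hc : c < 0 := by
    have := norm_pos_iff.2 hs
    have : 0 < ‖s‖ ^ 2 := by positivity
    simp only [c]
    linarith
  let A : Fin (M.p i + 1) → ℝ := Fin.cons b a
  have hA0 : ∀ j, A j ≠ 0 := fun j => by
    refine Fin.cases ?_ (fun j => ?_) j
    · exact hb0
    · exact ha0 j
  have hnot : ∀ l ∉ ({i} : Finset (Fin M.n)), ¬ LegAligned ξ l := fun l hl =>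
    hgen.not_legAligned_of_mem_legLine hξ hi hZ (by simpa using hl)
  have hsumA : ∑ j, c * A j = c := by
    rw [← Finset.mul_sum, Fin.sum_univ_succ]
    simp only [A, Fin.cons_zero, Fin.cons_succ, hab, mul_one]
  have hq := hyperplaneForm_nondegenerate_and_sigNeg (w := fun j => c * A j)
    (fun j => mul_ne_zero hc.ne (hA0 j)) (by rw [hsumA]; exact hc.ne)
  have hmem : ξ ∈ sameLeg ξ i := ⟨hξ, rfl⟩
  let lam : ∀ l, Fin (M.p l) → ℝ := Pi.single i fun j => 1 / a j
  have hlam : lam i = fun j => 1 / a j := Pi.single_eq_same i _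
  refine hasMorseBottIndex_of_quotient (hgen.isCriticalManifold_sameLeg hξ hi hZ) hmem
    (stressForm {i} lam)
    (sqDist_eq_add_stressForm hξ {i} lam (fun _ => s) ?_ (by simp [hsdef]))
    (hyperplaneParam a b c hab ∘ₗ edgeRates ξ i ∘ₗ
      (tangentSpaceAt M.spiderSpace ξ).subtype) ?_ ?_ (hyperplaneForm _) ?_ hq.1 ?_
  · intro l hl j
    obtain rfl := Finset.mem_singleton.1 hl
    rw [hlam, ha, smul_smul, div_mul_cancel₀ _ (ha0 j), one_smul]
  · refine (hyperplaneParam_surjective a b c hc.ne hab).comp fun t => ?_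
    let ε : ∀ l, Fin (M.p l) → Plane := fun l j =>
      (Pi.single i t : ∀ l, Fin (M.p l) → ℝ) l j • rot (edge ξ l j)
    obtain ⟨v, hv, -, hvε⟩ := hgen.exists_tangent hξ {i} (∑ j, ε i j) ε
      (fun l hl => by rw [Finset.mem_singleton.1 hl])
      (fun l _ j => by rw [inner_smul_right, inner_rot_self, mul_zero])
      fun l hl h => (hnot l hl h).elim
    refine ⟨⟨v, hv⟩, edgeRates_of_edgeMap_eq hξ fun j => ?_⟩
    refine (hvε i (Finset.mem_singleton_self i) j).trans ?_
    simp only [ε, Pi.single_eq_same]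
  · intro v
    rw [sameLeg_eq_fixedLegs, hgen.mem_tangentSpaceAt_fixedLegs hξ hnot v.2]
    change hyperplaneParam a b c hab (edgeRates ξ i v) = 0 ↔ _
    rw [map_eq_zero_iff _ (hyperplaneParam_injective a b c hab),
      hgen.edgeRates_eq_zero_iff hξ v.2]
    constructor
    · intro h
      refine ⟨?_, fun l hl => by rwa [Finset.mem_singleton.1 hl]⟩
      rw [← sum_edgeMap v.1 i]
      exact Finset.sum_eq_zero fun j _ => h j
    · exact fun h => h.2 i (Finset.mem_singleton_self i)
  · intro v
    change _ = hyperplaneForm _ (hyperplaneParam a b c hab (edgeRates ξ i v))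
    rw [hyperplaneForm_hyperplaneParam, stressForm_apply, Finset.sum_singleton, hlam,
      hgen.sum_stress_eq hξ v.2 ha, hgen.fst_eq_of_edge_smul hξ v.2 ha, norm_smul, norm_rot,
      mul_pow, Real.norm_eq_abs, sq_abs]
    simp only [c]
    ring
  · have h1 := hq.2
    rw [hsumA, if_pos hc] at h1
    have h2 : posEdges (Fin.cons Z (leg ξ i) : Fin (M.p i + 1 + 1) → Plane) =
        {j | 0 < A j}.ncard := by
      refine posEdges_eq_ncard hs ?_ hA0 fun j => ?_
      · rw [← Fin.succ_last, Fin.cons_succ, Fin.cons_zero, leg_last]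
      · refine Fin.cases ?_ (fun j => ?_) j
        · simp only [Fin.cons_succ, Fin.castSucc_zero, Fin.cons_zero, leg_zero, A]
          exact hbs
        · simp only [Fin.cons_succ, Fin.castSucc_succ, A]
          exact ha j
    have h3 : {j | c * A j < 0} = {j | 0 < A j} := by
      ext j
      rw [mem_ofPred_eq, mem_ofPred_eq]
      constructor
      · intro h
        by_contra h'
        have := mul_nonneg_of_nonpos_of_nonpos hc.le (not_lt.1 h')
        linarith
      · exact fun h => mul_neg_of_neg_of_pos hc h
    rw [extendedLegIndex, h2, ← h3]
    change sigNeg (hyperplaneForm fun j => c * A j) = _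
    omega

theorem exists_eq_add_of_signedArea_ne_zero {u v : Plane} (h : signedArea u v ≠ 0) (x : Plane) :
    ∃ c d : ℝ, x = c • u + d • v := by
  have h' : u 0 * v 1 - u 1 * v 0 ≠ 0 := h
  refine ⟨(x 0 * v 1 - x 1 * v 0) / signedArea u v, (u 0 * x 1 - u 1 * x 0) / signedArea u v,
    plane_ext ?_ ?_⟩
  all_goals
    simp only [PiLp.add_apply, PiLp.smul_apply, smul_eq_mul]
    field_simp
    rw [signedArea]
    ring

/-- The contribution of one of two aligned legs to the index, in terms of the coefficient `c` of the
stress in this leg. -/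
theorem sigNeg_hyperplaneForm_eq {ξ : M.Positions} {i : Fin M.n} {a : Fin (M.p i) → ℝ}
    (ha0 : ∀ j, a j ≠ 0) (hsum : ∑ j, a j = 1) (ha : ∀ j, edge ξ i j = a j • (ξ.1 - M.foot i))
    (hs : ξ.1 - M.foot i ≠ 0) {c : ℝ} (hc : c ≠ 0) :
    (hyperplaneForm fun j => -2 * c * ‖ξ.1 - M.foot i‖ ^ 2 * a j).Nondegenerate ∧
      sigNeg (hyperplaneForm fun j => -2 * c * ‖ξ.1 - M.foot i‖ ^ 2 * a j) =
        if 0 < c then legIndex ξ i else M.p i - 1 - legIndex ξ i := by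
  set s := ξ.1 - M.foot i with hsdef
  have hs2 : 0 < ‖s‖ ^ 2 := pow_pos (norm_pos_iff.2 hs) 2
  have hpos : posEdges (leg ξ i) = {j | 0 < a j}.ncard :=
    posEdges_eq_ncard hs (by rw [leg_last, leg_zero]) ha0 ha
  have hw0 : -2 * c * ‖s‖ ^ 2 ≠ 0 := mul_ne_zero (mul_ne_zero (by norm_num) hc) hs2.ne'
  have hsumw : ∑ j, -2 * c * ‖s‖ ^ 2 * a j = -2 * c * ‖s‖ ^ 2 := by
    rw [← Finset.mul_sum, hsum, mul_one]
  have hq := hyperplaneForm_nondegenerate_and_sigNeg (w := fun j => -2 * c * ‖s‖ ^ 2 * a j)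
    (fun j => mul_ne_zero hw0 (ha0 j)) (by rw [hsumw]; exact hw0)
  refine ⟨hq.1, ?_⟩
  have h1 := hq.2
  rw [hsumw] at h1
  have hcard := ncard_pos_add_ncard_neg ha0
  rw [Fintype.card_fin] at hcard
  -- the coefficients add up to `1`, so the subtraction in `legIndex` does not truncate
  have hone : 1 ≤ {j | 0 < a j}.ncard := by
    rw [Nat.one_le_iff_ne_zero]
    intro h
    rw [Set.ncard_eq_zero] at h
    have : ∑ j, a j ≤ 0 := Finset.sum_nonpos fun j _ => by
      by_contra hj
      have : j ∈ {j | 0 < a j} := not_le.1 hj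
      rw [h] at this
      exact this
    linarith
  rw [legIndex, hpos]
  rcases lt_or_gt_of_ne hc with hneg | hpos'
  · have hw : 0 < -2 * c * ‖s‖ ^ 2 := mul_pos (by linarith) hs2
    have h3 : {j | -2 * c * ‖s‖ ^ 2 * a j < 0} = {j | a j < 0} := by
      ext j
      simp only [mem_ofPred_eq, mul_neg_iff, hw, hw.not_gt, true_and, false_and, or_false]
    rw [if_neg hw.not_gt, h3] at h1
    rw [if_neg hneg.not_gt]
    omega
  · have hw : -2 * c * ‖s‖ ^ 2 < 0 := mul_neg_of_neg_of_pos (by linarith) hs2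
    have h3 : {j | -2 * c * ‖s‖ ^ 2 * a j < 0} = {j | 0 < a j} := by
      ext j
      simp only [mem_ofPred_eq, mul_neg_iff, hw, hw.not_gt, true_and, false_and, false_or]
    rw [if_pos hw, h3] at h1
    rw [if_pos hpos']
    omega

/-- The coefficients of the stresses in two aligned legs, and their signs. -/
theorem StronglyGeneric.exists_stress_coefficients (hgen : M.StronglyGeneric Z)
    {ξ : M.Positions} (hξ : ξ ∈ M.spiderSpace) {i k : Fin M.n} (hik : i ≠ k)
    (hi : LegAligned ξ i) (hk : LegAligned ξ k) :
    ∃ ci ck : ℝ, ξ.1 - Z = ci • (ξ.1 - M.foot i) + ck • (ξ.1 - M.foot k) ∧ ci ≠ 0 ∧ ck ≠ 0 ∧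
      quadrantSign (M.foot i) (M.foot k) ξ.1 Z = SignType.sign ci ∧
      quadrantSign (M.foot k) (M.foot i) ξ.1 Z = SignType.sign ck := by
  have hA := hgen.signedArea_body_ne_zero hξ hik hi hk
  have hA' := hgen.signedArea_body_ne_zero hξ hik.symm hk hi
  obtain ⟨ci, ck, h⟩ := exists_eq_add_of_signedArea_ne_zero hA (ξ.1 - Z)
  have hoff : ∀ l m : Fin M.n, l ≠ m → LegAligned ξ l → LegAligned ξ m →
      ∀ c : ℝ, ξ.1 - Z ≠ c • (ξ.1 - M.foot l) := by
    intro l m hlm hl hm c hc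
    refine hgen.notMem_line ξ hξ l m hlm hl hm ((mem_legLine_iff_body hξ hl).2 ?_)
    obtain ⟨r, hr⟩ := hl.exists_body_sub_foot_eq_smul hξ
    exact ⟨c * r, by rw [hc, hr, smul_smul]⟩
  refine ⟨ci, ck, h, ?_, ?_, ?_, ?_⟩
  · rintro rfl
    exact hoff k i hik.symm hk hi ck (by rw [h, zero_smul, zero_add])
  · rintro rfl
    exact hoff i k hik hi hk ci (by rw [h, zero_smul, add_zero])
  · have : signedArea (ξ.1 - Z) (ξ.1 - M.foot k) =
        ci * signedArea (ξ.1 - M.foot i) (ξ.1 - M.foot k) := by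
      rw [h]
      simp only [signedArea, PiLp.add_apply, PiLp.smul_apply, smul_eq_mul]
      ring
    rw [quadrantSign, this, mul_div_cancel_right₀ _ hA]
  · have : signedArea (ξ.1 - Z) (ξ.1 - M.foot i) =
        ck * signedArea (ξ.1 - M.foot k) (ξ.1 - M.foot i) := by
      rw [h]
      simp only [signedArea, PiLp.add_apply, PiLp.smul_apply, smul_eq_mul]
      ring
    rw [quadrantSign, this, mul_div_cancel_right₀ _ hA']

theorem pairIndex_eq {ξ : M.Positions} {i k : Fin M.n} {c : ℝ}
    (h : quadrantSign (M.foot i) (M.foot k) ξ.1 Z = SignType.sign c) :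
    pairIndex Z ξ i k = if 0 < c then legIndex ξ i else M.p i - 1 - legIndex ξ i := by
  rw [pairIndex, h]
  simp only [sign_eq_one_iff]

theorem LegAligned.exists_smul_body {ξ : M.Positions} (hξ : ξ ∈ M.spiderSpace) {i : Fin M.n}
    (hi : LegAligned ξ i) (hne : ξ.1 ≠ M.foot i) : ∃ a : Fin (M.p i) → ℝ,
      (∀ j, edge ξ i j = a j • (ξ.1 - M.foot i)) ∧ (∀ j, a j ≠ 0) ∧ ∑ j, a j = 1 := by
  have hs : ξ.1 - M.foot i ≠ 0 := sub_ne_zero.2 hne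
  obtain ⟨a', ha'⟩ := hi.exists_smul_firstEdge hξ
  obtain ⟨r, hr⟩ := hi.exists_body_sub_foot_eq_smul hξ
  have hr0 : r ≠ 0 := by rintro rfl; exact hs (by rw [hr, zero_smul])
  have ha : ∀ j, edge ξ i j = (a' j * r⁻¹) • (ξ.1 - M.foot i) := fun j => by
    rw [ha', hr, smul_smul, mul_assoc, inv_mul_cancel₀ hr0, mul_one]
  refine ⟨fun j => a' j * r⁻¹, ha, fun j h => edge_ne_zero hξ i j ?_, ?_⟩
  · rw [ha j, show a' j * r⁻¹ = 0 from h, zero_smul]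
  have h1 := body_sub_foot_eq_sum ha
  have h2 : (1 : ℝ) • (ξ.1 - M.foot i) = (∑ j, a' j * r⁻¹) • (ξ.1 - M.foot i) := by
    rw [one_smul, ← h1]
  exact (smul_left_injective ℝ hs h2).symm

/-- The body is fixed to first order, so the rates of rotation of the edges of the two legs range
independently over two hyperplanes, and the Hessian is the orthogonal sum of two forms, one for each
leg with its stress. -/
theorem StronglyGeneric.hasMorseBottIndex_of_two_aligned (hgen : M.StronglyGeneric Z)
    {ξ : M.Positions} (hξ : ξ ∈ M.spiderSpace) {i k : Fin M.n} (hik : i ≠ k)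
    (hi : LegAligned ξ i) (hk : LegAligned ξ k) :
    HasMorseBottIndex (M.sqDist Z) M.spiderSpace ξ (pairIndex Z ξ i k + pairIndex Z ξ k i) := by
  classical
  obtain ⟨ci, ck, hc, hci, hck, hsi, hsk⟩ := hgen.exists_stress_coefficients hξ hik hi hk
  have hXi := hgen.body_ne_foot hξ hik hi hk
  have hXk := hgen.body_ne_foot hξ hik.symm hk hi
  obtain ⟨a, ha, ha0, hasum⟩ := hi.exists_smul_body hξ hXi
  obtain ⟨b, hb, hb0, hbsum⟩ := hk.exists_smul_body hξ hXk
  have hqi := sigNeg_hyperplaneForm_eq ha0 hasum ha (sub_ne_zero.2 hXi) hci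
  have hqk := sigNeg_hyperplaneForm_eq hb0 hbsum hb (sub_ne_zero.2 hXk) hck
  have hq := nondegenerate_prod_and_sigNeg_prod hqi.1 hqk.1
  rw [hqi.2, hqk.2, ← pairIndex_eq hsi, ← pairIndex_eq hsk] at hq
  have hii : i ∈ ({i, k} : Finset (Fin M.n)) := by simp
  have hkk : k ∈ ({i, k} : Finset (Fin M.n)) := by simp
  have hnot : ∀ l ∉ ({i, k} : Finset (Fin M.n)), ¬ LegAligned ξ l := fun l hl h =>
    hl (by simpa using hgen.eq_or_eq hξ hik hi hk h)
  let s : Fin M.n → Plane := Function.update (fun _ => ck • (ξ.1 - M.foot k)) i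
    (ci • (ξ.1 - M.foot i))
  have hsi' : s i = ci • (ξ.1 - M.foot i) := Function.update_self ..
  have hsk' : s k = ck • (ξ.1 - M.foot k) := Function.update_of_ne hik.symm ..
  let lam : ∀ l, Fin (M.p l) → ℝ :=
    Function.update (Pi.single k fun j => ck / b j) i fun j => ci / a j
  have hlami : lam i = fun j => ci / a j := Function.update_self ..
  have hlamk : lam k = fun j => ck / b j :=
    (Function.update_of_ne hik.symm ..).trans (Pi.single_eq_same ..)
  -- two independent aligned legs hold the body fixed to first order
  have hfix : ∀ v ∈ tangentSpaceAt M.spiderSpace ξ, v.1 = 0 := fun v hv =>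
    eq_zero_of_inner_eq_zero (hgen.signedArea_firstEdge_ne_zero hξ hik hi hk)
      (hgen.inner_firstEdge_eq_zero hξ hv hi) (hgen.inner_firstEdge_eq_zero hξ hv hk)
  have hplane : ∀ (l : Fin M.n) (d : Fin (M.p l) → ℝ) (c : ℝ), ξ.1 ≠ M.foot l →
      (∀ j, edge ξ l j = d j • (ξ.1 - M.foot l)) → ∀ v : tangentSpaceAt M.spiderSpace ξ,
      (edgeRates ξ l ∘ₗ (tangentSpaceAt M.spiderSpace ξ).subtype) v ∈
        weightHyperplane fun j => c * d j := by
    intro l d c hne hd v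
    rw [mem_weightHyperplane]
    have h1 := hgen.fst_eq_of_edge_smul hξ v.2 hd
    rw [hfix v v.2] at h1
    have h2 := (smul_eq_zero.1 h1.symm).resolve_right (rot_ne_zero (sub_ne_zero.2 hne))
    simp only [mul_assoc, ← Finset.mul_sum]
    change c * ∑ j, d j * edgeRates ξ l v j = 0
    rw [h2, mul_zero]
  refine hasMorseBottIndex_of_quotient (hgen.isCriticalManifold_sameLeg_inter hξ hik hi hk)
    ⟨⟨hξ, rfl⟩, ⟨hξ, rfl⟩⟩ (stressForm {i, k} lam)
    (sqDist_eq_add_stressForm hξ {i, k} lam s ?_ ?_)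
    (LinearMap.prod (LinearMap.codRestrict _ _ (hplane i a _ hXi ha))
      (LinearMap.codRestrict _ _ (hplane k b _ hXk hb))) ?_ ?_ _ ?_ hq.1 hq.2
  · intro l hl j
    rw [Finset.mem_insert, Finset.mem_singleton] at hl
    rcases hl with rfl | rfl
    · rw [hlami, ha, smul_smul, div_mul_cancel₀ _ (ha0 j), hsi']
    · rw [hlamk, hb, smul_smul, div_mul_cancel₀ _ (hb0 j), hsk']
  · rw [Finset.sum_pair hik, hsi', hsk', hc]
  · rintro ⟨⟨t, ht⟩, ⟨t', ht'⟩⟩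
    let T : ∀ l, Fin (M.p l) → ℝ := Function.update (Pi.single k t') i t
    have hTi : T i = t := Function.update_self ..
    have hTk : T k = t' := (Function.update_of_ne hik.symm ..).trans (Pi.single_eq_same ..)
    let ε : ∀ l, Fin (M.p l) → Plane := fun l j => T l j • rot (edge ξ l j)
    have hzero : ∀ (l : Fin M.n) (d τ : Fin (M.p l) → ℝ) (c : ℝ), c ≠ 0 → ξ.1 ≠ M.foot l →
        (∀ j, edge ξ l j = d j • (ξ.1 - M.foot l)) → T l = τ →
        τ ∈ weightHyperplane (fun j => -2 * c * ‖ξ.1 - M.foot l‖ ^ 2 * d j) →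
        ∑ j, ε l j = 0 := by
      intro l d τ c hc0 hne hd hτ hmem
      rw [mem_weightHyperplane] at hmem
      simp only [mul_assoc (-2 * c * ‖ξ.1 - M.foot l‖ ^ 2), ← Finset.mul_sum] at hmem
      have hs2 : ‖ξ.1 - M.foot l‖ ^ 2 ≠ 0 := pow_ne_zero 2 (norm_ne_zero_iff.2 (sub_ne_zero.2 hne))
      have h1 := (mul_eq_zero.1 hmem).resolve_left
        (mul_ne_zero (mul_ne_zero (by norm_num) hc0) hs2)
      have h2 : ∀ j, ε l j = (d j * τ j) • rot (ξ.1 - M.foot l) := fun j => by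
        simp only [ε]
        rw [hτ, hd, map_smul, smul_smul, mul_comm]
      simp only [h2, ← Finset.sum_smul, h1, zero_smul]
    obtain ⟨v, hv, -, hvε⟩ := hgen.exists_tangent hξ {i, k} 0 ε
      (fun l hl => by
        rw [Finset.mem_insert, Finset.mem_singleton] at hl
        rcases hl with rfl | rfl
        · exact hzero l a t ci hci hXi ha hTi ht
        · exact hzero l b t' ck hck hXk hb hTk ht')
      (fun l _ j => by rw [inner_smul_right, inner_rot_self, mul_zero])
      fun l hl h => (hnot l hl h).elim
    refine ⟨⟨v, hv⟩, Prod.ext (Subtype.ext ?_) (Subtype.ext ?_)⟩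
    · refine edgeRates_of_edgeMap_eq hξ fun j => ?_
      refine (hvε i hii j).trans ?_
      simp only [ε, hTi]
    · refine edgeRates_of_edgeMap_eq hξ fun j => ?_
      refine (hvε k hkk j).trans ?_
      simp only [ε, hTk]
  · intro v
    rw [sameLeg_inter_eq_fixedLegs, hgen.mem_tangentSpaceAt_fixedLegs hξ hnot v.2]
    have h1 := hgen.edgeRates_eq_zero_iff hξ v.2
    rw [LinearMap.prod_apply, Function.prod_apply, Prod.mk_eq_zero, Subtype.ext_iff, Subtype.ext_iff]
    change edgeRates ξ i v = 0 ∧ edgeRates ξ k v = 0 ↔ _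
    rw [h1, h1]
    constructor
    · rintro ⟨h2, h3⟩
      refine ⟨hfix v v.2, fun l hl => ?_⟩
      rw [Finset.mem_insert, Finset.mem_singleton] at hl
      rcases hl with rfl | rfl
      · exact h2
      · exact h3
    · exact fun h => ⟨h.2 i hii, h.2 k hkk⟩
  · intro v
    rw [QuadraticMap.prod_apply]
    simp only [hyperplaneForm_apply]
    change _ = (∑ j, -2 * ci * ‖ξ.1 - M.foot i‖ ^ 2 * a j *
        (edgeRates ξ i v j * edgeRates ξ i v j)) +
      ∑ j, -2 * ck * ‖ξ.1 - M.foot k‖ ^ 2 * b j * (edgeRates ξ k v j * edgeRates ξ k v j)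
    rw [stressForm_apply, Finset.sum_pair hik, hlami, hlamk, hgen.sum_stress_eq hξ v.2 ha,
      hgen.sum_stress_eq hξ v.2 hb, hfix v v.2]
    simp only [mul_assoc (-2 * ci * ‖ξ.1 - M.foot i‖ ^ 2),
      mul_assoc (-2 * ck * ‖ξ.1 - M.foot k‖ ^ 2), ← Finset.mul_sum, ← pow_two]
    rw [norm_zero]
    ring

end SpiderMechanism

/-! ### Rigid motions of the plane -/

section RigidMotions

/-- The rotation-dilation `w ↦ ⟪v, u⟫ w + [v, u] J w`, which takes `v` to `‖v‖² u`. In complex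
notation it is multiplication by `u * conj v`. -/
noncomputable def alignMap (v u w : Plane) : Plane := inner ℝ v u • w + signedArea v u • rot w

/-- For `‖v‖ = ‖u‖ = r`, the rigid motion that takes `P₀` to `A` and the direction of `v` to
that of `u`. -/
noncomputable def motion (A : Plane) (r : ℝ) (v u P₀ x : Plane) : Plane :=
  A + (r ^ 2)⁻¹ • alignMap v u (x - P₀)

theorem alignMap_zero (v u : Plane) : alignMap v u 0 = 0 := by
  simp [alignMap]

theorem alignMap_left (v u : Plane) : alignMap v u v = ‖v‖ ^ 2 • u := by
  rw [alignMap, plane_inner, plane_norm_sq, signedArea]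
  refine plane_ext ?_ ?_ <;>
  · simp only [PiLp.add_apply, PiLp.smul_apply, smul_eq_mul, rot_apply_zero, rot_apply_one]
    ring

theorem alignMap_self (u w : Plane) : alignMap u u w = ‖u‖ ^ 2 • w := by
  rw [alignMap, plane_inner, plane_norm_sq, signedArea]
  refine plane_ext ?_ ?_ <;>
  · simp only [PiLp.add_apply, PiLp.smul_apply, smul_eq_mul, rot_apply_zero, rot_apply_one]
    ring

theorem motion_base (A : Plane) (r : ℝ) (v u P₀ : Plane) : motion A r v u P₀ P₀ = A := by
  rw [motion, sub_self, alignMap_zero, smul_zero, add_zero]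

theorem motion_end {A : Plane} {r : ℝ} (hr : r ≠ 0) {P₀ P₁ : Plane} (hv : ‖P₁ - P₀‖ = r)
    (u : Plane) : motion A r (P₁ - P₀) u P₀ P₁ = A + u := by
  rw [motion, alignMap_left, hv, smul_smul, inv_mul_cancel₀ (pow_ne_zero 2 hr), one_smul]

theorem motion_self {A v : Plane} {r : ℝ} (hr : r ≠ 0) (hv : ‖v‖ = r) (x : Plane) :
    motion A r v v A x = x := by
  rw [motion, alignMap_self, hv, smul_smul, inv_mul_cancel₀ (pow_ne_zero 2 hr), one_smul,
    add_sub_cancel]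

theorem plane_det (f : Plane →ₗ[ℝ] Plane) : LinearMap.det f =
    f (EuclideanSpace.single 0 1) 0 * f (EuclideanSpace.single 1 1) 1 -
      f (EuclideanSpace.single 1 1) 0 * f (EuclideanSpace.single 0 1) 1 := by
  rw [← LinearMap.det_toMatrix (EuclideanSpace.basisFun (Fin 2) ℝ).toBasis f, Matrix.det_fin_two]
  simp [LinearMap.toMatrix_apply]

/-- The rotation with cosine `α` and sine `β`. -/
noncomputable def turn (α β : ℝ) (h : α ^ 2 + β ^ 2 = 1) : Plane ≃ₗᵢ[ℝ] Plane :=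
  LinearIsometry.toLinearIsometryEquiv
    { toLinearMap := α • LinearMap.id + β • rot
      norm_map' := fun w => by
        have : ‖α • w + β • rot w‖ ^ 2 = ‖w‖ ^ 2 := by
          rw [plane_norm_sq, plane_norm_sq]
          simp only [PiLp.add_apply, PiLp.smul_apply, smul_eq_mul, rot_apply_zero, rot_apply_one]
          linear_combination (w 0 ^ 2 + w 1 ^ 2) * h
        exact (sq_eq_sq₀ (norm_nonneg _) (norm_nonneg _)).1 this } rfl

theorem turn_apply (α β : ℝ) (h : α ^ 2 + β ^ 2 = 1) (w : Plane) :
    turn α β h w = α • w + β • rot w := rfl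

theorem det_turn (α β : ℝ) (h : α ^ 2 + β ^ 2 = 1) :
    LinearMap.det ((turn α β h).toLinearEquiv : Plane →ₗ[ℝ] Plane) = 1 := by
  rw [plane_det]
  change turn α β h _ 0 * turn α β h _ 1 - turn α β h _ 0 * turn α β h _ 1 = 1
  simp only [turn_apply, PiLp.add_apply, PiLp.smul_apply, smul_eq_mul, rot_apply_zero,
    rot_apply_one, PiLp.single_apply]
  simp
  linarith

/-- The linear isometries of positive determinant are the rotations. -/
theorem exists_eq_turn (L : Plane ≃ₗᵢ[ℝ] Plane)
    (hL : 0 < LinearMap.det (L.toLinearEquiv : Plane →ₗ[ℝ] Plane)) :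
    ∃ α β : ℝ, α ^ 2 + β ^ 2 = 1 ∧ ∀ w, L w = α • w + β • rot w := by
  rw [plane_det] at hL
  change 0 < L _ 0 * L _ 1 - L _ 0 * L _ 1 at hL
  obtain ⟨e, he⟩ : ∃ e : Plane, e = EuclideanSpace.single 0 1 := ⟨_, rfl⟩
  obtain ⟨f, hf⟩ : ∃ f : Plane, f = EuclideanSpace.single 1 1 := ⟨_, rfl⟩
  rw [← he, ← hf] at hL
  have he0 : e 0 = 1 := by simp [he]
  have he1 : e 1 = 0 := by simp [he]
  have hf0 : f 0 = 0 := by simp [hf]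
  have hf1 : f 1 = 1 := by simp [hf]
  have h1 : (L e) 0 ^ 2 + (L e) 1 ^ 2 = 1 := by
    rw [← plane_norm_sq, L.norm_map, plane_norm_sq, he0, he1]; norm_num
  have h2 : (L f) 0 ^ 2 + (L f) 1 ^ 2 = 1 := by
    rw [← plane_norm_sq, L.norm_map, plane_norm_sq, hf0, hf1]; norm_num
  have h3 : (L e) 0 * (L f) 0 + (L e) 1 * (L f) 1 = 0 := by
    rw [← plane_inner, L.inner_map_map, plane_inner, he0, he1, hf0, hf1]; norm_num
  obtain ⟨a, ha⟩ : ∃ a, a = (L e) 0 := ⟨_, rfl⟩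
  obtain ⟨b, hb⟩ : ∃ b, b = (L e) 1 := ⟨_, rfl⟩
  obtain ⟨c, hc⟩ : ∃ c, c = (L f) 0 := ⟨_, rfl⟩
  obtain ⟨d, hd⟩ : ∃ d, d = (L f) 1 := ⟨_, rfl⟩
  rw [← ha, ← hb, ← hc, ← hd] at hL
  rw [← ha, ← hb] at h1
  rw [← hc, ← hd] at h2
  rw [← ha, ← hb, ← hc, ← hd] at h3
  have h4 : a * d - c * b = 1 := by
    have h5 : (a * d - c * b) ^ 2 = 1 := by
      linear_combination (c ^ 2 + d ^ 2) * h1 + h2 - (a * c + b * d) * h3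
    nlinarith
  have h6 : (a - d) ^ 2 + (b + c) ^ 2 = 0 := by linear_combination h1 + h2 - 2 * h4
  have h7 : a - d = 0 := by
    have := sq_nonneg (a - d)
    have := sq_nonneg (b + c)
    exact (pow_eq_zero_iff two_ne_zero).1 (by linarith)
  have h8 : b + c = 0 := by
    have := sq_nonneg (a - d)
    have := sq_nonneg (b + c)
    exact (pow_eq_zero_iff two_ne_zero).1 (by linarith)
  refine ⟨a, b, h1, fun w => ?_⟩
  have hw : w = w 0 • e + w 1 • f := by
    refine plane_ext ?_ ?_
    · simp only [PiLp.add_apply, PiLp.smul_apply, smul_eq_mul, he0, hf0]; ring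
    · simp only [PiLp.add_apply, PiLp.smul_apply, smul_eq_mul, he1, hf1]; ring
  have hLw : L w = w 0 • L e + w 1 • L f := by
    conv_lhs => rw [hw]
    rw [map_add, map_smul, map_smul]
  rw [hLw]
  refine plane_ext ?_ ?_
  · simp only [PiLp.add_apply, PiLp.smul_apply, smul_eq_mul, rot_apply_zero, ← ha, ← hc]
    linear_combination w 1 * h8
  · simp only [PiLp.add_apply, PiLp.smul_apply, smul_eq_mul, rot_apply_one, ← hb, ← hd]
    linear_combination -w 1 * h7

theorem alignMap_turn {α β : ℝ} (h : α ^ 2 + β ^ 2 = 1) (v u w : Plane) :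
    alignMap (α • v + β • rot v) u (α • w + β • rot w) = alignMap v u w := by
  rw [alignMap, alignMap, plane_inner, plane_inner, signedArea, signedArea]
  refine plane_ext ?_ ?_
  · simp only [PiLp.add_apply, PiLp.smul_apply, smul_eq_mul, rot_apply_zero, rot_apply_one]
    linear_combination
      ((v 0 * u 0 + v 1 * u 1) * w 0 - (v 0 * u 1 - v 1 * u 0) * w 1) * h
  · simp only [PiLp.add_apply, PiLp.smul_apply, smul_eq_mul, rot_apply_zero, rot_apply_one]
    linear_combination
      ((v 0 * u 0 + v 1 * u 1) * w 1 + (v 0 * u 1 - v 1 * u 0) * w 0) * h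

/-- The normalized position of a point does not change if the base edge and the point are moved
together, so it depends only on the congruence class of a polygon. -/
theorem motion_comp {g : Plane ≃ᵃⁱ[ℝ] Plane} (hg : IsOrientationPreserving g) (A : Plane) (r : ℝ)
    (u P₀ P₁ x : Plane) :
    motion A r (g P₁ - g P₀) u (g P₀) (g x) = motion A r (P₁ - P₀) u P₀ x := by
  obtain ⟨α, β, h, hL⟩ := exists_eq_turn g.linearIsometryEquiv hg
  have hsub : ∀ x y, g x - g y = α • (x - y) + β • rot (x - y) := fun x y => by
    rw [← hL]
    exact (g.map_vsub x y).symm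
  rw [motion, motion, hsub, hsub, alignMap_turn h]

theorem exists_motion (A : Plane) {r : ℝ} (hr : r ≠ 0) {v u : Plane} (hv : ‖v‖ = r)
    (hu : ‖u‖ = r) (P₀ : Plane) :
    ∃ g : Plane ≃ᵃⁱ[ℝ] Plane, IsOrientationPreserving g ∧ ∀ x, g x = motion A r v u P₀ x := by
  have h : ((r ^ 2)⁻¹ * inner ℝ v u) ^ 2 + ((r ^ 2)⁻¹ * signedArea v u) ^ 2 = 1 := by
    have hv' : v 0 ^ 2 + v 1 ^ 2 = r ^ 2 := by rw [← plane_norm_sq, hv]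
    have hu' : u 0 ^ 2 + u 1 ^ 2 = r ^ 2 := by rw [← plane_norm_sq, hu]
    have h1 : (inner ℝ v u) ^ 2 + (signedArea v u) ^ 2 = r ^ 2 * r ^ 2 := by
      rw [plane_inner, signedArea]
      linear_combination (u 0 ^ 2 + u 1 ^ 2) * hv' + r ^ 2 * hu'
    rw [mul_pow, mul_pow, ← mul_add, h1]
    field_simp
  let g : Plane ≃ᵃⁱ[ℝ] Plane :=
    ((AffineIsometryEquiv.vaddConst ℝ P₀).symm.trans (turn _ _ h).toAffineIsometryEquiv).trans
      (AffineIsometryEquiv.vaddConst ℝ A)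
  have hgL : g.linearIsometryEquiv = turn _ _ h := rfl
  refine ⟨g, ?_, fun x => ?_⟩
  · rw [IsOrientationPreserving, hgL, det_turn]
    exact one_pos
  · change turn _ _ h (x - P₀) + A = _
    rw [turn_apply, motion, alignMap, smul_add, smul_smul, smul_smul, add_comm]

theorem dist_motion (A : Plane) {r : ℝ} (hr : r ≠ 0) {v u : Plane} (hv : ‖v‖ = r)
    (hu : ‖u‖ = r) (P₀ x y : Plane) :
    dist (motion A r v u P₀ x) (motion A r v u P₀ y) = dist x y := by
  obtain ⟨g, -, hg⟩ := exists_motion A hr hv hu P₀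
  rw [← hg, ← hg, g.dist_map]

variable {E : Type} [NormedAddCommGroup E] [NormedSpace ℝ E]

theorem contDiff_motion (A : Plane) (r : ℝ) {v u P₀ x : E → Plane} (hv : ContDiff ℝ ∞ v)
    (hu : ContDiff ℝ ∞ u) (hP₀ : ContDiff ℝ ∞ P₀) (hx : ContDiff ℝ ∞ x) :
    ContDiff ℝ ∞ fun e => motion A r (v e) (u e) (P₀ e) (x e) := by
  have hcoord : ∀ {f : E → Plane} (i : Fin 2), ContDiff ℝ ∞ f → ContDiff ℝ ∞ fun e => f e i :=
    fun {f} i hf => (EuclideanSpace.proj (𝕜 := ℝ) i : Plane →L[ℝ] ℝ).contDiff.comp hf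
  have harea : ContDiff ℝ ∞ fun e => signedArea (v e) (u e) :=
    ((hcoord 0 hv).mul (hcoord 1 hu)).sub ((hcoord 1 hv).mul (hcoord 0 hu))
  have hrot : ContDiff ℝ ∞ fun e => rot (x e - P₀ e) :=
    (LinearMap.toContinuousLinearMap rot).contDiff.comp (hx.sub hP₀)
  have halign : ContDiff ℝ ∞ fun e => alignMap (v e) (u e) (x e - P₀ e) :=
    ((hv.inner ℝ hu).smul (hx.sub hP₀)).add (harea.smul hrot)
  have hscaled : ContDiff ℝ ∞ fun e => (r ^ 2)⁻¹ • alignMap (v e) (u e) (x e - P₀ e) :=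
    halign.const_smul _
  exact contDiff_const.add hscaled

end RigidMotions

/-! ### Diffeomorphisms with globally defined smooth lifts -/

/-- A diffeomorphism from a subset `A` of a normed space onto a quotient `Q`, with smooth lifts in
both directions defined on the whole ambient spaces. -/
structure GlobalDiffeo {E : Type} [NormedAddCommGroup E] [NormedSpace ℝ E] (A : Set E)
    (Q : SmoothQuotient) where
  toFun : E → Q.V
  invFun : Q.V → E
  contDiff_toFun : ContDiff ℝ ∞ toFun
  contDiff_invFun : ContDiff ℝ ∞ invFun
  mapsTo : ∀ a ∈ A, toFun a ∈ Q.K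
  mapsTo_inv : ∀ b ∈ Q.K, invFun b ∈ A
  eq_of_rel : ∀ (b : Q.V) (hb : b ∈ Q.K) (b' : Q.V) (hb' : b' ∈ Q.K),
    Q.rel ⟨b, hb⟩ ⟨b', hb'⟩ → invFun b = invFun b'
  left_inv : ∀ a ∈ A, invFun (toFun a) = a
  right_inv : ∀ (b : Q.V) (hb : b ∈ Q.K),
    Q.rel ⟨toFun (invFun b), mapsTo _ (mapsTo_inv b hb)⟩ ⟨b, hb⟩

section GlobalDiffeo

variable {E F : Type} [NormedAddCommGroup E] [NormedSpace ℝ E] [NormedAddCommGroup F]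
  [NormedSpace ℝ F]

theorem ContDiff.isSmoothOn {f : E → F} (hf : ContDiff ℝ ∞ f) (A : Set E) : IsSmoothOn f A :=
  fun _ _ => ⟨univ, isOpen_univ, trivial, f, hf.contDiffOn, fun _ _ => rfl⟩

theorem GlobalDiffeo.diffeomorphic {A : Set E} {Q : SmoothQuotient} (D : GlobalDiffeo A Q) :
    SmoothQuotient.Diffeomorphic (SmoothQuotient.ofSet A) Q := by
  let φ : (SmoothQuotient.ofSet A).Carrier ≃ Q.Carrier :=
    { toFun := Quotient.lift (fun a => Quotient.mk Q.rel ⟨D.toFun a.1, D.mapsTo a.1 a.2⟩) (by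
        rintro a a' h
        obtain rfl : a = a' := h
        rfl)
      invFun := Quotient.map (fun b => ⟨D.invFun b.1, D.mapsTo_inv b.1 b.2⟩)
        fun b b' h => Subtype.ext (D.eq_of_rel _ b.2 _ b'.2 h)
      left_inv := by
        intro x
        induction x using Quotient.inductionOn with
        | h a => exact Quotient.sound (Subtype.ext (D.left_inv a.1 a.2))
      right_inv := by
        intro x
        induction x using Quotient.inductionOn with
        | h b => exact Quotient.sound (D.right_inv b.1 b.2) }
  refine ⟨φ, fun a _ => ⟨univ, isOpen_univ, trivial, D.toFun, D.contDiff_toFun.isSmoothOn _, ?_⟩,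
    fun b _ => ⟨univ, isOpen_univ, trivial, D.invFun, D.contDiff_invFun.isSmoothOn _, ?_⟩⟩
  · exact fun b hb _ => ⟨D.mapsTo b hb, rfl⟩
  · exact fun b hb _ => ⟨D.mapsTo_inv b hb, rfl⟩

end GlobalDiffeo

/-! ### Positions of a single leg and polygon spaces -/

theorem val_finRotate {p : ℕ} (j : Fin p) :
    (finRotate p j : ℕ) = if (j : ℕ) + 1 = p then 0 else (j : ℕ) + 1 := by
  cases p with
  | zero => exact j.elim0
  | succ n =>
    split_ifs with h
    · have : j = Fin.last n := Fin.ext (by simp; omega)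
      rw [this, finRotate_last]
      rfl
    · rw [coe_finRotate_of_ne_last]
      rintro rfl
      exact h rfl

theorem mem_closedPolygons_snoc {p : ℕ} {l : Fin p → ℝ} {r : ℝ} {P : Fin (p + 1) → Plane} :
    P ∈ closedPolygons (Fin.snoc l r : Fin (p + 1) → ℝ) ↔
      (∀ j : Fin p, dist (P j.castSucc) (P j.succ) = l j) ∧ dist (P (Fin.last p)) (P 0) = r := by
  rw [closedPolygons, mem_ofPred_eq, Fin.forall_fin_succ']
  have h1 : ∀ j : Fin p, finRotate (p + 1) j.castSucc = j.succ := fun j => Fin.ext (by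
    rw [val_finRotate]
    have := j.2
    simp [this.ne])
  simp only [h1, finRotate_last, Fin.snoc_castSucc, Fin.snoc_last]

namespace SpiderMechanism

variable {M : SpiderMechanism}

/-- The leg `i` with body position `X` and joints `d`. -/
noncomputable def legPath (i : Fin M.n) (X : Plane) (d : Fin (M.p i - 1) → Plane)
    (j : Fin (M.p i + 1)) : Plane :=
  if h₀ : (j : ℕ) = 0 then M.foot i
  else if h₁ : (j : ℕ) = M.p i then X
  else d ⟨j - 1, by omega⟩

/-- The positions of the joints of leg `i` when the body is at `X`. -/
def legSpace (i : Fin M.n) (X : Plane) : Set (Fin (M.p i - 1) → Plane) :=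
  {d | ∀ j : Fin (M.p i),
    dist (legPath i X d j.castSucc) (legPath i X d j.succ) = M.len i j}

/-- For a given position of the body the legs move independently. -/
theorem mem_spiderSpace_iff_legSpace {ξ : M.Positions} :
    ξ ∈ M.spiderSpace ↔ ∀ i, ξ.2 i ∈ legSpace i ξ.1 := Iff.rfl

theorem legPath_of_val_eq_zero {i : Fin M.n} (X : Plane) (d : Fin (M.p i - 1) → Plane)
    {j : Fin (M.p i + 1)} (h : (j : ℕ) = 0) : legPath i X d j = M.foot i := dif_pos h

theorem legPath_of_val_eq_p {i : Fin M.n} (X : Plane) (d : Fin (M.p i - 1) → Plane)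
    {j : Fin (M.p i + 1)} (h : (j : ℕ) = M.p i) : legPath i X d j = X := by
  have := p_pos i
  rw [legPath, dif_neg (by omega), dif_pos h]

theorem legPath_succ {i : Fin M.n} (X : Plane) (d : Fin (M.p i - 1) → Plane)
    (k : Fin (M.p i - 1)) : legPath i X d ⟨k + 1, by omega⟩ = d k := by
  have := k.2
  rw [legPath, dif_neg (by simp), dif_neg (by simp; omega)]
  rfl

theorem legPath_eq {i : Fin M.n} {X : Plane} {d : Fin (M.p i - 1) → Plane}
    {Q : Fin (M.p i + 1) → Plane} (h0 : Q 0 = M.foot i) (h1 : Q (Fin.last _) = X)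
    (h2 : ∀ k : Fin (M.p i - 1), Q ⟨k + 1, by omega⟩ = d k) (j : Fin (M.p i + 1)) :
    legPath i X d j = Q j := by
  by_cases hj : (j : ℕ) = 0
  · rw [legPath_of_val_eq_zero X d hj, ← h0]
    congr 1
    exact Fin.ext hj.symm
  · by_cases hj' : (j : ℕ) = M.p i
    · rw [legPath_of_val_eq_p X d hj', ← h1]
      congr 1
      exact Fin.ext hj'.symm
    · have e : j = ⟨((⟨j - 1, by omega⟩ : Fin (M.p i - 1)) : ℕ) + 1, by simp; omega⟩ :=
        Fin.ext (by simp; omega)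
      rw [e, legPath_succ, h2]

theorem contDiff_legPath (i : Fin M.n) (X : Plane) (j : Fin (M.p i + 1)) :
    ContDiff ℝ ∞ fun d => legPath i X d j := by
  unfold legPath
  split_ifs
  · exact contDiff_const
  · exact contDiff_const
  · exact contDiff_apply ℝ Plane _

/-- If `X` is not the foot, the leg is completed to a polygon by the bar from `X` to the foot, and a
polygon is moved back so that this bar gets its original position. -/
theorem nonempty_globalDiffeo_closureSpace {i : Fin M.n} {X : Plane} (hX : X ≠ M.foot i) :
    Nonempty (GlobalDiffeo (legSpace i X) (M.closureSpace i X)) := by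
  let A := M.foot i
  let r : ℝ := dist X A
  have hr : r ≠ 0 := dist_ne_zero.2 hX
  have hu : ‖X - A‖ = r := (dist_eq_norm X A).symm
  let F : (Fin (M.p i - 1) → Plane) → Fin (M.p i + 1) → Plane := legPath i X
  let mot : (Fin (M.p i + 1) → Plane) → Plane → Plane := fun P =>
    motion A r (P (Fin.last _) - P 0) (X - A) (P 0)
  let G : (Fin (M.p i + 1) → Plane) → Fin (M.p i - 1) → Plane := fun P k =>
    mot P (P ⟨k + 1, by omega⟩)
  let K := closedPolygons (Fin.snoc (M.len i) (dist X (M.foot i)) : Fin (M.p i + 1) → ℝ)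
  have hnorm : ∀ P ∈ K, ‖P (Fin.last _) - P 0‖ = r := fun P hP => by
    rw [← dist_eq_norm]
    exact (mem_closedPolygons_snoc.1 hP).2
  have hFG : ∀ P ∈ K, ∀ j, legPath i X (G P) j = mot P (P j) := fun P hP =>
    legPath_eq (motion_base ..)
      ((motion_end hr (hnorm P hP) _).trans (add_sub_cancel ..)) fun k => rfl
  have hF : ∀ d ∈ legSpace i X, F d ∈ K := fun d hd => by
    refine mem_closedPolygons_snoc.2 ⟨hd, ?_⟩
    change dist (legPath i X d (Fin.last _)) (legPath i X d 0) = _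
    rw [legPath_of_val_eq_p X d rfl, legPath_of_val_eq_zero X d rfl]
  have hG : ∀ P ∈ K, G P ∈ legSpace i X := fun P hP j => by
    rw [hFG P hP, hFG P hP, dist_motion A hr (hnorm P hP) hu]
    exact (mem_closedPolygons_snoc.1 hP).1 j
  have hGF : ∀ d, G (F d) = d := fun d => by
    funext k
    have h0 : F d 0 = A := legPath_of_val_eq_zero X d rfl
    have h1 : F d (Fin.last _) = X := legPath_of_val_eq_p X d rfl
    change motion A r (F d (Fin.last _) - F d 0) (X - A) (F d 0) (F d _) = d k
    rw [h0, h1, motion_self hr hu]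
    exact legPath_succ X d k
  have hGrel : ∀ (P P' : Fin (M.p i + 1) → Plane) {g : Plane ≃ᵃⁱ[ℝ] Plane},
      IsOrientationPreserving g → (∀ j, P' j = g (P j)) → G P = G P' := by
    intro P P' g hg hgP
    funext k
    change motion A r (P _ - P _) _ (P _) (P _) = motion A r (P' _ - P' _) _ (P' _) (P' _)
    rw [hgP, hgP, hgP, motion_comp hg]
  refine ⟨⟨F, G, ?_, ?_, hF, hG, ?_, ?_, ?_⟩⟩
  · exact contDiff_pi.2 fun j => contDiff_legPath i X j
  · have happ : ∀ j : Fin (M.p i + 1),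
        ContDiff ℝ ∞ fun P : Fin (M.p i + 1) → Plane => P j := fun j => contDiff_apply ℝ Plane j
    exact contDiff_pi.2 fun k => contDiff_motion A r ((happ _).sub (happ _)) contDiff_const
      (happ _) (happ _)
  · rintro P hP P' hP' ⟨g, hg, hgP⟩
    exact hGrel P P' hg hgP
  · exact fun d _ => hGF d
  · intro P hP
    obtain ⟨g, hg, hgx⟩ := exists_motion A hr (hnorm P hP) hu (P 0)
    exact (M.closureSpace i X).rel.symm ⟨g, hg, fun j => (hFG P hP j).trans (hgx _).symm⟩

/-- If `X` is the foot, the leg is a closed polygon, and the direction of its first edge is recorded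
by a point of the circle. -/
theorem nonempty_globalDiffeo_prod_circle (i : Fin M.n) :
    Nonempty (GlobalDiffeo (legSpace i (M.foot i))
      (SmoothQuotient.prod (polygonSpace (M.len i)) unitCircle)) := by
  have hp := M.one_lt_p i
  let A := M.foot i
  let z : Fin (M.p i) := ⟨0, by omega⟩
  let o : Fin (M.p i) := ⟨1, hp⟩
  let r : ℝ := M.len i z
  have hr : r ≠ 0 := (M.len_pos i z).ne'
  have hr0 : 0 ≤ r := (M.len_pos i z).le
  have hrot : ∀ (d : Fin (M.p i - 1) → Plane) (j : Fin (M.p i)),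
      legPath i A d j.succ = legPath i A d (finRotate _ j).castSucc := by
    intro d j
    have hv := val_finRotate j
    split_ifs at hv with h
    · rw [legPath_of_val_eq_p A d (by simpa using h), legPath_of_val_eq_zero A d hv]
    · congr 1
      exact Fin.ext hv.symm
  let F : (Fin (M.p i - 1) → Plane) → (Fin (M.p i) → Plane) × Plane := fun d =>
    (fun j => legPath i A d j.castSucc, r⁻¹ • (legPath i A d o.castSucc - A))
  let mot : (Fin (M.p i) → Plane) × Plane → Plane → Plane := fun P =>
    motion A r (P.1 o - P.1 z) (r • P.2) (P.1 z)
  let G : (Fin (M.p i) → Plane) × Plane → Fin (M.p i - 1) → Plane := fun P k =>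
    mot P (P.1 ⟨k + 1, by omega⟩)
  let K := closedPolygons (M.len i) ×ˢ Metric.sphere (0 : Plane) 1
  have hz : finRotate _ z = o := Fin.ext (by
    rw [val_finRotate, if_neg]
    change ¬ 0 + 1 = M.p i
    omega)
  have hnorm : ∀ P ∈ K, ‖P.1 o - P.1 z‖ = r := fun P hP => by
    rw [← dist_eq_norm, dist_comm, ← hz]
    exact hP.1 z
  have hu : ∀ P ∈ K, ‖r • P.2‖ = r := fun P hP => by
    rw [norm_smul, mem_sphere_zero_iff_norm.1 hP.2, mul_one, Real.norm_of_nonneg hr0]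
  have hFG : ∀ P, ∀ j : Fin (M.p i), legPath i A (G P) j.castSucc = mot P (P.1 j) := by
    intro P j
    let Q : Fin (M.p i + 1) → Plane := Fin.snoc (fun j => mot P (P.1 j)) A
    have hQ := legPath_eq (i := i) (X := A) (d := G P) (Q := Q) ?_ ?_ ?_ j.castSucc
    · rw [hQ]
      exact Fin.snoc_castSucc (α := fun _ => Plane) _ _ _
    · exact (Fin.snoc_castSucc (α := fun _ => Plane) A (fun j => mot P (P.1 j)) z).trans
        (motion_base ..)
    · exact Fin.snoc_last (α := fun _ => Plane) _ _
    · intro k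
      exact Fin.snoc_castSucc (α := fun _ => Plane) A (fun j => mot P (P.1 j)) ⟨k + 1, by omega⟩
  have hz0 : ∀ d, legPath i A d z.castSucc = A := fun d => legPath_of_val_eq_zero A d rfl
  have hedge : ∀ d ∈ legSpace i A, ‖legPath i A d o.castSucc - A‖ = r := fun d hd => by
    have := hd z
    rw [hrot, hz, hz0, dist_comm, dist_eq_norm] at this
    exact this
  have hF : ∀ d ∈ legSpace i A, F d ∈ K := fun d hd => by
    refine ⟨fun j => ?_, ?_⟩
    · have := hd j
      rwa [hrot] at this
    · rw [mem_sphere_zero_iff_norm]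
      change ‖r⁻¹ • _‖ = 1
      rw [norm_smul, hedge d hd, norm_inv, Real.norm_of_nonneg hr0, inv_mul_cancel₀ hr]
  have hG : ∀ P ∈ K, G P ∈ legSpace i A := fun P hP j => by
    rw [hrot, hFG, hFG, dist_motion A hr (hnorm P hP) (hu P hP)]
    exact hP.1 j
  have hGF : ∀ d ∈ legSpace i A, G (F d) = d := fun d hd => by
    funext k
    change motion A r (legPath i A d o.castSucc - legPath i A d z.castSucc)
      (r • r⁻¹ • (legPath i A d o.castSucc - A)) (legPath i A d z.castSucc) (legPath i A d _) = d k
    rw [hz0, smul_smul, mul_inv_cancel₀ hr, one_smul, motion_self hr (hedge d hd)]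
    exact legPath_succ A d k
  have hGrel : ∀ (P P' : (Fin (M.p i) → Plane) × Plane) {g : Plane ≃ᵃⁱ[ℝ] Plane},
      IsOrientationPreserving g → (∀ j, P'.1 j = g (P.1 j)) → P.2 = P'.2 → G P = G P' := by
    intro P P' g hg hgP h2
    funext k
    change motion A r (P.1 _ - P.1 _) (r • P.2) (P.1 _) (P.1 _) =
      motion A r (P'.1 _ - P'.1 _) (r • P'.2) (P'.1 _) (P'.1 _)
    rw [hgP, hgP, hgP, motion_comp hg, h2]
  have hGdir : ∀ P ∈ K, P.2 = r⁻¹ • (legPath i A (G P) o.castSucc - A) := fun P hP => by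
    rw [hFG]
    change P.2 = r⁻¹ • (motion A r (P.1 o - P.1 z) (r • P.2) (P.1 z) (P.1 o) - A)
    rw [motion_end hr (hnorm P hP), add_sub_cancel_left, smul_smul, inv_mul_cancel₀ hr, one_smul]
  have hFs : ContDiff ℝ ∞ F := by
    have h2 : ContDiff ℝ ∞ fun d => r⁻¹ • (legPath i A d o.castSucc - A) :=
      ((contDiff_legPath i A _).sub contDiff_const).const_smul _
    exact (contDiff_pi.2 fun j => contDiff_legPath i A _).prodMk h2
  have hGs : ContDiff ℝ ∞ G := by
    have happ : ∀ j : Fin (M.p i),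
        ContDiff ℝ ∞ fun P : (Fin (M.p i) → Plane) × Plane => P.1 j :=
      fun j => (contDiff_apply ℝ Plane j).comp contDiff_fst
    have hdir : ContDiff ℝ ∞ fun P : (Fin (M.p i) → Plane) × Plane => r • P.2 :=
      contDiff_snd.const_smul r
    exact contDiff_pi.2 fun k => contDiff_motion A r ((happ _).sub (happ _)) hdir (happ _) (happ _)
  refine ⟨⟨F, G, hFs, hGs, hF, hG, ?_, ?_, ?_⟩⟩
  · rintro P hP P' hP' ⟨⟨g, hg, hgP⟩, h2⟩
    exact hGrel P P' hg hgP (congrArg Subtype.val h2)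
  · exact hGF
  · intro P hP
    obtain ⟨g, hg, hgx⟩ := exists_motion A hr (hnorm P hP) (hu P hP) (P.1 z)
    refine ((polygonSpace (M.len i)).prod unitCircle).rel.symm
      ⟨⟨g, hg, fun j => (hFG P j).trans (hgx _).symm⟩, Subtype.ext ?_⟩
    exact hGdir P hP

theorem nonempty_globalDiffeo_closureFactor (i : Fin M.n) (X : Plane) :
    Nonempty (GlobalDiffeo (legSpace i X) (M.closureFactor i X)) := by
  rw [closureFactor]
  split_ifs with h
  · rw [h]
    exact nonempty_globalDiffeo_prod_circle i
  · exact nonempty_globalDiffeo_closureSpace h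

/-! ### The diffeomorphism types of the critical manifolds -/

theorem diffeomorphic_bodyAt {Z : Plane} (hZ : ∀ i, Z ≠ M.foot i) :
    SmoothQuotient.Diffeomorphic (SmoothQuotient.ofSet (M.bodyAt Z))
      (SmoothQuotient.pi fun j : Fin M.n => M.closureSpace j Z) := by
  let D : ∀ i : Fin M.n, GlobalDiffeo (legSpace i Z) (M.closureSpace i Z) :=
    fun i => (nonempty_globalDiffeo_closureSpace (hZ i)).some
  have hmem : ∀ η ∈ M.bodyAt Z, ∀ i, η.2 i ∈ legSpace i Z := fun η hη i => by
    have := mem_spiderSpace_iff_legSpace.1 hη.1 i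
    rwa [hη.2] at this
  refine GlobalDiffeo.diffeomorphic
    { toFun := fun η j => (D j).toFun (η.2 j)
      invFun := fun b => (Z, fun i => (D i).invFun (b i))
      contDiff_toFun := contDiff_pi.2 fun j =>
        (D j).contDiff_toFun.comp (contDiff_pi.1 contDiff_snd j)
      contDiff_invFun := contDiff_const.prodMk
        (contDiff_pi.2 fun i => (D i).contDiff_invFun.comp (contDiff_pi.1 contDiff_id i))
      mapsTo := fun η hη j _ => (D j).mapsTo _ (hmem η hη j)
      mapsTo_inv := fun b hb => ⟨mem_spiderSpace_iff_legSpace.2 fun i =>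
        (D i).mapsTo_inv _ (hb i trivial), rfl⟩
      eq_of_rel := fun b hb b' hb' h => Prod.ext rfl (funext fun i =>
        (D i).eq_of_rel _ (hb i trivial) _ (hb' i trivial) (h i))
      left_inv := fun η hη => Prod.ext hη.2.symm (funext fun i =>
        (D i).left_inv (η.2 i) (hmem η hη i))
      right_inv := fun b hb j => (D j).right_inv _ (hb j trivial) }

/-- The legs outside `I`, described by `p`, vary independently of each other with fixed end
points. -/
theorem diffeomorphic_fixedLegs {ξ : M.Positions} (hξ : ξ ∈ M.spiderSpace)
    (I : Finset (Fin M.n)) (p : Fin M.n → Prop) [Fintype {j // p j}] (hp : ∀ j, p j ↔ j ∉ I) :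
    SmoothQuotient.Diffeomorphic (SmoothQuotient.ofSet (fixedLegs ξ I))
      (SmoothQuotient.pi fun j : {j : Fin M.n // p j} => M.closureFactor j ξ.1) := by
  classical
  let D : ∀ i : Fin M.n, GlobalDiffeo (legSpace i ξ.1) (M.closureFactor i ξ.1) :=
    fun i => (nonempty_globalDiffeo_closureFactor i ξ.1).some
  have hmem : ∀ η ∈ fixedLegs ξ I, ∀ i, η.2 i ∈ legSpace i ξ.1 := fun η hη i => by
    have := mem_spiderSpace_iff_legSpace.1 hη.1 i
    rwa [hη.2.1] at this
  let G : (∀ j : {j : Fin M.n // p j}, (M.closureFactor j ξ.1).V) → M.Positions := fun b =>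
    (ξ.1, fun i => if h : p i then (D i).invFun (b ⟨i, h⟩) else ξ.2 i)
  have hGpos : ∀ b i (h : p i), (G b).2 i = (D i).invFun (b ⟨i, h⟩) := fun b i h => dif_pos h
  have hGneg : ∀ b i, ¬ p i → (G b).2 i = ξ.2 i := fun b i h => dif_neg h
  have hGmem : ∀ b, (∀ j : {j : Fin M.n // p j}, b j ∈ (M.closureFactor j ξ.1).K) →
      G b ∈ fixedLegs ξ I := by
    refine fun b hb => ⟨mem_spiderSpace_iff_legSpace.2 fun i => ?_, rfl, fun i hi =>
      hGneg b i fun h => (hp i).1 h hi⟩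
    by_cases h : p i
    · rw [hGpos b i h]
      exact (D i).mapsTo_inv _ (hb ⟨i, h⟩)
    · rw [hGneg b i h]
      exact mem_spiderSpace_iff_legSpace.1 hξ i
  have hGcont : ∀ i, ContDiff ℝ ∞ fun b => (G b).2 i := fun i => by
    by_cases h : p i
    · simp only [hGpos _ i h]
      exact (D i).contDiff_invFun.comp (contDiff_pi.1 contDiff_id (⟨i, h⟩ : {j // p j}))
    · simp only [hGneg _ i h]
      exact contDiff_const
  have hGF : ∀ η ∈ fixedLegs ξ I, G (fun j => (D j).toFun (η.2 j)) = η := by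
    refine fun η hη => Prod.ext hη.2.1.symm (funext fun i => ?_)
    by_cases h : p i
    · exact (hGpos (fun j => (D j).toFun (η.2 j)) i h).trans
        ((D i).left_inv (η.2 i) (hmem η hη i))
    · refine (hGneg (fun j => (D j).toFun (η.2 j)) i h).trans (hη.2.2 i ?_).symm
      by_contra hi
      exact h ((hp i).2 hi)
  refine GlobalDiffeo.diffeomorphic
    { toFun := fun η j => (D j).toFun (η.2 j)
      invFun := G
      contDiff_toFun := contDiff_pi.2 fun j =>
        (D j).contDiff_toFun.comp (contDiff_pi.1 contDiff_snd (j : Fin M.n))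
      contDiff_invFun := contDiff_const.prodMk (contDiff_pi.2 hGcont)
      mapsTo := fun η hη j _ => (D j).mapsTo _ (hmem η hη j)
      mapsTo_inv := fun b hb => hGmem b fun j => hb j trivial
      eq_of_rel := fun b hb b' hb' hrel => Prod.ext rfl (funext fun i => ?_)
      left_inv := hGF
      right_inv := fun b hb j => ?_ }
  · by_cases h : p i
    · rw [hGpos b i h, hGpos b' i h]
      exact (D i).eq_of_rel _ (hb ⟨i, h⟩ trivial) _ (hb' ⟨i, h⟩ trivial) (hrel ⟨i, h⟩)
    · rw [hGneg b i h, hGneg b' i h]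
  · have key : ∀ d, d = (D j).invFun (b j) → ∀ hd : (D j).toFun d ∈ (M.closureFactor j ξ.1).K,
        (M.closureFactor j ξ.1).rel ⟨(D j).toFun d, hd⟩ ⟨b j, hb j trivial⟩ := by
      rintro _ rfl hd
      exact (D j).right_inv _ (hb j trivial)
    exact key _ (hGpos b j j.2) _

end SpiderMechanism

/-! ### The Morse-Bott property -/

namespace SpiderMechanism

variable {M : SpiderMechanism} {Z : Plane} {ξ η : M.Positions}

theorem extendedLegIndex_congr {i : Fin M.n} (h : leg η i = leg ξ i) :
    extendedLegIndex Z η i = extendedLegIndex Z ξ i := by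
  rw [extendedLegIndex, h, extendedLegIndex]

theorem pairIndex_congr {i k : Fin M.n} (h : leg η i = leg ξ i) :
    pairIndex Z η i k = pairIndex Z ξ i k := by
  rw [pairIndex, pairIndex, legIndex, legIndex, h, (leg_eq_iff.1 h).1]

theorem StronglyGeneric.isMorseBott (hgen : M.StronglyGeneric Z) :
    IsMorseBott (M.sqDist Z) M.spiderSpace where
  manifold := hgen.isSubmanifold_spiderSpace
  smooth := (contDiff_sqDist Z).isSmoothOn _
  critical_manifold x _ := isSubmanifold_connectedComponentIn x fun y hy => by
    have hy' := hy
    rw [hgen.criticalSet_eq] at hy'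
    obtain ⟨C, hyC, hC⟩ : ∃ C, y ∈ C ∧ IsCriticalManifold (M.sqDist Z) M.spiderSpace C := by
      obtain ⟨hyS, hZ | ⟨i, hi, hZ⟩ | ⟨i, k, hik, hi, hk⟩⟩ := hy'
      · exact ⟨M.bodyAt Z, ⟨hyS, hZ⟩, hgen.isCriticalManifold_bodyAt⟩
      · exact ⟨sameLeg y i, ⟨hyS, rfl⟩, hgen.isCriticalManifold_sameLeg hyS hi hZ⟩
      · exact ⟨sameLeg y i ∩ sameLeg y k, ⟨⟨hyS, rfl⟩, hyS, rfl⟩,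
          hgen.isCriticalManifold_sameLeg_inter hyS hik hi hk⟩
    exact ⟨C, hC.subset, hyC, hC.submanifold, hC.isOpen_rel⟩
  nondegenerate x hx := by
    rw [hgen.criticalSet_eq] at hx
    obtain ⟨hxS, hZ | ⟨i, hi, hZ⟩ | ⟨i, k, hik, hi, hk⟩⟩ := hx
    · exact ⟨_, hgen.hasMorseBottIndex_bodyAt ⟨hxS, hZ⟩⟩
    · exact ⟨_, hgen.hasMorseBottIndex_of_mem_legLine hxS hi hZ⟩
    · exact ⟨_, hgen.hasMorseBottIndex_of_two_aligned hxS hik hi hk⟩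

end SpiderMechanism

theorem mainTheorem1 (M : SpiderMechanism) (Z : Plane) (hgen : M.StronglyGeneric Z) :
    -- the squared distance is a Morse-Bott function on the spider space
    IsMorseBott (M.sqDist Z) M.spiderSpace ∧
    -- its critical points are of three kinds
    criticalSet (M.sqDist Z) M.spiderSpace =
      {ξ | ξ ∈ M.spiderSpace ∧ (ξ.1 = Z ∨ (∃ i, LegAligned ξ i ∧ Z ∈ legLine ξ i) ∨
        ∃ i k, i ≠ k ∧ LegAligned ξ i ∧ LegAligned ξ k)} ∧
    -- first kind: the body is at `Z`
    (IsCriticalManifold (M.sqDist Z) M.spiderSpace (M.bodyAt Z) ∧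
      (∀ η ∈ M.bodyAt Z, HasMorseBottIndex (M.sqDist Z) M.spiderSpace η 0) ∧
      SmoothQuotient.Diffeomorphic (SmoothQuotient.ofSet (M.bodyAt Z))
        (SmoothQuotient.pi fun j : Fin M.n => M.closureSpace j Z)) ∧
    -- second kind: one leg `i` is aligned, and `Z` lies on its line
    (∀ ξ ∈ M.spiderSpace, ∀ i, LegAligned ξ i → Z ∈ legLine ξ i →
      IsCriticalManifold (M.sqDist Z) M.spiderSpace (sameLeg ξ i) ∧
      (∀ η ∈ sameLeg ξ i,
        HasMorseBottIndex (M.sqDist Z) M.spiderSpace η (extendedLegIndex Z ξ i)) ∧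
      SmoothQuotient.Diffeomorphic (SmoothQuotient.ofSet (sameLeg ξ i))
        (SmoothQuotient.pi fun j : {j : Fin M.n // j ≠ i} => M.closureFactor j ξ.1)) ∧
    -- third kind: two legs `i` and `k` are aligned
    (∀ ξ ∈ M.spiderSpace, ∀ i k, i ≠ k → LegAligned ξ i → LegAligned ξ k →
      IsCriticalManifold (M.sqDist Z) M.spiderSpace (sameLeg ξ i ∩ sameLeg ξ k) ∧
      quadrantSign (M.foot i) (M.foot k) ξ.1 Z ≠ 0 ∧
      quadrantSign (M.foot k) (M.foot i) ξ.1 Z ≠ 0 ∧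
      (∀ η ∈ sameLeg ξ i ∩ sameLeg ξ k, HasMorseBottIndex (M.sqDist Z) M.spiderSpace η
        (pairIndex Z ξ i k + pairIndex Z ξ k i)) ∧
      SmoothQuotient.Diffeomorphic (SmoothQuotient.ofSet (sameLeg ξ i ∩ sameLeg ξ k))
        (SmoothQuotient.pi fun j : {j : Fin M.n // j ≠ i ∧ j ≠ k} =>
          M.closureFactor j ξ.1)) := by
  refine ⟨hgen.isMorseBott, hgen.criticalSet_eq, ⟨hgen.isCriticalManifold_bodyAt,
    fun η hη => hgen.hasMorseBottIndex_bodyAt hη, diffeomorphic_bodyAt hgen.ne_foot⟩, ?_, ?_⟩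
  · intro ξ hξ i hi hZ
    refine ⟨hgen.isCriticalManifold_sameLeg hξ hi hZ, fun η hη => ?_, ?_⟩
    · rw [← extendedLegIndex_congr hη.2]
      exact hgen.hasMorseBottIndex_of_mem_legLine hη.1 ((legAligned_congr hη.2).2 hi)
        (by rwa [legLine_congr hη.2])
    · rw [sameLeg_eq_fixedLegs]
      exact diffeomorphic_fixedLegs hξ {i} _ (by simp)
  · intro ξ hξ i k hik hi hk
    obtain ⟨ci, ck, -, hci, hck, hsi, hsk⟩ := hgen.exists_stress_coefficients hξ hik hi hk
    refine ⟨hgen.isCriticalManifold_sameLeg_inter hξ hik hi hk, ?_, ?_, ?_, ?_⟩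
    · rwa [hsi, Ne, sign_eq_zero_iff]
    · rwa [hsk, Ne, sign_eq_zero_iff]
    · rintro η ⟨⟨hη, hηi⟩, -, hηk⟩
      rw [← pairIndex_congr hηi, ← pairIndex_congr hηk]
      exact hgen.hasMorseBottIndex_of_two_aligned hη hik ((legAligned_congr hηi).2 hi)
        ((legAligned_congr hηk).2 hk)
    · rw [sameLeg_inter_eq_fixedLegs]
      exact diffeomorphic_fixedLegs hξ {i, k} _ (by simp)
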